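/- **Setting.** Let $d\ge 1$, $T>0$, and let $U$ be a compact metric space. $\mathcal P_c(\mathbb R^d)$ is the set of Borel probability measures with compact support, $\mathcal P(K)$ the set of those concentrated on $K$, $W_p$ the Wasserstein distances, $\Gamma_o(\mu,\nu)$ the set of $2$-optimal transport plans, $\mathcal M_1(\mu)=\int|x|\,d\mu(x)$, and $B_R(\mu)=\bigcup_{x\in\operatorname{supp}\mu}B(x,R)$. Fix $v:[0,T]\times\mathcal P_c(\mathbb R^d)\times U\times\mathbb R^d\to\mathbb R^d$, $\varphi:\mathcal P_c(\mathbb R^d)\to\mathbb R$ and $\mu^0\in\mathcal P_c(\mathbb R^d)$. *Wasserstein gradients.* For $\phi:\mathcal P_c(\mathbb R^d)\to\mathbb R$, a map $\xi\in L^2(\mu;\mathbb R^d)$ belongs to $\partial^-\phi(\mu)$ if for every $R>0$ $$\phi(\nu)-\phi(\mu)\ \ge \inf_{\gamma\in\Gamma_o(\mu,\nu)}\int\langle \xi(x),y-x\rangle\,d\gamma(x,y)+o_R(W_2(\mu,\nu))\qquad\text{for }\nu\in\mathcal P(B_R(\mu)),$$ and $\xi\in\partial^+\phi(\mu)$ if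 $-\xi\in\partial^-(-\phi)(\mu)$. The functional $\phi$ is locally differentiable at $\mu$ if there is an element $\nabla\phi(\mu)$ of $\partial^-\phi(\mu)\cap\partial^+\phi(\mu)$ that lies in the tangent space $\mathrm{Tan}_\mu=\overline{\{\nabla\zeta:\zeta\in C_c^\infty(\mathbb R^d)\}}^{L^2(\mu)}$ (it is then unique in $\mathrm{Tan}_\mu$). For vector-valued $\phi$, $\mathrm D\phi(\mu)(y)$ is the matrix whose rows are the gradients $\nabla\phi_i(\mu)(y)$ of the components. *Standing hypotheses.* 1. For all $(\mu,u,x)$, $t\mapsto v(t,\mu,u,x)$ is Lebesgue measurable; there is $m\in L^1([0,T],\mathbb R_+)$ with $|v(t,\mu,u,x)|\le m(t)(1+|x|+\mathcal M_1(\mu))$ for a.e. $t$ and all $(\mu,u,x)$. 2. For each $R>0$ and $K=B(0,R)$ there are $l_K,L_K\in L^1([0,T],\mathbb R_+)$ such that for a.e. $t$, all $u\in U$, $\mu,\nu\in\mathcal P(K)$ and $x,y\in K$: $|v(t,\mu,u,x)-v(t,\mu,u,y)|\le l_K(t)|x-y|$ and $|v(t,\mu,u,x)-v(t,\nu,u,x)|\le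 L_K(t)W_1(\mu,\nu)$. 3. For a.e. $t$ and all $u$: $x\mapsto v(t,\mu,u,x)$ is differentiable for every $\mu$; $\mu\mapsto v(t,\mu,u,x)$ is locally differentiable for every $x$; and, for every $K=B(0,R)$, the maps $(\mu,x)\mapsto \mathrm D_xv(t,\mu,u,x)$ and (for a suitable representative) $(\mu,x,y)\mapsto \mathrm D_\mu v(t,\mu,u,x)(y)$ are continuous on $\mathcal P(K)\times K$ and $\mathcal P(K)\times K\times K$, where $\mathcal P(K)$ carries $W_1$. 4. For a.e. $t$ and all $(\mu,x)$, $u\mapsto v(t,\mu,u,x)$ is continuous. 5. $\varphi$ is $W_1$-Lipschitz on $\mathcal P(K)$ for every $K=B(0,R)$, and locally differentiable at every $\mu\in\mathcal P_c(\mathbb R^d)$ with a gradient $\nabla\varphi(\mu)$ that has a continuous representative. *Control problem.* Controls are Lebesgue measurable maps $u:[0,T]\to U$. For $\tau\in[0,T]$, a trajectory driven by $u$ from $(\tau,\mu_\tau)$ is a $W_1$-continuous curve $\mu:[\tau,T]\to\mathcal P_c(\mathbb R^d)$ with $\mu(\tau)=\mu_\tau$ that solves $\partial_t\mu(t)+\mathrm{div}_x(v(t,\mu(t),u(t))\mu(t))=0$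 in the sense of distributions. A pair $(\mu,u)$ is admissible if $u$ is a control and $\mu$ is a trajectory driven by $u$ from $(0,\mu^0)$; it is optimal if it is admissible and minimises $\varphi(\mu(T))$ among all admissible pairs. The value function is $$\mathcal V(\tau,\mu_\tau)=\inf\{\varphi(\mu(T)) : \mu\text{ is a trajectory from }(\tau,\mu_\tau)\text{ driven by some control}\}.$$ *Maximum principle.* Let $\mathbb H(t,\nu,u)=\int_{\mathbb R^{2d}}\langle r,v(t,\pi^1_\#\nu,u,x)\rangle\,d\nu(x,r)$ for $\nu\in\mathcal P_c(\mathbb R^{2d})$. A curve $\nu^*:[0,T]\to\mathcal P_c(\mathbb R^{2d})$ satisfies the PMP along $(\mu^*,u^*)$ if - for some $R'>0$ and $m'\in L^1([0,T],\mathbb R_+)$, $\operatorname{supp}\nu^*(t)\subset B(0,R')\times B(0,R')$ for all $t\in[0,T]$ and $W_1(\nu^*(\tau),\nu^*(t))\le\int_\tau^t m'(s)\,ds$ for $0\le\tau\le t\le T$; - $\partial_t\nu^*(t)+\mathrm{div}_{(x,r)}\big(\mathbb J\,\nabla_\nu\mathbb H(t,\nu^*(t),u^*(t))\,\nu^*(t)\big)=0$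 in the sense of distributions, where $\mathbb J(a,b)=(b,-a)$ and $$\nabla_\nu\mathbb H(t,\nu^*(t),u^*(t))(x,r)=\Big(\mathrm D_xv(t,\mu^*(t),u^*(t),x)^\top r+\int \mathrm D_\mu v(t,\mu^*(t),u^*(t),y)(x)^\top p\,d\nu^*(t)(y,p),\ \ v(t,\mu^*(t),u^*(t),x)\Big);$$ - $\pi^1_\#\nu^*(t)=\mu^*(t)$ for all $t\in[0,T]$, and $\nu^*(T)=(\mathrm{Id},-\nabla\varphi(\mu^*(T)))_\#\mu^*(T)$; - $\mathbb H(t,\nu^*(t),u^*(t))=\max_{u\in U}\mathbb H(t,\nu^*(t),u)$ for a.e. $t\in[0,T]$. Let $\bar\nu^*(t)(x)=\int r\,d\nu^*_x(t)(r)$ be the barycentric projection of $\nu^*(t)$, where $(\nu_x^*(t))_x$ is the disintegration of $\nu^*(t)$ against its first marginal $\mu^*(t)$. *Dini superdifferential.* A pair $(\delta,\xi)\in\mathbb R\times L^2(\mu;\mathbb R^d)$ belongs to $\eth^+\mathcal V(\tau,\mu)$ if for all $h\in\mathbb R$ and $\mathcal F\in L^\infty(\mu;\mathbb R^d)$ $$\limsup_{\epsilon\to0^+}\frac{\mathcal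 V(\tau+\epsilon h,(\mathrm{Id}+\epsilon\mathcal F)_\#\mu)-\mathcal V(\tau,\mu)}{\epsilon}\ \le\ \int\langle\xi(x),\mathcal F(x)\rangle\,d\mu(x)+\delta h .$$ **Theorem.** Let $(\mu^*,u^*)$ be an admissible pair, and suppose that there exists a state-costate curve $\nu^*$ that satisfies the PMP along $(\mu^*,u^*)$ together with $$\big(\mathbb H(t,\nu^*(t),u^*(t)),\,-\bar\nu^*(t)\big)\in\eth^+\mathcal V(t,\mu^*(t))\qquad\text{for a.e. }t\in[0,T].$$ Then $(\mu^*,u^*)$ is optimal. -/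

import Mathlib

open MeasureTheory Set Filter Topology
open scoped ENNReal ContDiff InnerProductSpace

namespace MeanField

noncomputable section

/-! ### Compactly supported probability measures, transport plans, Wasserstein distances -/

/-- `𝓟_c(X)`: Borel probability measures with compact support. -/
structure Pc (X : Type*) [TopologicalSpace X] [MeasurableSpace X] where
  toMeasure : Measure X
  isProb : IsProbabilityMeasure toMeasure
  isCompact_support : IsCompact toMeasure.support

instance {X : Type*} [TopologicalSpace X] [MeasurableSpace X] (μ : Pc X) :
    IsProbabilityMeasure μ.toMeasure := μ.isProb

/-- The set `𝓟(K)` of the measures that are concentrated on `K`. -/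
def POn {X : Type*} [TopologicalSpace X] [MeasurableSpace X] (K : Set X) : Set (Pc X) :=
  {μ | μ.toMeasure Kᶜ = 0}

/-- The `R`-fattening `B_R(μ)` of the support of `μ`. -/
def fattening {X : Type*} [PseudoMetricSpace X] [MeasurableSpace X] (R : ℝ) (μ : Pc X) : Set X :=
  ⋃ x ∈ μ.toMeasure.support, Metric.closedBall x R

/-- A continuous image of a compactly supported measure is compactly supported. -/
def Pc.map {X Y : Type*} [TopologicalSpace X] [HereditarilyLindelofSpace X] [MeasurableSpace X]
    [OpensMeasurableSpace X] [TopologicalSpace Y] [T2Space Y] [MeasurableSpace Y] [BorelSpace Y]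
    (μ : Pc X) (f : X → Y) (hf : Continuous f) : Pc Y where
  toMeasure := μ.toMeasure.map f
  isProb := Measure.isProbabilityMeasure_map hf.measurable.aemeasurable
  isCompact_support := by
    have hK : IsCompact (f '' μ.toMeasure.support) := μ.isCompact_support.image hf
    refine hK.of_isClosed_subset Measure.isClosed_support
      (Measure.support_subset_of_isClosed hK.isClosed ?_)
    rw [mem_ae_iff, Measure.map_apply hf.measurable hK.isClosed.measurableSet.compl]
    refine measure_mono_null ?_ (Measure.measure_compl_support (μ := μ.toMeasure))
    intro x hx hx'
    exact hx ⟨x, hx', rfl⟩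

/-- The set `Γ(μ, ν)` of transport plans. -/
def plans {X : Type*} [MeasurableSpace X] (μ ν : Measure X) : Set (Measure (X × X)) :=
  {γ | IsProbabilityMeasure γ ∧ γ.map Prod.fst = μ ∧ γ.map Prod.snd = ν}

/-- The transport cost `∫ |x - y|^p dγ`. -/
def cost {X : Type*} [PseudoEMetricSpace X] [MeasurableSpace X] (p : ℝ)
    (γ : Measure (X × X)) : ℝ≥0∞ :=
  ∫⁻ z, edist z.1 z.2 ^ p ∂γ

/-- The Wasserstein distance `W_p`; it is finite between compactly supported measures. -/
def wass {X : Type*} [PseudoEMetricSpace X] [MeasurableSpace X] (p : ℝ) (μ ν : Pc X) : ℝ :=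
  ((⨅ γ ∈ plans μ.toMeasure ν.toMeasure, cost p γ) ^ (1 / p)).toReal

/-- The set `Γ_o(μ, ν)` of `2`-optimal transport plans. -/
def optPlans {X : Type*} [PseudoEMetricSpace X] [MeasurableSpace X] (μ ν : Pc X) :
    Set (Measure (X × X)) :=
  {γ | γ ∈ plans μ.toMeasure ν.toMeasure ∧
    ∀ γ' ∈ plans μ.toMeasure ν.toMeasure, cost 2 γ ≤ cost 2 γ'}

/-- Continuity of `(μ, y) ↦ f μ y` on `𝓟₁(K) × S`, where `𝓟₁(K)` is `𝓟(K)` with the distance `W₁`. -/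
def JointlyContinuous {X Y Z : Type*} [PseudoEMetricSpace X] [MeasurableSpace X]
    [PseudoMetricSpace Y] [PseudoMetricSpace Z] (K : Set X) (S : Set Y) (f : Pc X → Y → Z) : Prop :=
  ∀ μ ∈ POn K, ∀ y ∈ S, ∀ ε > 0, ∃ δ > 0, ∀ μ' ∈ POn K, ∀ y' ∈ S,
    wass 1 μ μ' < δ → dist y y' < δ → dist (f μ y) (f μ' y') < ε

/-! ### Wasserstein gradients -/

/-- The state space `ℝ^d`. -/
abbrev E (d : ℕ) := EuclideanSpace ℝ (Fin d)

/-- `ξ` belongs to the localised classical Fréchet subdifferential `∂⁻φ(μ)`. -/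
def IsSubgradient {d : ℕ} (φ : Pc (E d) → ℝ) (μ : Pc (E d)) (ξ : E d → E d) : Prop :=
  MemLp ξ 2 μ.toMeasure ∧
    ∀ R > 0, ∀ ε > 0, ∃ δ > 0, ∀ ν ∈ POn (fattening R μ), wass 2 μ ν ≤ δ →
      sInf ((fun γ : Measure (E d × E d) => ∫ z, ⟪ξ z.1, z.2 - z.1⟫_ℝ ∂γ) '' optPlans μ ν)
        - ε * wass 2 μ ν ≤ φ ν - φ μ

/-- `ξ` belongs to the localised classical Fréchet superdifferential `∂⁺φ(μ)`. -/
def IsSupergradient {d : ℕ} (φ : Pc (E d) → ℝ) (μ : Pc (E d)) (ξ : E d → E d) : Prop :=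
  IsSubgradient (fun ρ => -φ ρ) μ (fun x => -ξ x)

/-- `ξ` belongs to the analytical tangent space at `μ`, the `L²(μ)`-closure of the gradients of
smooth compactly supported functions. -/
def IsTangent {d : ℕ} (μ : Pc (E d)) (ξ : E d → E d) : Prop :=
  MemLp ξ 2 μ.toMeasure ∧
    ∀ ε > 0, ∃ ζ : E d → ℝ, ContDiff ℝ ∞ ζ ∧ HasCompactSupport ζ ∧
      eLpNorm (fun x => ξ x - gradient ζ x) 2 μ.toMeasure < ENNReal.ofReal ε

/-- `ξ` is (a representative of) the Wasserstein gradient `∇φ(μ)`: the tangent element lying in both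
the sub- and the superdifferential. It is unique `μ`-almost everywhere. (Outside the tangent space
there is no uniqueness: vector fields orthogonal to it do not change the two inequalities.) -/
def IsWassersteinGradient {d : ℕ} (φ : Pc (E d) → ℝ) (μ : Pc (E d)) (ξ : E d → E d) : Prop :=
  IsTangent μ ξ ∧ IsSubgradient φ μ ξ ∧ IsSupergradient φ μ ξ

/-! ### Continuity equations -/

/-- The `W₁`-continuous curve `μ` of compactly supported measures solves
`∂ₜμ + div(w(t) μ(t)) = 0` on `[a, b]` in the sense of distributions: for each test function `ψ`,
the map `t ↦ ∫ ψ dμ(t)` is absolutely continuous with derivative `∫ ⟨∇ψ, w(t)⟩ dμ(t)` a.e. -/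
def SolvesCE {X : Type*} [NormedAddCommGroup X] [NormedSpace ℝ X] [MeasurableSpace X]
    (a b : ℝ) (w : ℝ → X → X) (μ : ℝ → Pc X) : Prop :=
  (∀ t ∈ Icc a b, Tendsto (fun s => wass 1 (μ s) (μ t)) (𝓝[Icc a b] t) (𝓝 0)) ∧
  (∀ᵐ t ∂volume.restrict (Icc a b), Integrable (w t) (μ t).toMeasure) ∧
  ∀ ψ : X → ℝ, ContDiff ℝ ∞ ψ → HasCompactSupport ψ →
    IntegrableOn (fun t => ∫ x, fderiv ℝ ψ x (w t x) ∂(μ t).toMeasure) (Icc a b) ∧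
    ∀ t ∈ Icc a b, ∫ x, ψ x ∂(μ t).toMeasure =
      ∫ x, ψ x ∂(μ a).toMeasure + ∫ s in a..t, ∫ x, fderiv ℝ ψ x (w s x) ∂(μ s).toMeasure

/-! ### The control problem: dynamics `v(t, μ, u, x)` and final cost `φ` -/

/-- `Dv t μ u x y` is the matrix `D_μ v(t, μ, u, x)(y)`, whose rows are the values at `y` of the
Wasserstein gradients of the components of `ρ ↦ v(t, ρ, u, x)` at `μ`, chosen continuous in
`(μ, x, y)`. -/
def IsMeasureDerivative {d : ℕ} {U : Type*} (T : ℝ) (v : ℝ → Pc (E d) → U → E d → E d)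
    (Dv : ℝ → Pc (E d) → U → E d → E d → (E d →L[ℝ] E d)) : Prop :=
  (∀ᵐ t ∂volume.restrict (Icc 0 T), ∀ u μ x, ∀ i : Fin d,
    IsWassersteinGradient (fun ρ => v t ρ u x i) μ
      (fun y => ContinuousLinearMap.adjoint (Dv t μ u x y) (EuclideanSpace.single i 1))) ∧
  ∀ R > 0, ∀ᵐ t ∂volume.restrict (Icc 0 T), ∀ u,
    JointlyContinuous (Metric.closedBall (0 : E d) R)
      (Metric.closedBall (0 : E d) R ×ˢ Metric.closedBall (0 : E d) R)
      (fun μ z => Dv t μ u z.1 z.2)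

/-- The standing regularity assumptions on the dynamics and on the final cost. -/
structure Hypotheses {d : ℕ} {U : Type*} [TopologicalSpace U] (T : ℝ)
    (v : ℝ → Pc (E d) → U → E d → E d) (φ : Pc (E d) → ℝ) : Prop where
  measurable_time : ∀ μ u x,
    AEStronglyMeasurable (fun t => v t μ u x) (volume.restrict (Icc 0 T))
  sublinear : ∃ m : ℝ → ℝ, (∀ t, 0 ≤ m t) ∧ IntegrableOn m (Icc 0 T) ∧
    ∀ᵐ t ∂volume.restrict (Icc 0 T), ∀ u μ x,
      ‖v t μ u x‖ ≤ m t * (1 + ‖x‖ + ∫ y, ‖y‖ ∂μ.toMeasure)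
  lipschitz : ∀ R > 0, ∃ l L : ℝ → ℝ, (∀ t, 0 ≤ l t) ∧ (∀ t, 0 ≤ L t) ∧
    IntegrableOn l (Icc 0 T) ∧ IntegrableOn L (Icc 0 T) ∧
    ∀ᵐ t ∂volume.restrict (Icc 0 T), ∀ u,
      ∀ μ ∈ POn (Metric.closedBall (0 : E d) R), ∀ ν ∈ POn (Metric.closedBall (0 : E d) R),
      ∀ x ∈ Metric.closedBall (0 : E d) R, ∀ y ∈ Metric.closedBall (0 : E d) R,
        ‖v t μ u x - v t μ u y‖ ≤ l t * ‖x - y‖ ∧ ‖v t μ u x - v t ν u x‖ ≤ L t * wass 1 μ ν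
  differentiable_space : ∀ᵐ t ∂volume.restrict (Icc 0 T), ∀ u μ, Differentiable ℝ (v t μ u)
  continuous_space_derivative : ∀ R > 0, ∀ᵐ t ∂volume.restrict (Icc 0 T), ∀ u,
    JointlyContinuous (Metric.closedBall (0 : E d) R) (Metric.closedBall (0 : E d) R)
      (fun μ x => fderiv ℝ (v t μ u) x)
  differentiable_measure : ∃ Dv, IsMeasureDerivative T v Dv
  continuous_control : ∀ᵐ t ∂volume.restrict (Icc 0 T), ∀ μ x, Continuous (fun u => v t μ u x)
  cost_lipschitz : ∀ R > 0, ∃ L : ℝ,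
    ∀ μ ∈ POn (Metric.closedBall (0 : E d) R), ∀ ν ∈ POn (Metric.closedBall (0 : E d) R),
      |φ μ - φ ν| ≤ L * wass 1 μ ν
  cost_differentiable : ∀ μ, ∃ g, Continuous g ∧ IsWassersteinGradient φ μ g

/-- The set of admissible controls: Lebesgue measurable maps `[0, T] → U`. -/
def controls (U : Type*) [MeasurableSpace U] (T : ℝ) : Set (ℝ → U) :=
  {u | AEMeasurable u (volume.restrict (Icc 0 T))}

/-- `μ` solves the controlled Cauchy problem on `[τ, T]` with `μ(τ) = μτ`, driven by `u`. -/
def IsTrajectory {d : ℕ} {U : Type*} (T : ℝ) (v : ℝ → Pc (E d) → U → E d → E d)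
    (τ : ℝ) (μτ : Pc (E d)) (μ : ℝ → Pc (E d)) (u : ℝ → U) : Prop :=
  SolvesCE τ T (fun t => v t (μ t) (u t)) μ ∧ μ τ = μτ

/-- Admissible trajectory-control pairs for the problem started at `μ₀` at time `0`. -/
def IsAdmissible {d : ℕ} {U : Type*} [MeasurableSpace U] (T : ℝ)
    (v : ℝ → Pc (E d) → U → E d → E d) (μ₀ : Pc (E d)) (μ : ℝ → Pc (E d)) (u : ℝ → U) : Prop :=
  u ∈ controls U T ∧ IsTrajectory T v 0 μ₀ μ u

/-- Admissible pairs that minimise the final cost among all admissible pairs. -/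
def IsOptimal {d : ℕ} {U : Type*} [MeasurableSpace U] (T : ℝ)
    (v : ℝ → Pc (E d) → U → E d → E d) (φ : Pc (E d) → ℝ) (μ₀ : Pc (E d))
    (μ : ℝ → Pc (E d)) (u : ℝ → U) : Prop :=
  IsAdmissible T v μ₀ μ u ∧ ∀ μ' u', IsAdmissible T v μ₀ μ' u' → φ (μ T) ≤ φ (μ' T)

/-- The value function `𝒱(τ, μτ)`. -/
def value {d : ℕ} {U : Type*} [MeasurableSpace U] (T : ℝ)
    (v : ℝ → Pc (E d) → U → E d → E d) (φ : Pc (E d) → ℝ) (τ : ℝ) (μτ : Pc (E d)) : ℝ :=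
  sInf {c | ∃ u ∈ controls U T, ∃ μ, IsTrajectory T v τ μτ μ u ∧ c = φ (μ T)}

/-! ### The Pontryagin maximum principle -/

/-- The first marginal `π¹_# ν` of a measure on the state-costate space. -/
def Pc.fst {d : ℕ} (ν : Pc (E d × E d)) : Pc (E d) := ν.map Prod.fst continuous_fst

/-- The Hamiltonian `ℍ(t, ν, u) = ∫ ⟨r, v(t, π¹_# ν, u, x)⟩ dν(x, r)`. -/
def hamiltonian {d : ℕ} {U : Type*} (v : ℝ → Pc (E d) → U → E d → E d)
    (t : ℝ) (ν : Pc (E d × E d)) (u : U) : ℝ :=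
  ∫ z, ⟪z.2, v t ν.fst u z.1⟫_ℝ ∂ν.toMeasure

/-- The Wasserstein gradient of the Hamiltonian with respect to `ν`, evaluated at `z = (x, r)`. -/
def hamiltonianGrad {d : ℕ} {U : Type*} (v : ℝ → Pc (E d) → U → E d → E d)
    (Dv : ℝ → Pc (E d) → U → E d → E d → (E d →L[ℝ] E d))
    (t : ℝ) (ν : Pc (E d × E d)) (u : U) (z : E d × E d) : E d × E d :=
  (ContinuousLinearMap.adjoint (fderiv ℝ (v t ν.fst u) z.1) z.2 +
      ∫ q, ContinuousLinearMap.adjoint (Dv t ν.fst u q.1 z.1) q.2 ∂ν.toMeasure,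
    v t ν.fst u z.1)

/-- The action of the symplectic matrix with blocks `0, Id, -Id, 0`. -/
def symplectic {d : ℕ} (z : E d × E d) : E d × E d := (z.2, -z.1)

/-- The state-costate curve `ν` satisfies the Pontryagin maximum principle along `(μ, u)`.
The product `E d × E d` carries the maximum norm, which is equivalent to the Euclidean norm of
`ℝ^{2d}`; this only affects the bound in `abs_continuous` by a constant factor. The dynamics and the
terminal condition do not depend on the representatives of the Wasserstein gradients. -/
structure SatisfiesPMP {d : ℕ} {U : Type*} (T : ℝ) (v : ℝ → Pc (E d) → U → E d → E d)
    (φ : Pc (E d) → ℝ) (μ : ℝ → Pc (E d)) (u : ℝ → U) (ν : ℝ → Pc (E d × E d)) : Prop where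
  support_bound : ∃ R > 0, ∀ t ∈ Icc 0 T,
    ν t ∈ POn (Metric.closedBall (0 : E d) R ×ˢ Metric.closedBall (0 : E d) R)
  abs_continuous : ∃ m : ℝ → ℝ, (∀ t, 0 ≤ m t) ∧ IntegrableOn m (Icc 0 T) ∧
    ∀ τ t, 0 ≤ τ → τ ≤ t → t ≤ T → wass 1 (ν τ) (ν t) ≤ ∫ s in τ..t, m s
  dynamics : ∃ Dv, IsMeasureDerivative T v Dv ∧
    SolvesCE 0 T (fun t z => symplectic (hamiltonianGrad v Dv t (ν t) (u t) z)) ν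
  marginal : ∀ t ∈ Icc 0 T, (ν t).fst = μ t
  terminal : ∃ g, Continuous g ∧ IsWassersteinGradient φ (μ T) g ∧
    (ν T).toMeasure = (μ T).toMeasure.map (fun x => (x, -g x))
  maximisation : ∀ᵐ t ∂volume.restrict (Icc 0 T),
    ∀ u', hamiltonian v t (ν t) u' ≤ hamiltonian v t (ν t) (u t)

/-- The barycentric projection `ν̄(x) = ∫ r dν_x(r)` onto the first marginal, where `(ν_x)` is the
disintegration of `ν` against its first marginal. -/
def barycenter {d : ℕ} (ν : Pc (E d × E d)) (x : E d) : E d :=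
  ∫ r, r ∂(ν.toMeasure.condKernel x)

/-! ### Dini superdifferential -/

/-- The measure `(Id + ε F)_# μ` for `F ∈ L^∞(μ)`; its support is again compact. -/
def Pc.perturb {d : ℕ} (μ : Pc (E d)) (F : Lp (E d) ⊤ μ.toMeasure) (ε : ℝ) : Pc (E d) where
  toMeasure := μ.toMeasure.map (fun x => x + ε • F x)
  isProb := Measure.isProbabilityMeasure_map
    (aemeasurable_id.add ((Lp.aestronglyMeasurable F).aemeasurable.const_smul ε))
  isCompact_support := by
    obtain ⟨C, hC⟩ : ∃ C : ℝ, ∀ᵐ x ∂μ.toMeasure, ‖F x‖ ≤ C := by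
      refine ⟨(eLpNormEssSup F μ.toMeasure).toReal, ?_⟩
      have hfin : eLpNormEssSup F μ.toMeasure ≠ ⊤ := by
        have := Lp.eLpNorm_ne_top F
        rwa [eLpNorm_exponent_top] at this
      filter_upwards [enorm_ae_le_eLpNormEssSup F μ.toMeasure] with x hx
      rw [← toReal_enorm]
      exact ENNReal.toReal_mono hfin hx
    obtain ⟨R, hR⟩ := μ.isCompact_support.isBounded.subset_closedBall (0 : E d)
    have hmeas : AEMeasurable (fun x => x + ε • F x) μ.toMeasure :=
      aemeasurable_id.add ((Lp.aestronglyMeasurable F).aemeasurable.const_smul ε)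
    refine (isCompact_closedBall (0 : E d) (R + |ε| * C)).of_isClosed_subset
      Measure.isClosed_support
      (Measure.support_subset_of_isClosed Metric.isClosed_closedBall ?_)
    rw [mem_ae_map_iff hmeas Metric.isClosed_closedBall.measurableSet]
    filter_upwards [hC, Measure.support_mem_ae (μ := μ.toMeasure)] with x hx hxs
    have h1 : ‖x‖ ≤ R := by simpa using hR hxs
    simp only [mem_preimage, mem_closedBall_zero_iff]
    calc ‖x + ε • F x‖ ≤ ‖x‖ + ‖ε • F x‖ := norm_add_le _ _
      _ = ‖x‖ + |ε| * ‖F x‖ := by rw [norm_smul, Real.norm_eq_abs]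
      _ ≤ R + |ε| * C := by gcongr

/-- The upper Dini derivative of `V` at `(τ, μ)` in the direction `(h, F)`, an extended real. -/
def upperDini {d : ℕ} (V : ℝ → Pc (E d) → ℝ) (τ : ℝ) (μ : Pc (E d)) (h : ℝ)
    (F : Lp (E d) ⊤ μ.toMeasure) : EReal :=
  limsup (fun ε : ℝ => (((V (τ + ε * h) (μ.perturb F ε) - V τ μ) / ε : ℝ) : EReal)) (𝓝[>] 0)

/-- The pair `(δ, ξ)` belongs to the localised Dini superdifferential of `V` at `(τ, μ)`. -/
def MemDiniSuperdifferential {d : ℕ} (V : ℝ → Pc (E d) → ℝ) (τ : ℝ) (μ : Pc (E d))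
    (δ : ℝ) (ξ : E d → E d) : Prop :=
  MemLp ξ 2 μ.toMeasure ∧ ∀ (h : ℝ) (F : Lp (E d) ⊤ μ.toMeasure),
    upperDini V τ μ h F ≤ ((∫ x, ⟪ξ x, F x⟫_ℝ ∂μ.toMeasure + δ * h : ℝ) : EReal)

end

end MeanField

open scoped BoundedContinuousFunction
set_option linter.unusedSectionVars false
set_option maxSynthPendingDepth 3

namespace MeanField

/-! ### Absolutely continuous functions on an interval -/

/-! The proof is a verification argument: it suffices that f(t) = 𝒱(t, μ*(t)) does not increase,
because then φ(μ*(T)) = 𝒱(T, μ*(T)) ≤ 𝒱(0, μ⁰), which is at most the cost of any competitor. At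
almost every t, the superdifferential inclusion is tested in the direction h = 1, 𝓕 = v(t, μ*(t),
u*(t), ·). Disintegrating ν*(t) over its marginal μ*(t) shows that ∫⟨ν̄*, 𝓕⟩ dμ* is the Hamiltonian
(`integral_inner_barycenter`). The two terms of the bound cancel, and the upper Dini derivative of 𝒱
in this direction is at most 0.

To pass from the straight perturbation (Id + ε𝓕)_#μ*(t) to μ*(t + ε), two facts are combined in
`Hypotheses.ae_value_le`. The value function is locally W₁-Lipschitz in the measure, uniformly in
time (`Hypotheses.exists_value_lipschitz`), and the two measures are o(ε) apart in W₁ for a.e. t.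
The latter holds because μ*(t) is the image of μ⁰ under a flow, all of whose curves are
right-differentiable at a.e. common time (`IsFlow.ae_tendsto_integral`).

An a.e. sign of the derivative alone does not make f monotone. The one-sided bound f(t) − f(s) ≤ ∫ m
(`Hypotheses.exists_value_rate`) fills the gap: ∫ m − f is then monotone, and the integral of the
derivative of a monotone function is at most its increment (`le_of_ae_right_derivative_nonpos`). No
continuity of f is needed.

The remaining work is the well-posedness of the continuity equation. Supports are bounded by testing
with (1 + |x|²)^p and letting p → ∞. Trajectories exist by a Picard iteration for the nonlocal
characteristics (`exists_integral_curve`). Solutions for a given Lipschitz field are unique by a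
dual Euler scheme (`SolvesCE.eq_of_eq_left`), so that every trajectory is a push-forward by a flow.
Truncating the position outside a large ball turns the local hypotheses into global ones without
changing the trajectories. -/

theorem absolutelyContinuousOnInterval_of_le_integral {F : Type*} [SeminormedAddCommGroup F]
    {h : ℝ → F} {m : ℝ → ℝ} {a b : ℝ}
    (hab : a ≤ b) (hm : IntervalIntegrable m volume a b)
    (H : ∀ s t, a ≤ s → s ≤ t → t ≤ b → ‖h t - h s‖ ≤ ∫ r in s..t, m r) :
    AbsolutelyContinuousOnInterval h a b := by
  have hM := hm.absolutelyContinuousOnInterval_intervalIntegral (c := a) (by simp)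
  rw [absolutelyContinuousOnInterval_iff] at hM ⊢
  intro ε hε
  obtain ⟨δ, hδ, hd⟩ := hM ε hε
  refine ⟨δ, hδ, fun J hJ hs => lt_of_le_of_lt (Finset.sum_le_sum fun i hi => ?_) (hd J hJ hs)⟩
  have hint : ∀ t, a ≤ t → t ≤ b → IntervalIntegrable m volume a t := fun t h1 h2 =>
    hm.mono_set (by rw [uIcc_of_le h1, uIcc_of_le hab]; exact Icc_subset_Icc_right h2)
  have key : ∀ s t, a ≤ s → s ≤ t → t ≤ b →
      ‖h t - h s‖ ≤ |(∫ r in a..t, m r) - ∫ r in a..s, m r| := by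
    intro s t h1 h2 h3
    rw [intervalIntegral.integral_interval_sub_left (hint t (h1.trans h2) h3)
      (hint s h1 (h2.trans h3))]
    exact (H s t h1 h2 h3).trans (le_abs_self _)
  obtain ⟨h1, h2⟩ := hJ.1 i hi
  rw [uIcc_of_le hab] at h1 h2
  rcases le_total (J.2 i).1 (J.2 i).2 with hle | hle
  · rw [dist_comm, dist_eq_norm, dist_comm, Real.dist_eq]
    exact key _ _ h1.1 hle h2.2
  · rw [dist_eq_norm, Real.dist_eq]
    exact key _ _ h2.1 hle h1.2

/-- The fundamental theorem of calculus for a function whose increments are dominated by the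
integral of an integrable function. -/
theorem integral_eq_sub_of_ae_hasDerivAt {h k m : ℝ → ℝ} {a b : ℝ}
    (hab : a ≤ b) (hm : IntervalIntegrable m volume a b)
    (H : ∀ s t, a ≤ s → s ≤ t → t ≤ b → ‖h t - h s‖ ≤ ∫ r in s..t, m r)
    (hk : ∀ᵐ t ∂volume.restrict (Icc a b), HasDerivAt h (k t) t) :
    IntervalIntegrable k volume a b ∧ ∫ t in a..b, k t = h b - h a := by
  have hac := absolutelyContinuousOnInterval_of_le_integral hab hm H
  have hae : ∀ᵐ t ∂volume.restrict (uIoc a b), deriv h t = k t := by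
    rw [uIoc_of_le hab]
    filter_upwards [ae_restrict_of_ae_restrict_of_subset Ioc_subset_Icc_self hk] with t ht
    exact ht.deriv
  refine ⟨hac.intervalIntegrable_deriv.congr_ae hae, ?_⟩
  rw [← hac.integral_deriv_eq_sub]
  refine intervalIntegral.integral_congr_ae_restrict ?_
  filter_upwards [hae] with t ht using ht.symm

theorem ae_hasDerivAt_primitive {F : Type*} [NormedAddCommGroup F] [NormedSpace ℝ F]
    [CompleteSpace F] {f : ℝ → F} {a b : ℝ} (hab : a ≤ b) (hf : IntegrableOn f (Icc a b)) :
    ∀ᵐ t ∂volume.restrict (Icc a b), HasDerivAt (fun s => ∫ r in a..s, f r) (f t) t := by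
  have h1 : IntervalIntegrable f volume a b :=
    (intervalIntegrable_iff_integrableOn_Icc_of_le hab).2 hf
  rw [ae_restrict_iff' measurableSet_Icc]
  filter_upwards [h1.ae_hasDerivAt_integral] with t ht hmem
  rw [← uIcc_of_le hab] at hmem
  exact ht hmem a (by simp)

theorem integral_mono_right {m : ℝ → ℝ} (hm : Integrable m) (hm0 : ∀ t, 0 ≤ m t) {a s t : ℝ}
    (hst : s ≤ t) : ∫ r in a..s, m r ≤ ∫ r in a..t, m r := by
  rw [← intervalIntegral.integral_add_adjacent_intervals (hm.intervalIntegrable (a := a) (b := s))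
    (hm.intervalIntegrable (a := s) (b := t))]
  have := intervalIntegral.integral_nonneg (μ := volume) hst (fun u _ => hm0 u)
  linarith

/-- The integrand is a.e. the derivative of M^(n+1)/(n+1), where M is the primitive of m. This is
the source of the factorials in the Picard iteration. -/
theorem integral_mul_pow_primitive {m : ℝ → ℝ} (hm : Integrable m) (hm0 : ∀ t, 0 ≤ m t)
    {a t : ℝ} (hat : a ≤ t) (n : ℕ) :
    ∫ s in a..t, m s * (∫ r in a..s, m r) ^ n = (∫ r in a..t, m r) ^ (n + 1) / (n + 1) := by
  set M : ℝ → ℝ := fun s => ∫ r in a..s, m r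
  have hM0 : ∀ s, a ≤ s → 0 ≤ M s := fun s hs => intervalIntegral.integral_nonneg hs fun u _ => hm0 u
  have hMt : ∀ s, s ≤ t → M s ≤ M t := fun s hs => integral_mono_right hm hm0 hs
  have key := integral_eq_sub_of_ae_hasDerivAt (h := fun s => M s ^ (n + 1) / (n + 1))
    (k := fun s => m s * M s ^ n) (m := fun s => M t ^ n * m s) hat
    (hm.intervalIntegrable.const_mul _) ?_ ?_
  · rw [key.2]; simp [M]
  · intro s s' h1 h2 h3
    rw [intervalIntegral.integral_const_mul]
    have e : ∫ r in s..s', m r = M s' - M s :=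
      (intervalIntegral.integral_interval_sub_left hm.intervalIntegrable
        hm.intervalIntegrable).symm
    have hss : M s ≤ M s' := integral_mono_right hm hm0 h2
    rw [e, Real.norm_eq_abs, ← sub_div, abs_div, abs_of_pos (by positivity : (0:ℝ) < n + 1),
      div_le_iff₀ (by positivity), abs_of_nonneg (by
        have := pow_le_pow_left₀ (hM0 s h1) hss (n + 1); linarith)]
    -- The difference of two (n+1)-st powers is the difference of the bases times n + 1 monomials,
    -- each at most M(t)^n.
    have hgeom := (Commute.all (M s') (M s)).geom_sum₂_mul (n + 1)
    rw [← hgeom]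
    have : ∑ i ∈ Finset.range (n + 1), M s' ^ i * M s ^ (n + 1 - 1 - i) ≤
        ∑ i ∈ Finset.range (n + 1), M t ^ n := by
      refine Finset.sum_le_sum fun i hi => ?_
      have hi' : i ≤ n := by simpa [Nat.lt_succ_iff] using hi
      calc M s' ^ i * M s ^ (n + 1 - 1 - i) ≤ M t ^ i * M t ^ (n + 1 - 1 - i) := by
            gcongr
            · exact pow_nonneg (hM0 s h1) _
            · exact pow_nonneg (hM0 t hat) _
            · exact hM0 s' (h1.trans h2)
            · exact hMt _ h3
            · exact hM0 s h1
            · exact hMt _ (h2.trans h3)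
        _ = M t ^ n := by rw [← pow_add]; congr 1; omega
    simp only [Finset.sum_const, Finset.card_range, nsmul_eq_mul, Nat.cast_add, Nat.cast_one] at this
    nlinarith
  · filter_upwards [ae_hasDerivAt_primitive hat hm.integrableOn] with s hs
    convert! (hs.pow (n + 1)).div_const ((n : ℝ) + 1) using 1
    have : (n : ℝ) + 1 ≠ 0 := by positivity
    simp only [Nat.add_sub_cancel]
    push_cast
    field_simp
    ring

/-- Grönwall's inequality with an integrable rate. -/
theorem gronwall_of_le_integral {m g : ℝ → ℝ} (hm : Integrable m) (hm0 : ∀ t, 0 ≤ m t)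
    {a b c : ℝ} (hab : a ≤ b) (hg : ContinuousOn g (Icc a b))
    (H : ∀ t ∈ Icc a b, g t ≤ c + ∫ s in a..t, m s * g s) :
    g b ≤ c * Real.exp (∫ s in a..b, m s) := by
  set M : ℝ → ℝ := fun s => ∫ r in a..s, m r
  have hmg : IntervalIntegrable (fun s => m s * g s) volume a b := by
    refine hm.intervalIntegrable.mul_continuousOn ?_
    rwa [uIcc_of_le hab]
  have hM0 : ∀ s, a ≤ s → 0 ≤ M s := fun s hs => intervalIntegral.integral_nonneg hs fun u _ => hm0 u
  have hG : AbsolutelyContinuousOnInterval (fun t => c + ∫ s in a..t, m s * g s) a b :=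
    (LipschitzOnWith.absolutelyContinuousOnInterval (K := 0) (f := fun _ : ℝ => c)
      (fun x _ y _ => by simp)).fun_add
      (hmg.absolutelyContinuousOnInterval_intervalIntegral (c := a) (by simp))
  -- The integrating factor is absolutely continuous because x ↦ exp(−x) is 1-Lipschitz on x ≥ 0.
  -- Its product with c + ∫ m g then has a nonpositive derivative a.e., so it stays below its
  -- initial value c.
  have hE : AbsolutelyContinuousOnInterval (fun t => Real.exp (-M t)) a b := by
    refine absolutelyContinuousOnInterval_of_le_integral hab (hm.intervalIntegrable) ?_
    intro s t h1 h2 h3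
    have e : ∫ r in s..t, m r = M t - M s :=
      (intervalIntegral.integral_interval_sub_left hm.intervalIntegrable
        hm.intervalIntegrable).symm
    have hss : M s ≤ M t := integral_mono_right hm hm0 h2
    rw [e, Real.norm_eq_abs, abs_sub_comm, abs_of_nonneg (by
      have := Real.exp_le_exp.2 (neg_le_neg hss); linarith)]
    have h4 : Real.exp (-M s) ≤ 1 := Real.exp_le_one_iff.2 (by linarith [hM0 s h1])
    have h5 : Real.exp (-M t) = Real.exp (-M s) * Real.exp (-(M t - M s)) := by
      rw [← Real.exp_add]; congr 1; ring
    have h6 := Real.add_one_le_exp (-(M t - M s))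
    have h7 := Real.exp_pos (-M s)
    nlinarith
  have hGE := hG.fun_mul hE
  have hle := hGE.integral_deriv_eq_sub
  have hneg : ∫ t in a..b, deriv (fun t => (c + ∫ s in a..t, m s * g s) * Real.exp (-M t)) t ≤ 0 := by
    rw [intervalIntegral.integral_of_le hab]
    refine integral_nonpos_of_ae ?_
    have hI := (intervalIntegrable_iff_integrableOn_Icc_of_le hab).1 hmg
    filter_upwards [ae_restrict_of_ae_restrict_of_subset Ioc_subset_Icc_self
      (ae_hasDerivAt_primitive hab hI), ae_restrict_of_ae_restrict_of_subset Ioc_subset_Icc_self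
      (ae_hasDerivAt_primitive hab hm.integrableOn), ae_restrict_mem measurableSet_Ioc]
      with t h1 h2 h3
    have h6 : HasDerivAt (fun t => (c + ∫ s in a..t, m s * g s) * Real.exp (-M t))
        (m t * g t * Real.exp (-M t) + (c + ∫ s in a..t, m s * g s) *
          (Real.exp (-M t) * -m t)) t := (h1.const_add c).mul (h2.neg.exp)
    rw [h6.deriv]
    have := H t (Ioc_subset_Icc_self h3)
    have h4 := mul_le_mul_of_nonneg_left this (hm0 t)
    have h5 := Real.exp_pos (-M t)
    rw [Pi.zero_apply]
    nlinarith
  rw [hle] at hneg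
  simp only [intervalIntegral.integral_same, add_zero, M, neg_zero, Real.exp_zero, mul_one] at hneg
  have h8 := H b (right_mem_Icc.2 hab)
  rw [Real.exp_neg, ← div_eq_mul_inv, sub_nonpos, div_le_iff₀ (Real.exp_pos _)] at hneg
  linarith

/-- A function that grows at most like an absolutely continuous one and whose upper right derivative
is nonpositive almost everywhere does not increase. -/
theorem le_of_ae_right_derivative_nonpos {m f : ℝ → ℝ} (hm : Integrable m)
    {a b : ℝ} (hab : a ≤ b)
    (H : ∀ s t, a ≤ s → s ≤ t → t ≤ b → f t - f s ≤ ∫ r in s..t, m r)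
    (hd : ∀ᵐ t ∂volume.restrict (Icc a b), ∀ η > 0, ∀ᶠ ε in 𝓝[>] (0 : ℝ),
      f (t + ε) - f t ≤ η * ε) : f b ≤ f a := by
  set M : ℝ → ℝ := fun s => ∫ r in a..s, m r
  have e : ∀ s t, ∫ r in s..t, m r = M t - M s := fun s t =>
      (intervalIntegral.integral_interval_sub_left hm.intervalIntegrable
        hm.intervalIntegrable).symm
  -- The one-sided growth bound on f says exactly that this function is nondecreasing.
  set g : ℝ → ℝ := fun t => M t - f t
  have hg : MonotoneOn g (uIcc a b) := by
    rw [uIcc_of_le hab]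
    intro s hs t ht hst
    have := H s t hs.1 hst ht.2
    rw [e] at this
    simp only [g]; linarith
  have hg' : MonotoneOn g (Icc a b) := by rwa [uIcc_of_le hab] at hg
  -- Lebesgue's inequality ∫ g' ≤ g(b) − g(a): a singular part of g can only help.
  have h1 := hg.intervalIntegral_deriv_mem_uIcc
  rw [uIcc_of_le (sub_nonneg.2 (hg (by simp) (by simp) hab))] at h1
  have h2 : ∫ t in a..b, m t ≤ ∫ t in a..b, deriv g t := by
    refine intervalIntegral.integral_mono_ae_restrict hab hm.intervalIntegrable
      hg.intervalIntegrable_deriv ?_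
    rw [restrict_Ioo_eq_restrict_Icc.symm]
    filter_upwards [ae_restrict_of_ae_restrict_of_subset Ioo_subset_Icc_self hd,
      ae_restrict_of_ae_restrict_of_subset Ioo_subset_Icc_self
      (ae_hasDerivAt_primitive hab hm.integrableOn), ae_restrict_mem measurableSet_Ioo,
      ae_restrict_of_ae hg'.ae_differentiableWithinAt_of_mem] with t h1 h2 h3 h4
    have h5 := ((h4 (Ioo_subset_Icc_self h3)).differentiableAt (Icc_mem_nhds h3.1 h3.2)).hasDerivAt
    have h6 : HasDerivAt f (m t - deriv g t) t := by
      convert! h2.sub h5 using 1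
      funext s; simp [g, M]
    suffices m t - deriv g t ≤ 0 by linarith
    refine le_of_forall_pos_le_add fun η hη => ?_
    have h7 := (hasDerivAt_iff_tendsto_slope_zero.1 h6).mono_left
      (nhdsWithin_mono (0 : ℝ) (fun x (hx : x ∈ Ioi (0 : ℝ)) => (ne_of_gt hx : x ≠ 0)))
    rw [zero_add]
    refine le_of_tendsto h7 ?_
    filter_upwards [h1 η hη, self_mem_nhdsWithin] with ε hε hε0
    rw [smul_eq_mul, inv_mul_le_iff₀ hε0]
    linarith
  have h3 : ∫ t in a..b, m t = M b := rfl
  have h4 : M a = 0 := by simp [M]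
  simp only [g] at h1
  linarith [h1.2]

/-! ### Transport plans and the distance `W₁` -/

section Wasserstein

variable {X : Type*} [NormedAddCommGroup X] [MeasurableSpace X] [BorelSpace X]
  [SecondCountableTopology X]

theorem ae_mem_of_mem_POn {K : Set X} {μ : Pc X} (h : μ ∈ POn K) : ∀ᵐ x ∂μ.toMeasure, x ∈ K := h

theorem ae_norm_le_of_mem_POn {R : ℝ} {μ : Pc X} (h : μ ∈ POn (Metric.closedBall (0 : X) R)) :
    ∀ᵐ x ∂μ.toMeasure, ‖x‖ ≤ R := by
  filter_upwards [ae_mem_of_mem_POn h] with x hx using by simpa using hx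

theorem mem_POn_of_ae_norm_le {R : ℝ} {μ : Pc X} (h : ∀ᵐ x ∂μ.toMeasure, ‖x‖ ≤ R) :
    μ ∈ POn (Metric.closedBall (0 : X) R) := by
  show ∀ᵐ x ∂μ.toMeasure, x ∈ Metric.closedBall (0 : X) R
  filter_upwards [h] with x hx using by simpa using hx

theorem POn_mono {R S : ℝ} (h : R ≤ S) {μ : Pc X} (hμ : μ ∈ POn (Metric.closedBall (0 : X) R)) :
    μ ∈ POn (Metric.closedBall (0 : X) S) :=
  mem_POn_of_ae_norm_le ((ae_norm_le_of_mem_POn hμ).mono fun _ hx => hx.trans h)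

theorem Pc.exists_mem_POn (μ : Pc X) : ∃ R > 0, μ ∈ POn (Metric.closedBall (0 : X) R) := by
  obtain ⟨R, hR⟩ := μ.isCompact_support.isBounded.subset_closedBall (0 : X)
  refine ⟨max R 1, by positivity, mem_POn_of_ae_norm_le ?_⟩
  filter_upwards [Measure.support_mem_ae (μ := μ.toMeasure)] with x hx
  have := hR hx
  rw [mem_closedBall_zero_iff] at this
  exact this.trans (le_max_left _ _)

theorem Pc.integrable_norm (μ : Pc X) : Integrable (fun x => ‖x‖) μ.toMeasure := by
  obtain ⟨R, -, hR⟩ := μ.exists_mem_POn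
  refine Integrable.of_bound continuous_norm.aestronglyMeasurable R ?_
  filter_upwards [ae_norm_le_of_mem_POn hR] with x hx using by simpa using hx

theorem wass_nonneg (p : ℝ) (μ ν : Pc X) : 0 ≤ wass p μ ν := ENNReal.toReal_nonneg

theorem wass_one_eq (μ ν : Pc X) :
    wass 1 μ ν = (⨅ γ ∈ plans μ.toMeasure ν.toMeasure, ∫⁻ z, edist z.1 z.2 ∂γ).toReal := by
  simp [wass, cost]

/-- The joint law of f and g is a transport plan. Flows applied to a common random starting point,
or to a plan of starting points, are compared in this way. -/
theorem wass_le_integral {Ω : Type*} [MeasurableSpace Ω] {P : Measure Ω} [IsProbabilityMeasure P]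
    {f g : Ω → X} (hf : AEMeasurable f P) (hg : AEMeasurable g P) {μ ν : Pc X}
    (hμ : P.map f = μ.toMeasure) (hν : P.map g = ν.toMeasure)
    (hint : Integrable (fun z => ‖f z - g z‖) P) :
    wass 1 μ ν ≤ ∫ z, ‖f z - g z‖ ∂P := by
  rw [wass_one_eq, integral_eq_lintegral_of_nonneg_ae (Eventually.of_forall fun z => norm_nonneg _)
    hint.aestronglyMeasurable]
  have hfg : AEMeasurable (fun o => (f o, g o)) P := hf.prodMk hg
  have hplan : P.map (fun o => (f o, g o)) ∈ plans μ.toMeasure ν.toMeasure := by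
    refine ⟨Measure.isProbabilityMeasure_map hfg, ?_, ?_⟩
    · rw [AEMeasurable.map_map_of_aemeasurable measurable_fst.aemeasurable hfg]; exact hμ
    · rw [AEMeasurable.map_map_of_aemeasurable measurable_snd.aemeasurable hfg]; exact hν
  have hcost : ∫⁻ z, edist z.1 z.2 ∂(P.map (fun o => (f o, g o))) =
      ∫⁻ z, ENNReal.ofReal ‖f z - g z‖ ∂P := by
    rw [lintegral_map' (by fun_prop) hfg]
    refine lintegral_congr fun z => ?_
    rw [edist_dist, dist_eq_norm]
  rw [← hcost]
  refine ENNReal.toReal_mono ?_ (iInf₂_le _ hplan)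
  rw [hcost]
  exact hint.lintegral_lt_top.ne

/-- Near-optimal plans are enough, so no optimal one has to be constructed. The product plan makes
the infimum finite, so `toReal` loses nothing. -/
theorem exists_plan_integral_le (μ ν : Pc X) {ε : ℝ} (hε : 0 < ε) :
    ∃ γ ∈ plans μ.toMeasure ν.toMeasure, Integrable (fun z : X × X => ‖z.1 - z.2‖) γ ∧
      ∫ z, ‖z.1 - z.2‖ ∂γ ≤ wass 1 μ ν + ε := by
  have hmeas : Continuous (fun z : X × X => ‖z.1 - z.2‖) := by fun_prop
  have hint : ∀ γ ∈ plans μ.toMeasure ν.toMeasure,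
      Integrable (fun z : X × X => ‖z.1 - z.2‖) γ := by
    rintro γ ⟨hγ, h1, h2⟩
    have i1 : Integrable (fun z : X × X => ‖z.1‖) γ := by
      have := μ.integrable_norm
      rw [← h1] at this
      exact this.comp_measurable measurable_fst
    have i2 : Integrable (fun z : X × X => ‖z.2‖) γ := by
      have := ν.integrable_norm
      rw [← h2] at this
      exact this.comp_measurable measurable_snd
    refine (i1.add i2).mono' hmeas.aestronglyMeasurable (Eventually.of_forall fun z => ?_)
    rw [norm_norm]
    exact norm_sub_le _ _
  have hc : ∀ γ ∈ plans μ.toMeasure ν.toMeasure,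
      ∫⁻ z, edist z.1 z.2 ∂γ = ENNReal.ofReal (∫ z, ‖z.1 - z.2‖ ∂γ) := by
    intro γ hγ
    rw [ofReal_integral_eq_lintegral_ofReal (hint γ hγ)
      (Eventually.of_forall fun z => norm_nonneg _)]
    refine lintegral_congr fun z => ?_
    rw [edist_dist, dist_eq_norm]
  have hprod : μ.toMeasure.prod ν.toMeasure ∈ plans μ.toMeasure ν.toMeasure :=
    ⟨inferInstance, by simp, by simp⟩
  set I := ⨅ γ ∈ plans μ.toMeasure ν.toMeasure, ∫⁻ z, edist z.1 z.2 ∂γ with hI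
  have hfin : I ≠ ⊤ := by
    refine ne_top_of_le_ne_top ?_ (iInf₂_le _ hprod)
    rw [hc _ hprod]
    exact ENNReal.ofReal_ne_top
  have hlt : I < I + ENNReal.ofReal ε :=
    ENNReal.lt_add_right hfin (by simpa using hε)
  obtain ⟨γ, hγ⟩ := iInf_lt_iff.1 hlt
  obtain ⟨hγp, hγ⟩ := iInf_lt_iff.1 hγ
  refine ⟨γ, hγp, hint γ hγp, ?_⟩
  rw [hc γ hγp] at hγ
  have := (ENNReal.toReal_mono (by finiteness) hγ.le)
  rwa [ENNReal.toReal_ofReal (integral_nonneg fun _ => norm_nonneg _),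
    ENNReal.toReal_add hfin ENNReal.ofReal_ne_top, ENNReal.toReal_ofReal hε.le, hI,
    ← wass_one_eq] at this

theorem integrable_of_lipschitz {F : Type*} [NormedAddCommGroup F] {f : X → F} {L : ℝ}
    (hf : ∀ x y, ‖f x - f y‖ ≤ L * ‖x - y‖) (μ : Pc X) : Integrable f μ.toMeasure := by
  have hfc : Continuous f := by
    have : LipschitzWith L.toNNReal f := LipschitzWith.of_dist_le' fun x y => by
      simpa [dist_eq_norm] using hf x y
    exact this.continuous
  have h1 := (μ.integrable_norm.const_mul L).add (integrable_const ‖f 0‖)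
  refine h1.mono' hfc.aestronglyMeasurable (Eventually.of_forall fun x => ?_)
  have := hf x 0
  rw [sub_zero] at this
  have h2 := norm_sub_norm_le (f x) (f 0)
  simp only [Pi.add_apply]
  linarith

/-- The easy half of Kantorovich duality: integrate the Lipschitz bound against a near-optimal plan.
-/
theorem abs_integral_sub_le_wass {f : X → ℝ} {L : ℝ} (hL : 0 ≤ L)
    (hf : ∀ x y, ‖f x - f y‖ ≤ L * ‖x - y‖) (μ ν : Pc X) :
    |∫ x, f x ∂μ.toMeasure - ∫ x, f x ∂ν.toMeasure| ≤ L * wass 1 μ ν := by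
  have hf' : Continuous f := by
    have : LipschitzWith L.toNNReal f := LipschitzWith.of_dist_le' fun x y => by
      simpa [dist_eq_norm] using hf x y
    exact this.continuous
  refine le_of_forall_pos_le_add fun ε hε => ?_
  -- The tolerance ε/(L + 1) also covers L = 0.
  obtain ⟨γ, ⟨hγ, h1, h2⟩, hi, hle⟩ := exists_plan_integral_le μ ν
    (ε := ε / (L + 1)) (by positivity)
  have i1 : Integrable (fun z : X × X => f z.1) γ := by
    have := integrable_of_lipschitz hf μ
    rw [← h1] at this
    exact this.comp_measurable measurable_fst
  have i2 : Integrable (fun z : X × X => f z.2) γ := by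
    have := integrable_of_lipschitz hf ν
    rw [← h2] at this
    exact this.comp_measurable measurable_snd
  rw [← h1, ← h2, integral_map measurable_fst.aemeasurable hf'.aestronglyMeasurable,
    integral_map measurable_snd.aemeasurable hf'.aestronglyMeasurable, ← integral_sub i1 i2]
  calc |∫ z, (f z.1 - f z.2) ∂γ| ≤ ∫ z, |f z.1 - f z.2| ∂γ := abs_integral_le_integral_abs
    _ ≤ ∫ z, L * ‖z.1 - z.2‖ ∂γ :=
        integral_mono (i1.sub i2).abs (hi.const_mul L) fun z => hf _ _
    _ = L * ∫ z, ‖z.1 - z.2‖ ∂γ := integral_const_mul _ _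
    _ ≤ L * (wass 1 μ ν + ε / (L + 1)) := by gcongr
    _ = L * wass 1 μ ν + ε * (L / (L + 1)) := by ring
    _ ≤ L * wass 1 μ ν + ε := by
        have : L / (L + 1) ≤ 1 := by rw [div_le_one (by positivity)]; linarith
        nlinarith

end Wasserstein

/-! ### Mollification, truncation, Carathéodory functions -/

section Mollifier

variable {X : Type*} [NormedAddCommGroup X] [NormedSpace ℝ X] [FiniteDimensional ℝ X]
  [MeasurableSpace X] [BorelSpace X]

theorem continuous_of_norm_sub_le {Y F : Type*} [SeminormedAddCommGroup Y]
    [SeminormedAddCommGroup F] {g : Y → F} {δ : ℝ}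
    (hg : ∀ x y, ‖g x - g y‖ ≤ δ * ‖x - y‖) : Continuous g :=
  (LipschitzWith.of_dist_le' (K := δ) fun x y => by simpa [dist_eq_norm] using hg x y).continuous

open scoped Convolution in
-- Differences in x fall on the factor g(x − t), so its Lipschitz constant survives. The general
-- pairing B allows f to be either the mollifying kernel or its derivative.
theorem norm_convolution_sub_le {A F G : Type*} [NormedAddCommGroup A] [NormedSpace ℝ A]
    [NormedAddCommGroup F] [NormedSpace ℝ F] [NormedAddCommGroup G] [NormedSpace ℝ G]
    (B : A →L[ℝ] F →L[ℝ] G) {μ : Measure X} [IsFiniteMeasureOnCompacts μ] {f : X → A} {g : X → F}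
    {δ : ℝ} (hf : Continuous f) (hcf : HasCompactSupport f)
    (hg : ∀ x y, ‖g x - g y‖ ≤ δ * ‖x - y‖) (x y : X) :
    ‖(f ⋆[B, μ] g) x - (f ⋆[B, μ] g) y‖ ≤ ‖B‖ * (∫ t, ‖f t‖ ∂μ) * (δ * ‖x - y‖) := by
  have hgc := continuous_of_norm_sub_le hg
  have hex : ∀ x, Integrable (fun t => B (f t) (g (x - t))) μ := fun x => by
    refine Continuous.integrable_of_hasCompactSupport (by fun_prop) ?_
    refine hcf.mono fun t ht => ?_
    contrapose! ht
    simp only [Function.mem_support, not_not] at ht ⊢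
    simp [ht]
  have hfi : Integrable (fun t => ‖f t‖) μ := hf.norm.integrable_of_hasCompactSupport hcf.norm
  simp only [convolution_def]
  rw [← integral_sub (hex x) (hex y)]
  calc ‖∫ t, (B (f t) (g (x - t)) - B (f t) (g (y - t))) ∂μ‖
      ≤ ∫ t, ‖B‖ * ‖f t‖ * (δ * ‖x - y‖) ∂μ := by
        refine norm_integral_le_of_norm_le ((hfi.const_mul _).mul_const _)
          (Eventually.of_forall fun t => ?_)
        rw [← map_sub]
        refine (B.le_opNorm₂ _ _).trans ?_
        gcongr
        simpa using hg (x - t) (y - t)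
    _ = _ := by rw [integral_mul_const, integral_const_mul]

open scoped Convolution in
theorem exists_norm_convolution_sub_le {A F G : Type*} [NormedAddCommGroup A] [NormedSpace ℝ A]
    [NormedAddCommGroup F] [NormedSpace ℝ F] [NormedAddCommGroup G] [NormedSpace ℝ G]
    (B : A →L[ℝ] F →L[ℝ] G) {μ : Measure X} [IsFiniteMeasureOnCompacts μ] {f : X → A}
    (hf : Continuous f) (hcf : HasCompactSupport f) :
    ∃ C, 0 ≤ C ∧ ∀ (g : X → F) (δ : ℝ), (∀ x y, ‖g x - g y‖ ≤ δ * ‖x - y‖) → ∀ x y,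
      ‖(f ⋆[B, μ] g) x - (f ⋆[B, μ] g) y‖ ≤ C * (δ * ‖x - y‖) :=
  ⟨‖B‖ * ∫ t, ‖f t‖ ∂μ, mul_nonneg B.opNorm_nonneg (integral_nonneg fun _ => norm_nonneg _),
    fun _ _ hg x y => norm_convolution_sub_le B hf hcf hg x y⟩

open scoped Convolution in
/-- Mollification at scale `r` of Lipschitz maps. -/
theorem exists_mollification (X F : Type*) [NormedAddCommGroup X] [NormedSpace ℝ X]
    [FiniteDimensional ℝ X] [NormedAddCommGroup F] [NormedSpace ℝ F] [CompleteSpace F]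
    {r : ℝ} (hr : 0 < r) :
    ∃ C, 1 ≤ C ∧ ∀ (g : X → F) (δ : ℝ), 0 ≤ δ → (∀ x y, ‖g x - g y‖ ≤ δ * ‖x - y‖) →
      ∃ g' : X → F, ContDiff ℝ ∞ g' ∧ (∀ x, ‖g' x - g x‖ ≤ r * δ) ∧
        (∀ x y, ‖g' x - g' y‖ ≤ δ * ‖x - y‖) ∧
        (∀ x y, ‖fderiv ℝ g' x - fderiv ℝ g' y‖ ≤ C * δ * ‖x - y‖) ∧
        (HasCompactSupport g → HasCompactSupport g') := by
  borelize X
  let φ : ContDiffBump (0 : X) := ⟨r / 2, r, half_pos hr, half_lt_self hr⟩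
  let μ : Measure X := Measure.addHaar
  let ρ : X → ℝ := φ.normed μ
  let B : ℝ →L[ℝ] F →L[ℝ] F := ContinuousLinearMap.lsmul ℝ ℝ
  have hρ : ContDiff ℝ ∞ ρ := φ.contDiff_normed
  have hρc : HasCompactSupport ρ := φ.hasCompactSupport_normed
  have hρ1 : ContDiff ℝ 1 ρ := φ.contDiff_normed
  -- The derivative of the mollification is the convolution with the derivative of the kernel. Hence
  -- κ may depend on r, but not on g.
  obtain ⟨κ, hκ0, hκ⟩ := exists_norm_convolution_sub_le (B.precompL X) (μ := μ)
    (hρ1.continuous_fderiv one_ne_zero) (hρc.fderiv ℝ)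
  refine ⟨κ + 1, by linarith, fun g δ hδ hg => ?_⟩
  have hgc := continuous_of_norm_sub_le hg
  have hloc : LocallyIntegrable g μ := hgc.locallyIntegrable
  refine ⟨ρ ⋆[B, μ] g, hρc.contDiff_convolution_left B hρ hloc, fun x => ?_, fun x y => ?_,
    fun x y => ?_, fun hc => hρc.convolution B hc⟩
  · rw [← dist_eq_norm]
    refine φ.dist_normed_convolution_le hgc.aestronglyMeasurable fun y hy => ?_
    rw [dist_eq_norm]
    refine (hg y x).trans ?_
    rw [mul_comm r δ]
    gcongr
    rw [← dist_eq_norm]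
    exact (Metric.mem_ball.1 hy).le
  · refine (norm_convolution_sub_le B hρ.continuous hρc hg x y).trans ?_
    have h1 : ∫ t, ‖ρ t‖ ∂μ = 1 := by
      rw [← φ.integral_normed (μ := μ)]
      refine integral_congr_ae (Eventually.of_forall fun t => ?_)
      exact Real.norm_of_nonneg (φ.nonneg_normed t)
    have h2 : ‖B‖ ≤ 1 := ContinuousLinearMap.opNorm_lsmul_le
    rw [h1, mul_one]
    exact mul_le_of_le_one_left (mul_nonneg hδ (norm_nonneg _)) h2
  · have hd : ∀ x, fderiv ℝ (ρ ⋆[B, μ] g) x = (fderiv ℝ ρ ⋆[B.precompL X, μ] g) x := fun x =>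
      (hρc.hasFDerivAt_convolution_left B hρ1 hloc x).fderiv
    rw [hd, hd]
    refine (hκ g δ hg x y).trans ?_
    have := mul_nonneg hδ (norm_nonneg (x - y))
    nlinarith

/-- P multiplies x by a bump function that is 1 on the ball of radius R and 0 outside the ball of
radius 2R. A C¹ map with compact support is Lipschitz. That norms never increase preserves sublinear
growth bounds. -/
theorem exists_truncation (X : Type*) [NormedAddCommGroup X] [NormedSpace ℝ X]
    [FiniteDimensional ℝ X] {R : ℝ} (hR : 0 < R) :
    ∃ (P : X → X) (C : ℝ), 0 ≤ C ∧ (∀ x, ‖x‖ ≤ R → P x = x) ∧ (∀ x, ‖P x‖ ≤ ‖x‖) ∧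
      (∀ x, ‖P x‖ ≤ 2 * R) ∧ ∀ x y, ‖P x - P y‖ ≤ C * ‖x - y‖ := by
  let φ : ContDiffBump (0 : X) := ⟨R, 2 * R, hR, by linarith⟩
  have hle : ∀ x, ‖φ x • x‖ ≤ ‖x‖ := fun x => by
    rw [norm_smul, Real.norm_of_nonneg φ.nonneg]
    exact mul_le_of_le_one_left (norm_nonneg _) φ.le_one
  have hcd : ContDiff ℝ 1 (fun x => φ x • x) := φ.contDiff.smul contDiff_id
  have hcs : HasCompactSupport (fun x => φ x • x) := φ.hasCompactSupport.smul_right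
  obtain ⟨C, hC⟩ := ContDiff.lipschitzWith_of_hasCompactSupport hcs hcd one_ne_zero
  refine ⟨fun x => φ x • x, C, C.2, fun x hx => ?_, hle, fun x => ?_, fun x y => ?_⟩
  · have : φ x = 1 := φ.one_of_mem_closedBall (by simpa using hx)
    simp [this]
  · rcases lt_or_ge ‖x‖ (2 * R) with h | h
    · exact (hle x).trans h.le
    · have : φ x = 0 := φ.zero_of_le_dist (by simpa [dist_eq_norm] using h)
      simp [this]; linarith
  · simpa [dist_eq_norm] using hC.dist_le_mul x y

end Mollifier

/-! ### Measurability of Carathéodory functions and of their compositions. -/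

section Caratheodory

variable {P F : Type*} [TopologicalSpace P] [TopologicalSpace.MetrizableSpace P]
  [SecondCountableTopology P] [MeasurableSpace P] [OpensMeasurableSpace P] [NormedAddCommGroup F]
  {g : ℝ → P → F} {lam : Measure ℝ}

/-- A function that is measurable in the first and continuous in the second variable agrees with a
jointly measurable one. -/
theorem exists_stronglyMeasurable_uncurry (hc : ∀ᵐ s ∂lam, Continuous (g s))
    (hm : ∀ p, AEStronglyMeasurable (fun s => g s p) lam) :
    ∃ g' : ℝ → P → F, StronglyMeasurable (Function.uncurry g') ∧
      ∀ᵐ s ∂lam, ∀ p, g s p = g' s p := by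
  classical
  obtain ⟨D, hDc, hD⟩ := TopologicalSpace.exists_countable_dense P
  -- Only countably many null sets are discarded. Off them, g is determined by continuity from its
  -- measurable representatives on the dense set D.
  have h1 : ∀ᵐ s ∂lam, Continuous (g s) ∧ ∀ d ∈ D, g s d = (hm d).mk _ s :=
    hc.and ((ae_ball_iff hDc).2 fun d _ => (hm d).ae_eq_mk)
  obtain ⟨S, hS, hSm, hSg⟩ := h1.exists_measurable_mem
  refine ⟨fun s p => S.indicator (fun s => g s p) s, ?_, ?_⟩
  · have hu := stronglyMeasurable_uncurry_of_continuous_of_stronglyMeasurable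
      (u := fun p s => S.indicator (fun s => g s p) s) (fun s => ?_) (fun p => ?_)
    · exact hu.comp_measurable measurable_swap
    · by_cases hs : s ∈ S
      · simpa [hs] using (hSg s hs).1
      · simpa [hs] using continuous_const
    · obtain ⟨d, hd, hlim⟩ := mem_closure_iff_seq_limit.1 (hD p)
      refine stronglyMeasurable_of_tendsto atTop
        (f := fun n s => S.indicator ((hm (d n)).mk _) s)
        (fun n => (hm (d n)).stronglyMeasurable_mk.indicator hSm) ?_
      rw [tendsto_pi_nhds]
      intro s
      by_cases hs : s ∈ S
      · simp only [hs, indicator_of_mem]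
        refine Tendsto.congr (fun n => (hSg s hs).2 (d n) (hd n)) ?_
        exact ((hSg s hs).1.tendsto p).comp hlim
      · simp [hs]
  · filter_upwards [hS] with s hs p
    simp [hs]

theorem aestronglyMeasurable_comp_caratheodory (hc : ∀ᵐ s ∂lam, Continuous (g s))
    (hm : ∀ p, AEStronglyMeasurable (fun s => g s p) lam) {x : ℝ → P} (hx : AEMeasurable x lam) :
    AEStronglyMeasurable (fun s => g s (x s)) lam := by
  obtain ⟨g', hg', he⟩ := exists_stronglyMeasurable_uncurry hc hm
  refine ⟨fun s => g' s (hx.mk x s),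
    hg'.comp_measurable (measurable_id.prodMk hx.measurable_mk), ?_⟩
  filter_upwards [he, hx.ae_eq_mk] with s h1 h2
  rw [h1, ← h2]

theorem aestronglyMeasurable_uncurry_comp_caratheodory (hc : ∀ᵐ s ∂lam, Continuous (g s))
    (hm : ∀ p, AEStronglyMeasurable (fun s => g s p) lam) {Y : Type*} [MeasurableSpace Y]
    (κ : Measure Y) [SFinite lam] [SFinite κ] {x : ℝ → Y → P} (hx : Measurable (Function.uncurry x)) :
    AEStronglyMeasurable (fun z : ℝ × Y => g z.1 (x z.1 z.2)) (lam.prod κ) := by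
  obtain ⟨g', hg', he⟩ := exists_stronglyMeasurable_uncurry hc hm
  refine ⟨fun z => g' z.1 (x z.1 z.2), hg'.comp_measurable (measurable_fst.prodMk hx), ?_⟩
  filter_upwards [Measure.quasiMeasurePreserving_fst.ae he] with z h1
  rw [h1]

end Caratheodory

/-! ### Integral equations with integrable rates -/

section Picard

theorem IntegrableOn.intervalIntegrable_of_Icc {F : Type*} [NormedAddCommGroup F] {f : ℝ → F}
    {a b s t : ℝ} (hf : IntegrableOn f (Icc a b)) (hs : s ∈ Icc a b) (ht : t ∈ Icc a b) :
    IntervalIntegrable f volume s t :=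
  intervalIntegrable_iff.2 (hf.mono_set (uIoc_subset_uIcc.trans (uIcc_subset_Icc hs ht)))

theorem norm_intervalIntegral_le_of_ae_le {F : Type*} [NormedAddCommGroup F] [NormedSpace ℝ F]
    {f : ℝ → F} {m : ℝ → ℝ} {a b s t : ℝ} (hs : a ≤ s) (hst : s ≤ t) (ht : t ≤ b)
    (hf : ∀ᵐ r ∂volume.restrict (Icc a b), ‖f r‖ ≤ m r) (hm : IntegrableOn m (Icc a b)) :
    ‖∫ r in s..t, f r‖ ≤ ∫ r in s..t, m r := by
  refine intervalIntegral.norm_integral_le_of_norm_le hst ?_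
    (IntegrableOn.intervalIntegrable_of_Icc hm ⟨hs, hst.trans ht⟩ ⟨hs.trans hst, ht⟩)
  rw [ae_restrict_iff' measurableSet_Icc] at hf
  filter_upwards [hf] with r hr hr'
  exact hr ⟨hs.trans hr'.1.le, hr'.2.trans ht⟩

theorem integrableOn_of_ae_norm_le {F : Type*} [NormedAddCommGroup F] {f : ℝ → F} {m : ℝ → ℝ}
    {S : Set ℝ} (hf : AEStronglyMeasurable f (volume.restrict S))
    (hb : ∀ᵐ r ∂volume.restrict S, ‖f r‖ ≤ m r) (hm : IntegrableOn m S) : IntegrableOn f S :=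
  Integrable.mono' hm hf hb

theorem integral_rate_eq_sub {m : ℝ → ℝ} (hm : Integrable m) (a s t : ℝ) :
    ∫ r in s..t, m r = (∫ r in a..t, m r) - ∫ r in a..s, m r :=
  (intervalIntegral.integral_interval_sub_left hm.intervalIntegrable hm.intervalIntegrable).symm

variable {X : Type*} [NormedAddCommGroup X] [NormedSpace ℝ X] [CompleteSpace X]

/-- Carathéodory's existence theorem for curves of bounded continuous maps `Y t : X → X` solving
`∂ₜ Y(t, x) = G(t, Y(t), Y(t, x))`, for a Lipschitz right-hand side with integrable rate. -/
theorem exists_integral_curve {a b : ℝ} (hab : a ≤ b) {m : ℝ → ℝ} (hm : Integrable m)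
    (hm0 : ∀ t, 0 ≤ m t) (X₀ : X →ᵇ X) {G : ℝ → (X →ᵇ X) → X → X}
    (hb : ∀ᵐ s ∂volume.restrict (Icc a b), ∀ Y z, ‖G s Y z‖ ≤ m s)
    (hl : ∀ᵐ s ∂volume.restrict (Icc a b), ∀ Y Y' z z',
      ‖G s Y z - G s Y' z'‖ ≤ m s * (‖Y - Y'‖ + ‖z - z'‖))
    (hG : ∀ Y : ℝ → (X →ᵇ X), Continuous Y → ∀ x,
      AEStronglyMeasurable (fun s => G s (Y s) (Y s x)) (volume.restrict (Icc a b))) :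
    ∃ Y : ℝ → (X →ᵇ X), Continuous Y ∧
      ∀ t ∈ Icc a b, ∀ x, Y t x = X₀ x + ∫ s in a..t, G s (Y s) (Y s x) := by
  set M : ℝ → ℝ := fun t => ∫ r in a..t, m r
  have hMc : Continuous M := intervalIntegral.continuous_primitive
    (fun _ _ => hm.intervalIntegrable) a
  have hM0 : ∀ t, a ≤ t → 0 ≤ M t := fun t ht =>
    intervalIntegral.integral_nonneg ht fun u _ => hm0 u
  let J : (ℝ → (X →ᵇ X)) → ℝ → X → X := fun Y t x => ∫ s in a..t, G s (Y s) (Y s x)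
  have hbY : ∀ (Y : ℝ → (X →ᵇ X)) x, ∀ᵐ s ∂volume.restrict (Icc a b), ‖G s (Y s) (Y s x)‖ ≤ m s :=
    fun Y x => hb.mono fun s hs => hs _ _
  have hint : ∀ Y : ℝ → (X →ᵇ X), Continuous Y → ∀ x,
      IntegrableOn (fun s => G s (Y s) (Y s x)) (Icc a b) := fun Y hY x =>
    integrableOn_of_ae_norm_le (hG Y hY x) (hbY Y x) hm.integrableOn
  have hJsub : ∀ Y : ℝ → (X →ᵇ X), Continuous Y → ∀ x, ∀ s t, a ≤ s → s ≤ t → t ≤ b →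
      ‖J Y t x - J Y s x‖ ≤ M t - M s := by
    intro Y hY x s t h1 h2 h3
    have := norm_intervalIntegral_le_of_ae_le h1 h2 h3 (hbY Y x) hm.integrableOn
    rw [integral_rate_eq_sub hm a] at this
    convert this using 2
    exact intervalIntegral.integral_interval_sub_left
      (IntegrableOn.intervalIntegrable_of_Icc (hint Y hY x) ⟨le_rfl, hab⟩ ⟨h1.trans h2, h3⟩)
      (IntegrableOn.intervalIntegrable_of_Icc (hint Y hY x) ⟨le_rfl, hab⟩ ⟨h1, h2.trans h3⟩)
  have hJbound : ∀ Y : ℝ → (X →ᵇ X), ∀ t ∈ Icc a b, ∀ x, ‖J Y t x‖ ≤ M b := by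
    intro Y t ht x
    refine (norm_intervalIntegral_le_of_ae_le le_rfl ht.1 ht.2 (hbY Y x) hm.integrableOn).trans ?_
    exact integral_mono_right hm hm0 ht.2
  have hJc : ∀ Y : ℝ → (X →ᵇ X), Continuous Y → ∀ t ∈ Icc a b, Continuous (J Y t) := by
    intro Y hY t ht
    refine intervalIntegral.continuous_of_dominated_interval (bound := m) (fun x => ?_)
      (fun x => ?_) hm.intervalIntegrable ?_
    · rw [uIoc_of_le ht.1]
      exact (hG Y hY x).mono_measure (Measure.restrict_mono
        ((Ioc_subset_Icc_self).trans (Icc_subset_Icc_right ht.2)) le_rfl)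
    · have := (ae_restrict_iff' measurableSet_Icc).1 (hbY Y x)
      filter_upwards [this] with s hs hs'
      rw [uIoc_of_le ht.1] at hs'
      exact hs ⟨hs'.1.le, hs'.2.trans ht.2⟩
    · have := (ae_restrict_iff' measurableSet_Icc).1 hl
      filter_upwards [this] with s hs hs'
      rw [uIoc_of_le ht.1] at hs'
      have h1 := hs ⟨hs'.1.le, hs'.2.trans ht.2⟩
      have h2 : Continuous (G s (Y s)) := continuous_of_norm_sub_le (δ := m s) fun z z' => by
        simpa using h1 (Y s) (Y s) z z'
      exact h2.comp (Y s).continuous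
  -- The Picard operator acts on curves of whole maps, since the field at a point depends on the
  -- entire map Y(t).
  let Φ : C(Icc a b, X →ᵇ X) → C(Icc a b, X →ᵇ X) := fun Y =>
    { toFun := fun t => BoundedContinuousFunction.ofNormedAddCommGroup
        (fun x => X₀ x + J (IccExtend hab Y) t x)
        (X₀.continuous.add (hJc _ Y.continuous.Icc_extend' t t.2)) (‖X₀‖ + M b)
        (fun x => (norm_add_le _ _).trans
          (add_le_add (X₀.norm_coe_le_norm x) (hJbound _ t t.2 x)))
      continuous_toFun := by
        rw [continuous_iff_continuousAt]
        intro t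
        rw [ContinuousAt, tendsto_iff_dist_tendsto_zero]
        refine squeeze_zero (fun _ => dist_nonneg) (g := fun s : Icc a b => |M s - M t|)
          (fun s => ?_) ?_
        · rw [BoundedContinuousFunction.dist_le (abs_nonneg _)]
          intro x
          simp only [BoundedContinuousFunction.coe_ofNormedAddCommGroup, dist_add_left]
          rw [dist_eq_norm]
          rcases le_total (s : ℝ) t with h | h
          · rw [norm_sub_rev, abs_sub_comm]
            exact (hJsub _ Y.continuous.Icc_extend' x s t s.2.1 h t.2.2).trans (le_abs_self _)
          · exact (hJsub _ Y.continuous.Icc_extend' x t s t.2.1 h s.2.2).trans (le_abs_self _)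
        · have : Continuous (fun s : Icc a b => |M s - M t|) := by fun_prop
          simpa using this.tendsto t }
  have hΦ : ∀ (Y : C(Icc a b, X →ᵇ X)) (t : Icc a b) x,
      Φ Y t x = X₀ x + J (IccExtend hab Y) t x := fun Y t x => rfl
  -- A difference of curves enters the field twice, through the map and through the evaluated point,
  -- hence the 2^n. The iterated integrals of the rate give M^n/n!.
  have hstep : ∀ n : ℕ, ∀ (Y Y' : C(Icc a b, X →ᵇ X)) (t : Icc a b),
      ‖Φ^[n] Y t - Φ^[n] Y' t‖ ≤ 2 ^ n * (M t ^ n / n.factorial) * dist Y Y' := by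
    intro n
    induction n with
    | zero =>
      intro Y Y' t
      simp only [Function.iterate_zero, id_eq, pow_zero, Nat.factorial_zero, Nat.cast_one, div_one,
        one_mul]
      rw [← dist_eq_norm]
      exact ContinuousMap.dist_apply_le_dist t
    | succ n ih =>
      intro Y Y' t
      rw [Function.iterate_succ_apply', Function.iterate_succ_apply']
      set Z := Φ^[n] Y
      set Z' := Φ^[n] Y'
      have hR : 0 ≤ 2 ^ (n + 1) * (M t ^ (n + 1) / (n + 1).factorial) * dist Y Y' := by
        have := hM0 t t.2.1
        positivity
      rw [BoundedContinuousFunction.norm_le hR]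
      intro x
      rw [BoundedContinuousFunction.coe_sub, Pi.sub_apply, hΦ, hΦ, add_sub_add_left_eq_sub]
      have hZ := Z.continuous.Icc_extend' (h := hab)
      have hZ' := Z'.continuous.Icc_extend' (h := hab)
      have hsub := intervalIntegral.integral_sub
        (IntegrableOn.intervalIntegrable_of_Icc (hint _ hZ x) ⟨le_rfl, hab⟩ t.2)
        (IntegrableOn.intervalIntegrable_of_Icc (hint _ hZ' x) ⟨le_rfl, hab⟩ t.2)
      show ‖(∫ s in a..t, G s (IccExtend hab Z s) (IccExtend hab Z s x)) -
        ∫ s in a..t, G s (IccExtend hab Z' s) (IccExtend hab Z' s x)‖ ≤ _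
      rw [← hsub]
      have hbd : ∀ᵐ s ∂volume.restrict (Icc a b),
          ‖G s (IccExtend hab Z s) (IccExtend hab Z s x) -
            G s (IccExtend hab Z' s) (IccExtend hab Z' s x)‖ ≤
          2 ^ (n + 1) / n.factorial * dist Y Y' * (m s * M s ^ n) := by
        filter_upwards [hl, ae_restrict_mem measurableSet_Icc] with s hs hmem
        refine (hs _ _ _ _).trans ?_
        rw [IccExtend_of_mem hab Z hmem, IccExtend_of_mem hab Z' hmem]
        have h1 := ih Y Y' ⟨s, hmem⟩
        have h2 : ‖Z ⟨s, hmem⟩ x - Z' ⟨s, hmem⟩ x‖ ≤ ‖Z ⟨s, hmem⟩ - Z' ⟨s, hmem⟩‖ :=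
          (Z ⟨s, hmem⟩ - Z' ⟨s, hmem⟩).norm_coe_le_norm x
        calc m s * (‖Z ⟨s, hmem⟩ - Z' ⟨s, hmem⟩‖ + ‖Z ⟨s, hmem⟩ x - Z' ⟨s, hmem⟩ x‖)
            ≤ m s * (2 * (2 ^ n * (M s ^ n / n.factorial) * dist Y Y')) := by
              gcongr
              · exact hm0 s
              · linarith
          _ = _ := by ring
      have hmM : Integrable (fun s => m s * M s ^ n) (volume.restrict (Icc a b)) := by
        refine Integrable.mul_bdd (c := M b ^ n) hm.integrableOn
          (hMc.pow n).aestronglyMeasurable ?_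
        filter_upwards [ae_restrict_mem measurableSet_Icc] with s hs
        rw [norm_pow, Real.norm_of_nonneg (hM0 s hs.1)]
        exact pow_le_pow_left₀ (hM0 s hs.1) (integral_mono_right hm hm0 hs.2) n
      refine (norm_intervalIntegral_le_of_ae_le le_rfl t.2.1 t.2.2 hbd
        (hmM.const_mul _)).trans (le_of_eq ?_)
      rw [intervalIntegral.integral_const_mul, integral_mul_pow_primitive hm hm0 t.2.1]
      rw [Nat.factorial_succ]
      push_cast
      have : (n : ℝ) + 1 ≠ 0 := by positivity
      have : (n.factorial : ℝ) ≠ 0 := by positivity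
      field_simp
      rfl
  obtain ⟨n, hn⟩ : ∃ n : ℕ, (2 * M b) ^ n / n.factorial < 1 / 2 :=
    ((FloorSemiring.tendsto_pow_div_factorial_atTop (2 * M b)).eventually_lt_const
      (by norm_num)).exists
  have hcontr : ContractingWith (1 / 2) Φ^[n] := by
    refine ⟨by norm_num [← NNReal.coe_lt_coe], LipschitzWith.of_dist_le_mul fun Y Y' => ?_⟩
    rw [ContinuousMap.dist_le (by positivity)]
    intro t
    rw [dist_eq_norm]
    refine (hstep n Y Y' t).trans ?_
    have h1 : M t ^ n ≤ M b ^ n :=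
      pow_le_pow_left₀ (hM0 t t.2.1) (integral_mono_right hm hm0 t.2.2) n
    have h2 : 2 ^ n * (M t ^ n / n.factorial) ≤ ((1 / 2 : NNReal) : ℝ) := by
      push_cast
      refine le_trans ?_ hn.le
      rw [mul_pow, mul_div_assoc]
      gcongr
    gcongr
  have : Nonempty C(Icc a b, X →ᵇ X) := ⟨0⟩
  -- The fixed point of a contracting iterate is already fixed by Φ.
  have hfix := hcontr.isFixedPt_fixedPoint_iterate
  set Y := ContractingWith.fixedPoint Φ^[n] hcontr
  refine ⟨IccExtend hab Y, Y.continuous.Icc_extend', fun t ht x => ?_⟩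
  conv_lhs => rw [IccExtend_of_mem hab Y ht, ← hfix.eq]
  exact hΦ Y ⟨t, ht⟩ x

end Picard

/-! ### Flows of Lipschitz fields and the continuity equation -/

section Flow

variable {X : Type*} [NormedAddCommGroup X] [NormedSpace ℝ X] [FiniteDimensional ℝ X]
  [MeasurableSpace X] [BorelSpace X]

/-- A field that is measurable in time, bounded and Lipschitz in space with rate `m`. -/
structure IsLipschitzField (a b : ℝ) (m : ℝ → ℝ) (w : ℝ → X → X) : Prop where
  aestronglyMeasurable : ∀ x, AEStronglyMeasurable (fun t => w t x) (volume.restrict (Icc a b))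
  norm_le : ∀ᵐ t ∂volume.restrict (Icc a b), ∀ x, ‖w t x‖ ≤ m t
  norm_sub_le : ∀ᵐ t ∂volume.restrict (Icc a b), ∀ x y, ‖w t x - w t y‖ ≤ m t * ‖x - y‖

theorem IsLipschitzField.ae_continuous {a b : ℝ} {m : ℝ → ℝ} {w : ℝ → X → X}
    (hw : IsLipschitzField a b m w) : ∀ᵐ t ∂volume.restrict (Icc a b), Continuous (w t) :=
  hw.norm_sub_le.mono fun _ ht => continuous_of_norm_sub_le ht

/-- `Y` is the flow of `w` on `[a, b]`, in integrated form. -/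
def IsFlow (a b : ℝ) (w : ℝ → X → X) (Y : ℝ → (X →ᵇ X)) : Prop :=
  Continuous Y ∧ ∀ t ∈ Icc a b, ∀ x, Y t x = Y a x + ∫ s in a..t, w s (Y s x)

theorem IsLipschitzField.exists_flow {a b : ℝ} (hab : a ≤ b) {m : ℝ → ℝ} (hm : Integrable m)
    (hm0 : ∀ t, 0 ≤ m t) {w : ℝ → X → X} (hw : IsLipschitzField a b m w) (X₀ : X →ᵇ X) :
    ∃ Y, IsFlow a b w Y ∧ Y a = X₀ := by
  obtain ⟨Y, hY, h⟩ := exists_integral_curve hab hm hm0 X₀ (G := fun s _ z => w s z)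
    (hw.norm_le.mono fun s hs _ z => hs z)
    (hw.norm_sub_le.mono fun s hs Z Z' z z' => (hs z z').trans
      (mul_le_mul_of_nonneg_left (by linarith [norm_nonneg (Z - Z')]) (hm0 s)))
    (fun Y hY x => aestronglyMeasurable_comp_caratheodory hw.ae_continuous hw.aestronglyMeasurable
      (x := fun s => Y s x)
      ((continuous_eval_const x).comp hY).aemeasurable)
  have ha : Y a = X₀ := by
    ext1 x
    simpa using h a (left_mem_Icc.2 hab) x
  exact ⟨Y, ⟨hY, fun t ht x => by rw [ha]; exact h t ht x⟩, ha⟩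

variable {a b : ℝ} {m : ℝ → ℝ} {w : ℝ → X → X} {Y : ℝ → (X →ᵇ X)}

theorem IsFlow.continuous_apply (hY : IsFlow a b w Y) (x : X) : Continuous fun t => Y t x :=
  (continuous_eval_const x).comp hY.1

theorem IsFlow.continuous_uncurry (hY : IsFlow a b w Y) :
    Continuous fun z : ℝ × X => Y z.1 z.2 :=
  continuous_eval.comp (hY.1.prodMap continuous_id)

theorem IsFlow.integrableOn (hY : IsFlow a b w Y) (hm : Integrable m)
    (hw : IsLipschitzField a b m w) (x : X) : IntegrableOn (fun s => w s (Y s x)) (Icc a b) :=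
  integrableOn_of_ae_norm_le (aestronglyMeasurable_comp_caratheodory hw.ae_continuous
    hw.aestronglyMeasurable (hY.continuous_apply x).aemeasurable)
    (hw.norm_le.mono fun _ hs => hs _) hm.integrableOn

theorem IsFlow.sub_eq (hY : IsFlow a b w Y) (hm : Integrable m)
    (hw : IsLipschitzField a b m w) (x : X) {s t : ℝ} (hs : s ∈ Icc a b) (ht : t ∈ Icc a b) :
    Y t x - Y s x = ∫ r in s..t, w r (Y r x) := by
  have hi := hY.integrableOn hm hw x
  have ha : a ∈ Icc a b := ⟨le_rfl, hs.1.trans hs.2⟩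
  rw [hY.2 t ht, hY.2 s hs, add_sub_add_left_eq_sub]
  exact intervalIntegral.integral_interval_sub_left
    (IntegrableOn.intervalIntegrable_of_Icc hi ha ht)
    (IntegrableOn.intervalIntegrable_of_Icc hi ha hs)

theorem IsFlow.norm_sub_le (hY : IsFlow a b w Y) (hm : Integrable m)
    (hw : IsLipschitzField a b m w) (x : X) {s t : ℝ} (h1 : a ≤ s) (h2 : s ≤ t) (h3 : t ≤ b) :
    ‖Y t x - Y s x‖ ≤ ∫ r in s..t, m r := by
  rw [hY.sub_eq hm hw x ⟨h1, h2.trans h3⟩ ⟨h1.trans h2, h3⟩]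
  exact norm_intervalIntegral_le_of_ae_le h1 h2 h3 (hw.norm_le.mono fun s hs => hs _)
    hm.integrableOn

theorem IsFlow.ae_hasDerivAt (hY : IsFlow a b w Y) (hab : a ≤ b) (hm : Integrable m)
    (hw : IsLipschitzField a b m w) (x : X) :
    ∀ᵐ t ∂volume.restrict (Icc a b), HasDerivAt (fun t => Y t x) (w t (Y t x)) t := by
  rw [← restrict_Ioo_eq_restrict_Icc]
  filter_upwards [ae_restrict_of_ae_restrict_of_subset Ioo_subset_Icc_self
    (ae_hasDerivAt_primitive hab (hY.integrableOn hm hw x)), ae_restrict_mem measurableSet_Ioo]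
    with t ht hmem
  refine (ht.const_add (Y a x)).congr_of_eventuallyEq ?_
  filter_upwards [Icc_mem_nhds hmem.1 hmem.2] with s hs using hY.2 s hs x

theorem exists_test_bounds {F : Type*} [NormedAddCommGroup F] [NormedSpace ℝ F] {ψ : X → F}
    (hψ : ContDiff ℝ ∞ ψ) (hc : HasCompactSupport ψ) :
    ∃ A B : ℝ, 0 ≤ A ∧ 0 ≤ B ∧ (∀ x, ‖fderiv ℝ ψ x‖ ≤ A) ∧ (∀ x y, ‖ψ x - ψ y‖ ≤ A * ‖x - y‖) ∧
      ∀ x y, ‖fderiv ℝ ψ x - fderiv ℝ ψ y‖ ≤ B * ‖x - y‖ := by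
  obtain ⟨A, hA⟩ := ContDiff.lipschitzWith_of_hasCompactSupport hc hψ (by simp)
  have h1 : ContDiff ℝ 1 (fderiv ℝ ψ) := (contDiff_infty.1 hψ 2).fderiv_right (by norm_num)
  obtain ⟨B, hB⟩ := ContDiff.lipschitzWith_of_hasCompactSupport (hc.fderiv ℝ) h1 one_ne_zero
  exact ⟨A, B, A.2, B.2, fun x => norm_fderiv_le_of_lipschitz ℝ hA,
    fun x y => by simpa [dist_eq_norm] using hA.dist_le_mul x y,
    fun x y => by simpa [dist_eq_norm] using hB.dist_le_mul x y⟩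

theorem IsFlow.comp_sub_eq (hY : IsFlow a b w Y) (hm : Integrable m)
    (hw : IsLipschitzField a b m w) {ψ : X → ℝ} (hψ : ContDiff ℝ ∞ ψ) (hc : HasCompactSupport ψ)
    {t : ℝ} (ht : t ∈ Icc a b) (x : X) :
    ψ (Y t x) - ψ (Y a x) = ∫ s in a..t, fderiv ℝ ψ (Y s x) (w s (Y s x)) := by
  obtain ⟨A, B, hA, -, -, hψA, -⟩ := exists_test_bounds hψ hc
  refine (integral_eq_sub_of_ae_hasDerivAt (h := fun s => ψ (Y s x)) (m := fun s => A * m s) ht.1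
    (hm.intervalIntegrable.const_mul A) (fun s s' h1 h2 h3 => ?_) ?_).2.symm
  · rw [intervalIntegral.integral_const_mul]
    exact (hψA _ _).trans
      (mul_le_mul_of_nonneg_left (hY.norm_sub_le hm hw x h1 h2 (h3.trans ht.2)) hA)
  · filter_upwards [ae_restrict_of_ae_restrict_of_subset (Icc_subset_Icc_right ht.2)
      (hY.ae_hasDerivAt (ht.1.trans ht.2) hm hw x)] with s hs
    exact ((hψ.differentiable (by simp)) (Y s x)).hasFDerivAt.comp_hasDerivAt s hs

/-- The push-forward of a measure along the flow of `w` solves the continuity equation. -/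
theorem IsFlow.solvesCE (hY : IsFlow a b w Y) (hm : Integrable m)
    (hw : IsLipschitzField a b m w) (ρ : Pc X) :
    SolvesCE a b w (fun t => ρ.map (Y t) (Y t).continuous) := by
  refine ⟨fun t _ => ?_, ?_, fun ψ hψ hc => ?_⟩
  · have h1 : Tendsto (fun s => ‖Y s - Y t‖) (𝓝[Icc a b] t) (𝓝 0) := by
      have : Continuous fun s => ‖Y s - Y t‖ := by have := hY.1; fun_prop
      simpa using (this.tendsto t).mono_left nhdsWithin_le_nhds
    refine squeeze_zero (fun _ => wass_nonneg _ _ _) (fun s => ?_) h1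
    have hb : ∀ x, ‖Y s x - Y t x‖ ≤ ‖Y s - Y t‖ := fun x => (Y s - Y t).norm_coe_le_norm x
    have hi : Integrable (fun x => ‖Y s x - Y t x‖) ρ.toMeasure :=
      Integrable.of_bound (by have := (Y s).continuous; have := (Y t).continuous; fun_prop) ‖Y s - Y t‖
        (Eventually.of_forall fun x => by simpa using hb x)
    refine (wass_le_integral (P := ρ.toMeasure) (f := Y s) (g := Y t)
      (Y s).continuous.measurable.aemeasurable (Y t).continuous.measurable.aemeasurable rfl rfl
      hi).trans ?_
    refine (integral_mono hi (integrable_const _) hb).trans ?_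
    simp
  · filter_upwards [hw.ae_continuous, hw.norm_le] with t h1 h2
    exact Integrable.of_bound h1.aestronglyMeasurable (m t) (Eventually.of_forall h2)
  · obtain ⟨A, B, hA, -, hdA, hψA, -⟩ := exists_test_bounds hψ hc
    have hdc : Continuous (fderiv ℝ ψ) := hψ.continuous_fderiv (by simp)
    set k : ℝ → X → ℝ := fun s x => fderiv ℝ ψ (Y s x) (w s (Y s x))
    have hkmap : ∀ᵐ s ∂volume.restrict (Icc a b),
        ∫ x, fderiv ℝ ψ x (w s x) ∂(ρ.map (Y s) (Y s).continuous).toMeasure =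
          ∫ x, k s x ∂ρ.toMeasure := by
      filter_upwards [hw.ae_continuous] with s hs
      exact integral_map (Y s).continuous.measurable.aemeasurable
        (hdc.clm_apply hs).aestronglyMeasurable
    have hkb : ∀ᵐ s ∂volume.restrict (Icc a b), ∀ x, ‖k s x‖ ≤ A * m s := by
      filter_upwards [hw.norm_le] with s hs x
      exact (ContinuousLinearMap.le_opNorm _ _).trans
        (mul_le_mul (hdA _) (hs _) (norm_nonneg _) hA)
    have hkm : AEStronglyMeasurable (Function.uncurry k)
        ((volume.restrict (Icc a b)).prod ρ.toMeasure) :=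
      aestronglyMeasurable_uncurry_comp_caratheodory
        (g := fun s y => fderiv ℝ ψ y (w s y)) (x := fun s x => Y s x)
        (hw.ae_continuous.mono fun s hs => hdc.clm_apply hs)
        (fun y => (fderiv ℝ ψ y).continuous.comp_aestronglyMeasurable (hw.aestronglyMeasurable y))
        ρ.toMeasure hY.continuous_uncurry.measurable
    have hki : Integrable (Function.uncurry k)
        ((volume.restrict (Icc a b)).prod ρ.toMeasure) := by
      refine Integrable.mono' (g := fun z => A * m z.1)
        ((hm.integrableOn (s := Icc a b)).const_mul A |>.comp_fst ρ.toMeasure) hkm ?_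
      filter_upwards [Measure.quasiMeasurePreserving_fst.ae hkb] with z hz using hz z.2
    refine ⟨?_, fun t ht => ?_⟩
    · refine Integrable.congr hki.integral_prod_left ?_
      filter_upwards [hkmap] with s hs using hs.symm
    · have hint : ∀ s, Integrable (fun x => ψ (Y s x)) ρ.toMeasure := fun s => by
        obtain ⟨C, hC⟩ := hψ.continuous.bounded_above_of_compact_support hc
        exact Integrable.of_bound (hψ.continuous.comp (Y s).continuous).aestronglyMeasurable C
          (Eventually.of_forall fun x => hC _)
      have e1 : ∀ s, ∫ x, ψ x ∂(ρ.map (Y s) (Y s).continuous).toMeasure =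
          ∫ x, ψ (Y s x) ∂ρ.toMeasure := fun s =>
        integral_map (Y s).continuous.measurable.aemeasurable hψ.continuous.aestronglyMeasurable
      rw [e1, e1, ← sub_eq_iff_eq_add', ← integral_sub (hint t) (hint a)]
      have hsub : Ioc a t ⊆ Icc a b := Ioc_subset_Icc_self.trans (Icc_subset_Icc_right ht.2)
      rw [intervalIntegral.integral_of_le ht.1]
      rw [setIntegral_congr_ae (g := fun s => ∫ x, k s x ∂ρ.toMeasure) measurableSet_Ioc ?_]
      -- After Fubini, the claim is the chain rule along each single curve of the flow.
      · rw [integral_integral_swap (hki.mono_measure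
          (Measure.prod_mono (Measure.restrict_mono hsub le_rfl) le_rfl))]
        refine integral_congr_ae (Eventually.of_forall fun x => ?_)
        simp only
        rw [hY.comp_sub_eq hm hw hψ hc ht x, intervalIntegral.integral_of_le ht.1]
      · filter_upwards [(ae_restrict_iff' measurableSet_Icc).1 hkmap] with s hs hs'
        exact hs (hsub hs')

end Flow

/-! ### Uniqueness for the continuity equation with a Lipschitz field -/

section Uniqueness

variable {X : Type*} [NormedAddCommGroup X] [NormedSpace ℝ X] [FiniteDimensional ℝ X]
  [MeasurableSpace X] [BorelSpace X] {a b : ℝ} {m : ℝ → ℝ} {w : ℝ → X → X} {μ μ' : ℝ → Pc X}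

theorem Pc.ext_of_toMeasure {μ ν : Pc X} (h : μ.toMeasure = ν.toMeasure) : μ = ν := by
  cases μ; cases ν; cases h; rfl

theorem SolvesCE.sub_eq (h : SolvesCE a b w μ) {ψ : X → ℝ} (hψ : ContDiff ℝ ∞ ψ)
    (hc : HasCompactSupport ψ) {s t : ℝ} (hs : s ∈ Icc a b) (ht : t ∈ Icc a b) :
    ∫ x, ψ x ∂(μ t).toMeasure - ∫ x, ψ x ∂(μ s).toMeasure =
      ∫ r in s..t, ∫ x, fderiv ℝ ψ x (w r x) ∂(μ r).toMeasure := by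
  obtain ⟨h1, h2⟩ := h.2.2 ψ hψ hc
  have ha : a ∈ Icc a b := ⟨le_rfl, hs.1.trans hs.2⟩
  rw [h2 t ht, h2 s hs, add_sub_add_left_eq_sub]
  exact intervalIntegral.integral_interval_sub_left
    (IntegrableOn.intervalIntegrable_of_Icc h1 ha ht)
    (IntegrableOn.intervalIntegrable_of_Icc h1 ha hs)

theorem SolvesCE.mono (h : SolvesCE a b w μ) {c e : ℝ} (hce : Icc c e ⊆ Icc a b) :
    SolvesCE c e w μ := by
  refine ⟨fun t ht => (h.1 t (hce ht)).mono_left (nhdsWithin_mono _ hce),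
    ae_restrict_of_ae_restrict_of_subset hce h.2.1, fun ψ hψ hc =>
      ⟨(h.2.2 ψ hψ hc).1.mono_set hce, fun t ht => ?_⟩⟩
  rw [← h.sub_eq hψ hc (hce ⟨le_rfl, ht.1.trans ht.2⟩) (hce ht)]
  ring

/-- The equation sees the field only μ(t)-almost everywhere. This allows a velocity to be replaced
by its truncation, and back. -/
theorem SolvesCE.congr_field (h : SolvesCE a b w μ) {w' : ℝ → X → X}
    (hw : ∀ᵐ t ∂volume.restrict (Icc a b), ∀ᵐ x ∂(μ t).toMeasure, w t x = w' t x) :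
    SolvesCE a b w' μ := by
  have key : ∀ ψ : X → ℝ, ∀ᵐ t ∂volume.restrict (Icc a b),
      ∫ x, fderiv ℝ ψ x (w t x) ∂(μ t).toMeasure = ∫ x, fderiv ℝ ψ x (w' t x) ∂(μ t).toMeasure := by
    intro ψ
    filter_upwards [hw] with t ht
    refine integral_congr_ae ?_
    filter_upwards [ht] with x hx
    rw [hx]
  refine ⟨h.1, ?_, fun ψ hψ hc => ?_⟩
  · filter_upwards [h.2.1, hw] with t h1 h2 using h1.congr h2
  · obtain ⟨h1, h2⟩ := h.2.2 ψ hψ hc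
    refine ⟨h1.congr (key ψ), fun t ht => ?_⟩
    rw [h2 t ht]
    congr 1
    refine intervalIntegral.integral_congr_ae_restrict ?_
    rw [uIoc_of_le ht.1]
    exact ae_restrict_of_ae_restrict_of_subset
      (Ioc_subset_Icc_self.trans (Icc_subset_Icc_right ht.2)) (key ψ)

theorem SolvesCE.abs_sub_le_of_smooth (h : SolvesCE a b w μ) (hm : Integrable m)
    (hw : IsLipschitzField a b m w) {ψ : X → ℝ} (hψ : ContDiff ℝ ∞ ψ)
    (hc : HasCompactSupport ψ) {A : ℝ} (hA : 0 ≤ A) (hψA : ∀ x, ‖fderiv ℝ ψ x‖ ≤ A)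
    {s t : ℝ} (h1 : a ≤ s) (h2 : s ≤ t) (h3 : t ≤ b) :
    |∫ x, ψ x ∂(μ t).toMeasure - ∫ x, ψ x ∂(μ s).toMeasure| ≤ A * ∫ r in s..t, m r := by
  rw [h.sub_eq hψ hc ⟨h1, h2.trans h3⟩ ⟨h1.trans h2, h3⟩, ← intervalIntegral.integral_const_mul,
    ← Real.norm_eq_abs]
  refine norm_intervalIntegral_le_of_ae_le h1 h2 h3 ?_ (hm.integrableOn.const_mul A)
  filter_upwards [hw.norm_le] with r hr
  have := norm_integral_le_of_norm_le_const (μ := (μ r).toMeasure)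
    (f := fun x => fderiv ℝ ψ x (w r x)) (C := A * m r) (Eventually.of_forall fun x =>
    (ContinuousLinearMap.le_opNorm _ _).trans (mul_le_mul (hψA x) (hr x) (norm_nonneg _) hA))
  simpa using this

theorem norm_fderiv_le_of_norm_sub_le {F : Type*} [NormedAddCommGroup F] [NormedSpace ℝ F]
    {g : X → F} {A : ℝ} (hA : 0 ≤ A) (hg : ∀ x y, ‖g x - g y‖ ≤ A * ‖x - y‖) (x : X) :
    ‖fderiv ℝ g x‖ ≤ A :=
  norm_fderiv_le_of_lip' ℝ hA (Eventually.of_forall fun y => hg y x)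

/-- Mollification changes g by an arbitrarily small uniform error and does not increase its
Lipschitz constant. The extension beyond smooth test functions is needed for x ↦ Df(x) w(r, x),
which is merely Lipschitz. -/
theorem SolvesCE.abs_sub_le_of_lipschitz (h : SolvesCE a b w μ) (hm : Integrable m)
    (hw : IsLipschitzField a b m w) {g : X → ℝ} (hc : HasCompactSupport g) {A : ℝ}
    (hA : 0 ≤ A) (hg : ∀ x y, ‖g x - g y‖ ≤ A * ‖x - y‖)
    {s t : ℝ} (h1 : a ≤ s) (h2 : s ≤ t) (h3 : t ≤ b) :
    |∫ x, g x ∂(μ t).toMeasure - ∫ x, g x ∂(μ s).toMeasure| ≤ A * ∫ r in s..t, m r := by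
  refine le_of_forall_pos_le_add fun ε hε => ?_
  -- This scale makes the mollification error, at most scale times A, no larger than ε/2.
  obtain ⟨C, -, hC⟩ := exists_mollification X ℝ (r := ε / (2 * (A + 1))) (by positivity)
  obtain ⟨g', hg', happ, hlip, -, hcs⟩ := hC g A hA hg
  have happ' : ∀ x, ‖g' x - g x‖ ≤ ε / 2 := fun x => (happ x).trans <| by
    rw [div_mul_eq_mul_div, div_le_div_iff₀ (by positivity) (by positivity)]
    nlinarith
  have hd : ∀ r, |∫ x, g' x ∂(μ r).toMeasure - ∫ x, g x ∂(μ r).toMeasure| ≤ ε / 2 := fun r => by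
    rw [← integral_sub (integrable_of_lipschitz hlip _) (integrable_of_lipschitz hg _)]
    simpa using norm_integral_le_of_norm_le_const (μ := (μ r).toMeasure)
      (Eventually.of_forall happ')
  have key := h.abs_sub_le_of_smooth hm hw hg' (hcs hc) hA
    (norm_fderiv_le_of_norm_sub_le hA hlip) h1 h2 h3
  have e1 := abs_le.1 (hd t)
  have e2 := abs_le.1 (hd s)
  have e3 := abs_le.1 key
  exact abs_le.2 ⟨by linarith, by linarith⟩

theorem norm_taylor_le {f : X → ℝ} (hf : Differentiable ℝ f) {B : ℝ} (hB : 0 ≤ B)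
    (hfB : ∀ x y, ‖fderiv ℝ f x - fderiv ℝ f y‖ ≤ B * ‖x - y‖) (x v : X) :
    ‖f (x + v) - f x - fderiv ℝ f x v‖ ≤ B * ‖v‖ ^ 2 := by
  have := (convex_closedBall x ‖v‖).norm_image_sub_le_of_norm_fderiv_le' (𝕜 := ℝ) (f := f)
    (φ := fderiv ℝ f x) (C := B * ‖v‖) (x := x) (y := x + v) (fun z _ => hf z) (fun z hz => ?_)
    (by simp) (by simp)
  · simpa [pow_two, mul_assoc] using this
  · refine (hfB z x).trans (mul_le_mul_of_nonneg_left ?_ hB)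
    simpa [dist_eq_norm] using hz

/-- One step of the dual Euler scheme. -/
theorem SolvesCE.abs_sub_comp_le (h : SolvesCE a b w μ) (hm : Integrable m) (hm0 : ∀ t, 0 ≤ m t)
    (hw : IsLipschitzField a b m w) {f : X → ℝ} (hf : ContDiff ℝ ∞ f)
    (hc : HasCompactSupport f) {A B : ℝ} (hA : 0 ≤ A) (hB : 0 ≤ B)
    (hfA : ∀ x, ‖fderiv ℝ f x‖ ≤ A) (hfA' : ∀ x y, ‖f x - f y‖ ≤ A * ‖x - y‖)
    (hfB : ∀ x y, ‖fderiv ℝ f x - fderiv ℝ f y‖ ≤ B * ‖x - y‖)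
    {s t : ℝ} (h1 : a ≤ s) (h2 : s ≤ t) (h3 : t ≤ b) {δ η : ℝ} (hδ : ∫ r in s..t, m r ≤ δ)
    {Φ : X → X} (hΦ : Continuous Φ) (hΦη : ∀ x, ‖Φ x - (x + ∫ r in s..t, w r x)‖ ≤ η) :
    |∫ x, f x ∂(μ t).toMeasure - ∫ x, f (Φ x) ∂(μ s).toMeasure| ≤
      A * η + (A + 2 * B) * δ ^ 2 := by
  have hsub : Icc s t ⊆ Icc a b := Icc_subset_Icc h1 h3
  have hδ0 : 0 ≤ δ := (intervalIntegral.integral_nonneg h2 fun u _ => hm0 u).trans hδ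
  set Δ : X → X := fun x => ∫ r in s..t, w r x with hΔ
  have hwi : ∀ x, IntegrableOn (fun r => w r x) (Icc a b) := fun x =>
    integrableOn_of_ae_norm_le (hw.aestronglyMeasurable x) (hw.norm_le.mono fun r hr => hr x)
      hm.integrableOn
  have hwii : ∀ x, IntervalIntegrable (fun r => w r x) volume s t := fun x =>
    IntegrableOn.intervalIntegrable_of_Icc (hwi x) (hsub ⟨le_rfl, h2⟩) (hsub ⟨h2, le_rfl⟩)
  have hΔb : ∀ x, ‖Δ x‖ ≤ δ := fun x =>
    (norm_intervalIntegral_le_of_ae_le h1 h2 h3 (hw.norm_le.mono fun r hr => hr x)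
      hm.integrableOn).trans hδ
  have hΔl : ∀ x y, ‖Δ x - Δ y‖ ≤ δ * ‖x - y‖ := fun x y => by
    rw [hΔ]
    simp only
    rw [← intervalIntegral.integral_sub (hwii x) (hwii y)]
    refine (norm_intervalIntegral_le_of_ae_le h1 h2 h3 (hw.norm_sub_le.mono fun r hr => hr x y)
      (hm.integrableOn.mul_const _)).trans ?_
    rw [intervalIntegral.integral_mul_const]
    gcongr
  have hΔc : Continuous Δ := continuous_of_norm_sub_le hΔl
  have hdc : Continuous (fderiv ℝ f) := hf.continuous_fderiv (by simp)
  -- the integrands at the moving and at the frozen time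
  set k : ℝ → X → ℝ := fun r x => fderiv ℝ f x (w r x)
  have hkb : ∀ᵐ r ∂volume.restrict (Icc a b), ∀ x, ‖k r x‖ ≤ A * m r := by
    filter_upwards [hw.norm_le] with r hr x
    exact (ContinuousLinearMap.le_opNorm _ _).trans
      (mul_le_mul (hfA _) (hr _) (norm_nonneg _) hA)
  have hkm : AEStronglyMeasurable (Function.uncurry k)
      ((volume.restrict (Icc a b)).prod (μ s).toMeasure) :=
    aestronglyMeasurable_uncurry_comp_caratheodory
      (g := fun r y => fderiv ℝ f y (w r y)) (x := fun _ x => x)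
      (hw.ae_continuous.mono fun s hs => hdc.clm_apply hs)
      (fun y => (fderiv ℝ f y).continuous.comp_aestronglyMeasurable (hw.aestronglyMeasurable y))
      (μ s).toMeasure measurable_snd
  have hki : Integrable (Function.uncurry k)
      ((volume.restrict (Icc a b)).prod (μ s).toMeasure) := by
    refine Integrable.mono' (g := fun z => A * m z.1)
      ((hm.integrableOn (s := Icc a b)).const_mul A |>.comp_fst (μ s).toMeasure) hkm ?_
    filter_upwards [Measure.quasiMeasurePreserving_fst.ae hkb] with z hz using hz z.2
  have hsub' : Ioc s t ⊆ Icc a b := Ioc_subset_Icc_self.trans hsub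
  have hfub : ∫ r in s..t, ∫ x, k r x ∂(μ s).toMeasure =
      ∫ x, fderiv ℝ f x (Δ x) ∂(μ s).toMeasure := by
    rw [intervalIntegral.integral_of_le h2, integral_integral_swap (hki.mono_measure
      (Measure.prod_mono (Measure.restrict_mono hsub' le_rfl) le_rfl))]
    refine integral_congr_ae (Eventually.of_forall fun x => ?_)
    simp only [hΔ]
    rw [intervalIntegral.integral_of_le h2]
    exact ContinuousLinearMap.integral_comp_comm _ ((hwi x).mono_set hsub')
  -- Freezing the measure at time s. The integrand at time r is Lipschitz with constant (A + B)
  -- m(r), where A m(r) comes from w and B m(r) from Df. Against such a function the measure moves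
  -- by at most that constant times δ.
  have hdiff : |(∫ r in s..t, ∫ x, k r x ∂(μ r).toMeasure) -
      ∫ r in s..t, ∫ x, k r x ∂(μ s).toMeasure| ≤ (A + B) * δ ^ 2 := by
    have i1 : IntervalIntegrable (fun r => ∫ x, k r x ∂(μ r).toMeasure) volume s t :=
      IntegrableOn.intervalIntegrable_of_Icc (h.2.2 f hf hc).1 (hsub ⟨le_rfl, h2⟩)
        (hsub ⟨h2, le_rfl⟩)
    have i2 : IntervalIntegrable (fun r => ∫ x, k r x ∂(μ s).toMeasure) volume s t :=
      IntegrableOn.intervalIntegrable_of_Icc (a := a) (b := b) hki.integral_prod_left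
        (hsub ⟨le_rfl, h2⟩) (hsub ⟨h2, le_rfl⟩)
    rw [← intervalIntegral.integral_sub i1 i2, ← Real.norm_eq_abs]
    have hbd : ∀ᵐ r ∂volume.restrict (Icc s t),
        ‖(∫ x, k r x ∂(μ r).toMeasure) - ∫ x, k r x ∂(μ s).toMeasure‖ ≤
          (A + B) * δ * m r := by
      filter_upwards [ae_restrict_of_ae_restrict_of_subset hsub hw.norm_le,
        ae_restrict_of_ae_restrict_of_subset hsub hw.norm_sub_le,
        ae_restrict_mem measurableSet_Icc] with r e1 e2 e3
      have hl : ∀ x y, ‖k r x - k r y‖ ≤ (A + B) * m r * ‖x - y‖ := fun x y => by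
        have : k r x - k r y = (fderiv ℝ f x - fderiv ℝ f y) (w r x) +
            fderiv ℝ f y (w r x - w r y) := by simp [k]
        rw [this]
        calc _ ≤ ‖fderiv ℝ f x - fderiv ℝ f y‖ * ‖w r x‖ + ‖fderiv ℝ f y‖ * ‖w r x - w r y‖ :=
              (norm_add_le _ _).trans (add_le_add (ContinuousLinearMap.le_opNorm _ _)
                (ContinuousLinearMap.le_opNorm _ _))
          _ ≤ (B * ‖x - y‖) * m r + A * (m r * ‖x - y‖) := by
              gcongr
              · exact hfB x y
              · exact e1 x
              · exact hfA y
              · exact e2 x y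
          _ = _ := by ring
      have hcs : HasCompactSupport (k r) := by
        refine (hc.fderiv ℝ).mono fun x hx => ?_
        contrapose! hx
        simp only [Function.mem_support, not_not] at hx ⊢
        simp [k, hx]
      have := h.abs_sub_le_of_lipschitz hm hw hcs (mul_nonneg (add_nonneg hA hB) (hm0 r)) hl h1
        e3.1 (e3.2.trans h3)
      rw [Real.norm_eq_abs]
      refine this.trans ?_
      have e4 : ∫ r in s..r, m r ≤ δ := (integral_mono_right hm hm0 e3.2).trans hδ
      calc _ ≤ (A + B) * m r * δ := by
            have := hm0 r
            gcongr
        _ = _ := by ring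
    refine (norm_intervalIntegral_le_of_ae_le le_rfl h2 le_rfl hbd
      (hm.integrableOn.const_mul _)).trans ?_
    rw [intervalIntegral.integral_const_mul, pow_two, ← mul_assoc]
    gcongr
  -- Second-order Taylor expansion at x costs Bδ², and replacing x + Δ(x) by Φ(x) costs Aη. Together
  -- with the freezing error this gives A + 2B in front of δ².
  have hpt : ∀ x, ‖f x + fderiv ℝ f x (Δ x) - f (Φ x)‖ ≤ A * η + B * δ ^ 2 := fun x => by
    have e1 := norm_taylor_le (hf.differentiable (by simp)) hB hfB x (Δ x)
    have e2 := hfA' (Φ x) (x + Δ x)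
    have e3 := mul_le_mul_of_nonneg_left (hΦη x) hA
    have e4 : B * ‖Δ x‖ ^ 2 ≤ B * δ ^ 2 := by gcongr; exact hΔb x
    rw [Real.norm_eq_abs, abs_le] at e1 e2 ⊢
    exact ⟨by linarith, by linarith⟩
  have j1 : Integrable f (μ s).toMeasure := integrable_of_lipschitz hfA' _
  have j2 : Integrable (fun x => fderiv ℝ f x (Δ x)) (μ s).toMeasure :=
    Integrable.of_bound (hdc.clm_apply hΔc).aestronglyMeasurable (A * δ)
      (Eventually.of_forall fun x => (ContinuousLinearMap.le_opNorm _ _).trans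
        (mul_le_mul (hfA _) (hΔb _) (norm_nonneg _) hA))
  have j3 : Integrable (fun x => f (Φ x)) (μ s).toMeasure := by
    obtain ⟨K, hK⟩ := hf.continuous.bounded_above_of_compact_support hc
    exact Integrable.of_bound (hf.continuous.comp hΦ).aestronglyMeasurable K
      (Eventually.of_forall fun x => hK _)
  have hfin : |∫ x, (f x + fderiv ℝ f x (Δ x) - f (Φ x)) ∂(μ s).toMeasure| ≤
      A * η + B * δ ^ 2 := by
    simpa using norm_integral_le_of_norm_le_const (μ := (μ s).toMeasure)
      (Eventually.of_forall hpt)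
  have hsplit := integral_sub (j1.add j2) j3
  simp only [Pi.add_apply] at hsplit
  rw [hsplit, integral_add j1 j2] at hfin
  have hCE := h.sub_eq hf hc (hsub ⟨le_rfl, h2⟩) (hsub ⟨h2, le_rfl⟩)
  rw [hfub] at hdiff
  rw [abs_le] at hfin hdiff ⊢
  constructor <;> linarith [hfin.1, hfin.2, hdiff.1, hdiff.2]

end Uniqueness

/-! ### Iteration of the dual Euler step and passage to the limit. -/

section Uniqueness

variable {X : Type*} [NormedAddCommGroup X] [NormedSpace ℝ X] [FiniteDimensional ℝ X]
  [MeasurableSpace X] [BorelSpace X] {a b : ℝ} {m : ℝ → ℝ} {w : ℝ → X → X} {μ μ' : ℝ → Pc X}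

/-- By the chain rule, the derivative of the pull-back is Dg(x + Δ(x)) ∘ (Id + DΔ(x)). The constants
A(1 + δ) and B(1 + δ)² + AD govern one step of the dual scheme. Boundedness of Δ keeps the support
compact. -/
theorem test_function_comp {Δ : X → X} {g : X → ℝ} (hg : ContDiff ℝ ∞ g)
    (hc : HasCompactSupport g) {A B : ℝ} (hA : 0 ≤ A) (hB : 0 ≤ B)
    (hgA : ∀ x, ‖fderiv ℝ g x‖ ≤ A) (hgB : ∀ x y, ‖fderiv ℝ g x - fderiv ℝ g y‖ ≤ B * ‖x - y‖)
    (hΔ : ContDiff ℝ ∞ Δ) {δ D K : ℝ} (hδ : 0 ≤ δ) (hΔl : ∀ x y, ‖Δ x - Δ y‖ ≤ δ * ‖x - y‖)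
    (hΔd : ∀ x y, ‖fderiv ℝ Δ x - fderiv ℝ Δ y‖ ≤ D * ‖x - y‖) (hΔK : ∀ x, ‖Δ x‖ ≤ K) :
    ContDiff ℝ ∞ (fun x => g (x + Δ x)) ∧ HasCompactSupport (fun x => g (x + Δ x)) ∧
      (∀ x, ‖fderiv ℝ (fun x => g (x + Δ x)) x‖ ≤ A * (1 + δ)) ∧
      ∀ x y, ‖fderiv ℝ (fun x => g (x + Δ x)) x - fderiv ℝ (fun x => g (x + Δ x)) y‖ ≤
        (B * (1 + δ) ^ 2 + A * D) * ‖x - y‖ := by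
  have hd : ∀ x, fderiv ℝ (fun x => g (x + Δ x)) x =
      (fderiv ℝ g (x + Δ x)).comp (ContinuousLinearMap.id ℝ X + fderiv ℝ Δ x) := fun x =>
    (((hg.differentiable (by simp)) (x + Δ x)).hasFDerivAt.comp x
      ((hasFDerivAt_id x).add ((hΔ.differentiable (by simp)) x).hasFDerivAt)).fderiv
  have hI : ∀ x, ‖ContinuousLinearMap.id ℝ X + fderiv ℝ Δ x‖ ≤ 1 + δ := fun x =>
    (norm_add_le _ _).trans (add_le_add ContinuousLinearMap.norm_id_le
      (norm_fderiv_le_of_norm_sub_le hδ hΔl x))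
  refine ⟨hg.comp (contDiff_id.add hΔ), ?_, fun x => ?_, fun x y => ?_⟩
  · obtain ⟨R, hR⟩ := hc.isCompact.isBounded.subset_closedBall (0 : X)
    refine HasCompactSupport.intro (isCompact_closedBall (0 : X) (R + K)) fun x hx => ?_
    refine image_eq_zero_of_notMem_tsupport fun h => hx ?_
    have h1 := hR h
    rw [mem_closedBall_zero_iff] at h1 ⊢
    have h2 := norm_sub_le (x + Δ x) (Δ x)
    rw [add_sub_cancel_right] at h2
    linarith [hΔK x]
  · rw [hd]
    exact (ContinuousLinearMap.opNorm_comp_le _ _).trans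
      (mul_le_mul (hgA _) (hI x) (norm_nonneg _) hA)
  · rw [hd, hd]
    have e : (fderiv ℝ g (x + Δ x)).comp (ContinuousLinearMap.id ℝ X + fderiv ℝ Δ x) -
        (fderiv ℝ g (y + Δ y)).comp (ContinuousLinearMap.id ℝ X + fderiv ℝ Δ y) =
        (fderiv ℝ g (x + Δ x) - fderiv ℝ g (y + Δ y)).comp
          (ContinuousLinearMap.id ℝ X + fderiv ℝ Δ x) +
        (fderiv ℝ g (y + Δ y)).comp (fderiv ℝ Δ x - fderiv ℝ Δ y) := by
      ext v; simp; ring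
    rw [e]
    have h1 : ‖fderiv ℝ g (x + Δ x) - fderiv ℝ g (y + Δ y)‖ ≤ B * ((1 + δ) * ‖x - y‖) := by
      refine (hgB _ _).trans (mul_le_mul_of_nonneg_left ?_ hB)
      rw [add_sub_add_comm, one_add_mul]
      exact (norm_add_le _ _).trans (add_le_add le_rfl (hΔl x y))
    calc _ ≤ ‖fderiv ℝ g (x + Δ x) - fderiv ℝ g (y + Δ y)‖ *
          ‖ContinuousLinearMap.id ℝ X + fderiv ℝ Δ x‖ +
          ‖fderiv ℝ g (y + Δ y)‖ * ‖fderiv ℝ Δ x - fderiv ℝ Δ y‖ :=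
        (norm_add_le _ _).trans (add_le_add (ContinuousLinearMap.opNorm_comp_le _ _)
          (ContinuousLinearMap.opNorm_comp_le _ _))
      _ ≤ B * ((1 + δ) * ‖x - y‖) * (1 + δ) + A * (D * ‖x - y‖) := by
        gcongr
        · exact hI x
        · exact hgA _
        · exact hΔd x y
      _ = _ := by ring

/-- Instead of following the measures forward, the test function is pulled back step by step until
time a, where the two solutions agree. The increment of a Lipschitz field is only Lipschitz in x, so
it is mollified at scale r to keep the pulled-back function smooth. The factor 2 counts the two
solutions. The exponentials bound the growth of the constants A and B + CA over n steps. -/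
theorem SolvesCE.abs_sub_le_steps (h : SolvesCE a b w μ) (h' : SolvesCE a b w μ')
    (hm : Integrable m) (hm0 : ∀ t, 0 ≤ m t) (hw : IsLipschitzField a b m w) (h0 : μ a = μ' a)
    {r C : ℝ} (hC1 : 1 ≤ C)
    (hC : ∀ (g : X → X) (δ : ℝ), 0 ≤ δ → (∀ x y, ‖g x - g y‖ ≤ δ * ‖x - y‖) →
      ∃ g' : X → X, ContDiff ℝ ∞ g' ∧ (∀ x, ‖g' x - g x‖ ≤ r * δ) ∧
        (∀ x y, ‖g' x - g' y‖ ≤ δ * ‖x - y‖) ∧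
        (∀ x y, ‖fderiv ℝ g' x - fderiv ℝ g' y‖ ≤ C * δ * ‖x - y‖) ∧
        (HasCompactSupport g → HasCompactSupport g')) (hr : 0 ≤ r)
    {δ : ℝ} (hδ : 0 ≤ δ) (n : ℕ) :
    ∀ t ∈ Icc a b, ∫ s in a..t, m s ≤ n * δ → ∀ (f : X → ℝ) (A B : ℝ), ContDiff ℝ ∞ f →
      HasCompactSupport f → 0 ≤ A → 0 ≤ B → (∀ x, ‖fderiv ℝ f x‖ ≤ A) →
      (∀ x y, ‖fderiv ℝ f x - fderiv ℝ f y‖ ≤ B * ‖x - y‖) →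
      |∫ x, f x ∂(μ t).toMeasure - ∫ x, f x ∂(μ' t).toMeasure| ≤
        n * (2 * (A * Real.exp (n * δ) * (r * δ) +
          2 * (B + C * A) * Real.exp (2 * (n * δ)) * δ ^ 2)) := by
  have hlip : ∀ (f : X → ℝ) (A : ℝ), ContDiff ℝ ∞ f → (∀ x, ‖fderiv ℝ f x‖ ≤ A) →
      ∀ x y, ‖f x - f y‖ ≤ A * ‖x - y‖ := fun f A hf hA x y =>
    convex_univ.norm_image_sub_le_of_norm_fderiv_le (𝕜 := ℝ)
      (fun z _ => (hf.differentiable (by simp)) z) (fun z _ => hA z) (mem_univ _) (mem_univ _)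
  induction n with
  | zero =>
    intro t ht hM f A B hf hc hA hB hfA hfB
    have e1 := h.abs_sub_le_of_smooth hm hw hf hc hA hfA le_rfl ht.1 ht.2
    have e2 := h'.abs_sub_le_of_smooth hm hw hf hc hA hfA le_rfl ht.1 ht.2
    rw [← h0] at e2
    have e3 : A * ∫ s in a..t, m s ≤ 0 := mul_nonpos_of_nonneg_of_nonpos hA (by simpa using hM)
    rw [abs_le] at e1 e2
    simp only [Nat.cast_zero, zero_mul]
    rw [abs_le]
    constructor <;> linarith [e1.1, e1.2, e2.1, e2.2]
  | succ n ih =>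
    intro t ht hM f A B hf hc hA hB hfA hfB
    set M : ℝ → ℝ := fun s => ∫ r in a..s, m r
    have hMc : Continuous M := intervalIntegral.continuous_primitive
      (fun _ _ => hm.intervalIntegrable) a
    have hM0 : 0 ≤ M t := intervalIntegral.integral_nonneg ht.1 fun u _ => hm0 u
    -- Steps are measured by the integral of m rather than by time. The minimum covers the case in
    -- which less than nδ is available.
    obtain ⟨s, hs, hsM⟩ : min (n * δ) (M t) ∈ M '' Icc a t := by
      refine intermediate_value_Icc ht.1 hMc.continuousOn ⟨?_, min_le_right _ _⟩
      simp only [M, intervalIntegral.integral_same]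
      exact le_min (by positivity) hM0
    have hsn : M s ≤ n * δ := hsM.le.trans (min_le_left _ _)
    have hst : ∫ r in s..t, m r ≤ δ := by
      rw [integral_rate_eq_sub hm a]
      show M t - M s ≤ δ
      have hM' : M t ≤ (n + 1) * δ := by simpa using hM
      rw [hsM]
      rcases min_choice (n * δ) (M t) with h | h <;> rw [h] <;> linarith
    have hs' : s ∈ Icc a b := ⟨hs.1, hs.2.trans ht.2⟩
    have hwii : ∀ x, IntervalIntegrable (fun r => w r x) volume s t := fun x =>
      IntegrableOn.intervalIntegrable_of_Icc (integrableOn_of_ae_norm_le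
        (hw.aestronglyMeasurable x) (hw.norm_le.mono fun r hr => hr x) hm.integrableOn) hs' ht
    have hΔl : ∀ x y, ‖(∫ r in s..t, w r x) - ∫ r in s..t, w r y‖ ≤ δ * ‖x - y‖ := fun x y => by
      rw [← intervalIntegral.integral_sub (hwii x) (hwii y)]
      refine (norm_intervalIntegral_le_of_ae_le hs.1 hs.2 ht.2
        (hw.norm_sub_le.mono fun r hr => hr x y) (hm.integrableOn.mul_const _)).trans ?_
      rw [intervalIntegral.integral_mul_const]
      gcongr
    have hΔb : ∀ x, ‖∫ r in s..t, w r x‖ ≤ δ := fun x =>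
      (norm_intervalIntegral_le_of_ae_le hs.1 hs.2 ht.2 (hw.norm_le.mono fun r hr => hr x)
        hm.integrableOn).trans hst
    obtain ⟨Δ, hΔ, hΔa, hΔl', hΔd, -⟩ := hC _ δ hδ hΔl
    have hΔK : ∀ x, ‖Δ x‖ ≤ δ + r * δ := fun x => by
      have := norm_add_le (Δ x - ∫ r in s..t, w r x) (∫ r in s..t, w r x)
      rw [sub_add_cancel] at this
      linarith [hΔa x, hΔb x]
    obtain ⟨k1, k2, k3, k4⟩ := test_function_comp hf hc hA hB hfA hfB hΔ hδ hΔl' hΔd hΔK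
    have hCA : 0 ≤ C * A := mul_nonneg (by linarith) hA
    have hB' : 0 ≤ B * (1 + δ) ^ 2 + A * (C * δ) := by
      have : A * (C * δ) = C * A * δ := by ring
      rw [this]; positivity
    have hA' : 0 ≤ A * (1 + δ) := by positivity
    have e3 := ih s hs' hsn _ _ _ k1 k2 hA' hB' k3 k4
    have hΔη : ∀ x, ‖(x + Δ x) - (x + ∫ r in s..t, w r x)‖ ≤ r * δ := fun x => by
      rw [add_sub_add_left_eq_sub]; exact hΔa x
    have hΦ : Continuous fun x => x + Δ x := continuous_id.add hΔ.continuous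
    have e1 := h.abs_sub_comp_le hm hm0 hw hf hc hA hB hfA (hlip f A hf hfA) hfB hs.1 hs.2 ht.2 hst
      hΦ hΔη
    have e2 := h'.abs_sub_comp_le hm hm0 hw hf hc hA hB hfA (hlip f A hf hfA) hfB hs.1 hs.2 ht.2 hst
      hΦ hΔη
    set Q := B + C * A
    have hQ : 0 ≤ Q := by positivity
    have hAQ : A + 2 * B ≤ 2 * Q := by
      have : A ≤ C * A := le_mul_of_one_le_left hA hC1
      simp only [Q]; linarith
    -- Q = B + CA grows by at most (1 + δ)² per step: the terms in CA add up to CA(1 + 2δ) ≤ CA(1 +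
    -- δ)².
    have hQ' : B * (1 + δ) ^ 2 + A * (C * δ) + C * (A * (1 + δ)) ≤ Q * (1 + δ) ^ 2 := by
      have : 0 ≤ C * A * δ ^ 2 := by positivity
      simp only [Q]; nlinarith
    have hexp : 1 + δ ≤ Real.exp δ := by linarith [Real.add_one_le_exp δ]
    have hexp2 : (1 + δ) ^ 2 ≤ Real.exp (2 * δ) := by
      have : Real.exp (2 * δ) = Real.exp δ ^ 2 := by rw [← Real.exp_nat_mul]; norm_num
      rw [this]; gcongr
    set EA := A * Real.exp (((n + 1 : ℕ) : ℝ) * δ) * (r * δ)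
    set EQ := 2 * Q * Real.exp (2 * (((n + 1 : ℕ) : ℝ) * δ)) * δ ^ 2
    have f1 : A * (1 + δ) * Real.exp (n * δ) * (r * δ) ≤ EA := by
      have : Real.exp (((n + 1 : ℕ) : ℝ) * δ) = Real.exp δ * Real.exp (n * δ) := by
        rw [← Real.exp_add]; push_cast; ring_nf
      simp only [EA]
      rw [this, ← mul_assoc A]
      gcongr
    have f2 : 2 * (B * (1 + δ) ^ 2 + A * (C * δ) + C * (A * (1 + δ))) *
        Real.exp (2 * (n * δ)) * δ ^ 2 ≤ EQ := by
      have : Real.exp (2 * (((n + 1 : ℕ) : ℝ) * δ)) =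
          Real.exp (2 * δ) * Real.exp (2 * (n * δ)) := by
        rw [← Real.exp_add]; push_cast; ring_nf
      simp only [EQ]
      rw [this, ← mul_assoc (2 * Q), mul_assoc 2 Q]
      gcongr
      exact hQ'.trans (by gcongr)
    have f3 : A * (r * δ) ≤ EA := by
      have : 1 ≤ Real.exp (((n + 1 : ℕ) : ℝ) * δ) := Real.one_le_exp (by positivity)
      simp only [EA]
      have h2 : 0 ≤ A * (r * δ) := by positivity
      calc A * (r * δ) = A * 1 * (r * δ) := by ring
        _ ≤ _ := by gcongr
    have f4 : (A + 2 * B) * δ ^ 2 ≤ EQ := by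
      have : 1 ≤ Real.exp (2 * (((n + 1 : ℕ) : ℝ) * δ)) := Real.one_le_exp (by positivity)
      simp only [EQ]
      calc (A + 2 * B) * δ ^ 2 ≤ 2 * Q * 1 * δ ^ 2 := by rw [mul_one]; gcongr
        _ ≤ _ := by gcongr
    have f5 : (n : ℝ) * (2 * (A * (1 + δ) * Real.exp (n * δ) * (r * δ) +
        2 * (B * (1 + δ) ^ 2 + A * (C * δ) + C * (A * (1 + δ))) *
        Real.exp (2 * (n * δ)) * δ ^ 2)) ≤ n * (2 * (EA + EQ)) := by
      gcongr
    have f6 : ((n + 1 : ℕ) : ℝ) * (2 * (EA + EQ)) = n * (2 * (EA + EQ)) + 2 * (EA + EQ) := by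
      push_cast; ring
    rw [f6]
    rw [abs_le] at e1 e2 e3 ⊢
    constructor <;> linarith [e1.1, e1.2, e2.1, e2.2, e3.1, e3.2]

theorem SolvesCE.integral_eq (h : SolvesCE a b w μ) (h' : SolvesCE a b w μ')
    (hm : Integrable m) (hm0 : ∀ t, 0 ≤ m t) (hw : IsLipschitzField a b m w) (h0 : μ a = μ' a)
    {t : ℝ} (ht : t ∈ Icc a b) {f : X → ℝ} (hf : ContDiff ℝ ∞ f) (hc : HasCompactSupport f) :
    ∫ x, f x ∂(μ t).toMeasure = ∫ x, f x ∂(μ' t).toMeasure := by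
  obtain ⟨A, B, hA, hB, hfA, -, hfB⟩ := exists_test_bounds hf hc
  set M := ∫ s in a..t, m s
  have hM0 : 0 ≤ M := intervalIntegral.integral_nonneg ht.1 fun u _ => hm0 u
  set c := |∫ x, f x ∂(μ t).toMeasure - ∫ x, f x ∂(μ' t).toMeasure|
  -- The order of limits matters, as C depends on r. For fixed r, equal steps δ = M/(N + 1) with N →
  -- ∞ remove the quadratic error; the remaining mollification error is linear in r and vanishes as
  -- r → 0.
  have key : ∀ r > 0, c ≤ r * (2 * A * Real.exp M * M) := by
    intro r hr
    obtain ⟨C, hC1, hC⟩ := exists_mollification X X hr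
    set Q := B + C * A
    have hlim : Tendsto (fun N : ℕ => r * (2 * A * Real.exp M * M) +
        4 * Q * Real.exp (2 * M) * M ^ 2 / ((N : ℝ) + 1)) atTop
        (𝓝 (r * (2 * A * Real.exp M * M) + 0)) :=
      tendsto_const_nhds.add (tendsto_const_nhds.div_atTop
        (tendsto_atTop_add_const_right _ _ tendsto_natCast_atTop_atTop))
    rw [add_zero] at hlim
    refine ge_of_tendsto' hlim fun N => ?_
    have hN : (0 : ℝ) < (N : ℝ) + 1 := by positivity
    have e : ((N + 1 : ℕ) : ℝ) * (M / ((N : ℝ) + 1)) = M := by push_cast; field_simp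
    refine (h.abs_sub_le_steps h' hm hm0 hw h0 hC1 hC hr.le (δ := M / ((N : ℝ) + 1))
      (by positivity) (N + 1) t ht e.ge f A B hf hc hA hB hfA hfB).trans (le_of_eq ?_)
    rw [e]
    push_cast
    simp only [Q]
    field_simp
    ring
  have hc0 : c ≤ 0 := by
    have hlim : Tendsto (fun r : ℝ => r * (2 * A * Real.exp M * M)) (𝓝[>] 0) (𝓝 0) := by
      have : Continuous fun r : ℝ => r * (2 * A * Real.exp M * M) := by fun_prop
      simpa using (this.tendsto 0).mono_left nhdsWithin_le_nhds
    refine ge_of_tendsto hlim ?_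
    filter_upwards [self_mem_nhdsWithin] with r hr using key r hr
  exact sub_eq_zero.1 (abs_eq_zero.1 (le_antisymm hc0 (abs_nonneg _)))

/-- A continuous compactly supported g is uniformly close to a smooth k. A bump function equal to 1
on the support of g makes k compactly supported without increasing the error. -/
theorem Pc.ext_of_integral_smooth {μ ν : Pc X} (h : ∀ f : X → ℝ, ContDiff ℝ ∞ f →
    HasCompactSupport f → ∫ x, f x ∂μ.toMeasure = ∫ x, f x ∂ν.toMeasure) : μ = ν := by
  refine Pc.ext_of_toMeasure (Measure.ext_of_integral_eq_on_compactlySupported fun g => ?_)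
  have hgc : Continuous g := g.continuous
  have hgs : HasCompactSupport g := g.hasCompactSupport
  obtain ⟨R, hR⟩ := hgs.isCompact.isBounded.subset_closedBall (0 : X)
  let χ : ContDiffBump (0 : X) := ⟨max R 1, max R 1 + 1, by positivity, by linarith⟩
  have hg1 : ∀ x, χ x * g x = g x := fun x => by
    by_cases hx : x ∈ tsupport g
    · have : χ x = 1 := χ.one_of_mem_closedBall
        (Metric.closedBall_subset_closedBall (le_max_left _ _) (hR hx))
      rw [this, one_mul]
    · rw [image_eq_zero_of_notMem_tsupport hx, mul_zero]
  refine eq_of_forall_dist_le fun ε hε => ?_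
  obtain ⟨k, hk, hkg⟩ := (hgs.uniformContinuous_of_continuous hgc).exists_contDiff_dist_le
    (half_pos hε)
  have hχk : ContDiff ℝ ∞ fun x => χ x * k x := χ.contDiff.mul hk
  have hχc : HasCompactSupport fun x => χ x * k x := χ.hasCompactSupport.mul_right
  have hd : ∀ ρ : Pc X, |∫ x, χ x * k x ∂ρ.toMeasure - ∫ x, g x ∂ρ.toMeasure| ≤ ε / 2 := by
    intro ρ
    rw [← integral_sub (hχk.continuous.integrable_of_hasCompactSupport hχc)
      (hgc.integrable_of_hasCompactSupport hgs)]
    have := norm_integral_le_of_norm_le_const (μ := ρ.toMeasure)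
      (f := fun x => χ x * k x - g x) (C := ε / 2) (Eventually.of_forall fun x => by
      rw [← hg1, ← mul_sub, norm_mul, Real.norm_of_nonneg χ.nonneg, ← dist_eq_norm]
      exact (mul_le_of_le_one_left dist_nonneg χ.le_one).trans (hkg x).le)
    simpa using this
  have e1 := abs_le.1 (hd μ)
  have e2 := abs_le.1 (hd ν)
  rw [h _ hχk hχc] at e1
  rw [Real.dist_eq]
  exact abs_le.2 ⟨by linarith, by linarith⟩

/-- Solutions of the continuity equation with a Lipschitz field are unique. -/
theorem SolvesCE.eq_of_eq_left (h : SolvesCE a b w μ) (h' : SolvesCE a b w μ')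
    (hm : Integrable m) (hm0 : ∀ t, 0 ≤ m t) (hw : IsLipschitzField a b m w) (h0 : μ a = μ' a)
    {t : ℝ} (ht : t ∈ Icc a b) : μ t = μ' t :=
  Pc.ext_of_integral_smooth fun _ hf hc => h.integral_eq h' hm hm0 hw h0 ht hf hc

end Uniqueness

/-! ### Bounds on the supports of solutions of the continuity equation -/

section Support

/-- Glues y to the constant 1 with a smooth step. Composed with a shifted logarithm, it stops the
growth of log(1 + |x|²) just above a level n. -/
theorem exists_smooth_plateau : ∃ (q : ℝ → ℝ) (C : ℝ), 0 ≤ C ∧ ContDiff ℝ ∞ q ∧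
    (∀ y ≤ 0, q y = y) ∧ (∀ y, 1 ≤ y → q y = 1) ∧ ∀ y, |deriv q y| ≤ C := by
  set q : ℝ → ℝ := fun y => y * (1 - Real.smoothTransition y) + Real.smoothTransition y
  have hq : ContDiff ℝ ∞ q :=
    (contDiff_id.mul (contDiff_const.sub Real.smoothTransition.contDiff)).add
      Real.smoothTransition.contDiff
  have h0 : ∀ y ≤ 0, q y = y := fun y hy => by
    simp [q, Real.smoothTransition.zero_of_nonpos hy]
  have h1 : ∀ y, 1 ≤ y → q y = 1 := fun y hy => by
    simp [q, Real.smoothTransition.one_of_one_le hy]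
  obtain ⟨C, hC⟩ := (isCompact_Icc (a := (0 : ℝ)) (b := 1)).exists_bound_of_continuousOn
    (hq.continuous_deriv (by simp)).continuousOn
  refine ⟨q, max C 1, by positivity, hq, h0, h1, fun y => ?_⟩
  rcases lt_or_ge y 0 with hy | hy
  · have : deriv q y = 1 := by
      have : q =ᶠ[𝓝 y] fun y => y := by
        filter_upwards [Iio_mem_nhds hy] with z hz using h0 z (le_of_lt hz)
      rw [this.deriv_eq]; simp
    rw [this]; simp
  rcases le_or_gt y 1 with hy' | hy'
  · exact (hC y ⟨hy, hy'⟩).trans (le_max_left _ _)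
  · have : deriv q y = 0 := by
      have : q =ᶠ[𝓝 y] fun _ => 1 := by
        filter_upwards [Ioi_mem_nhds hy'] with z hz using h1 z (le_of_lt hz)
      rw [this.deriv_eq]; simp
    rw [this]; simp

variable {X : Type*} [NormedAddCommGroup X] [InnerProductSpace ℝ X] [FiniteDimensional ℝ X]

/-- Smooth truncations, constant at infinity, of the powers `(1 + ‖x‖²) ^ p`. -/
theorem exists_truncated_power (X : Type*) [NormedAddCommGroup X] [InnerProductSpace ℝ X]
    [FiniteDimensional ℝ X] : ∃ C : ℝ, 0 ≤ C ∧ ∀ p n : ℝ, 0 ≤ p →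
    ∃ ψ : X → ℝ, ContDiff ℝ ∞ ψ ∧ (∀ x, 0 < ψ x) ∧
      (∃ c : ℝ, HasCompactSupport fun x => ψ x - c) ∧
      (∀ x, Real.log (1 + ‖x‖ ^ 2) ≤ n → ψ x = Real.exp (p * Real.log (1 + ‖x‖ ^ 2))) ∧
      ∀ x v, |fderiv ℝ ψ x v| ≤ C * p * ψ x * (‖x‖ * ‖v‖ / (1 + ‖x‖ ^ 2)) := by
  obtain ⟨q, C, hC, hq, hq0, hq1, hqC⟩ := exists_smooth_plateau
  refine ⟨2 * C, by positivity, fun p n hp => ?_⟩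
  have hpos : ∀ x : X, 0 < 1 + ‖x‖ ^ 2 := fun x => by positivity
  set g : X → ℝ := fun x => Real.log (1 + ‖x‖ ^ 2)
  have hsq : ContDiff ℝ ∞ fun x : X => 1 + ‖x‖ ^ 2 := contDiff_const.add (contDiff_norm_sq ℝ)
  have hg : ContDiff ℝ ∞ g := hsq.log fun x => (hpos x).ne'
  -- Truncating the logarithm rather than the power keeps ψ itself as a factor of Dψ. The derivative
  -- bound is therefore uniform in n.
  set ψ : X → ℝ := fun x => Real.exp (p * (n + q (g x - n)))
  have hψ : ContDiff ℝ ∞ ψ :=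
    (contDiff_const.mul (contDiff_const.add (hq.comp (hg.sub contDiff_const)))).exp
  refine ⟨ψ, hψ, fun x => Real.exp_pos _, ⟨Real.exp (p * (n + 1)), ?_⟩, fun x hx => ?_,
    fun x v => ?_⟩
  · refine HasCompactSupport.intro (isCompact_closedBall (0 : X) (Real.exp (n + 1))) fun x hx => ?_
    rw [mem_closedBall_zero_iff, not_le] at hx
    have hx' : n + 1 ≤ g x := by
      rw [Real.le_log_iff_exp_le (hpos x)]
      nlinarith [norm_nonneg x]
    simp only [ψ]
    rw [hq1 _ (by linarith), sub_self]
  · simp only [ψ]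
    rw [hq0 _ (by simp only [g]; linarith)]
    simp only [g]
    ring_nf
  · have hgd : HasFDerivAt g ((1 + ‖x‖ ^ 2)⁻¹ • (2 • (innerSL ℝ x))) x :=
      (((hasStrictFDerivAt_norm_sq x).hasFDerivAt).const_add 1).log (hpos x).ne'
    have hqd : HasDerivAt q (deriv q (g x - n)) (g x - n) :=
      ((hq.differentiable (by simp)) _).hasDerivAt
    have hψd := (((hqd.comp_hasFDerivAt x (hgd.sub_const n)).const_add n).const_mul p).exp
    have hE : fderiv ℝ ψ x v = ψ x * (p * (deriv q (g x - n) *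
        ((1 + ‖x‖ ^ 2)⁻¹ * (2 * inner ℝ x v)))) := by
      have := hψd.fderiv
      rw [show fderiv ℝ ψ x = _ from this]
      simp [ψ]
    rw [hE, abs_mul, abs_mul, abs_mul, abs_mul, abs_mul, abs_of_pos (Real.exp_pos _),
      abs_of_nonneg hp, abs_of_pos (inv_pos.2 (hpos x)), abs_two]
    have h1 := hqC (g x - n)
    have h2 := abs_real_inner_le_norm x v
    calc ψ x * (p * (|deriv q (g x - n)| * ((1 + ‖x‖ ^ 2)⁻¹ * (2 * |inner ℝ x v|))))
        ≤ ψ x * (p * (C * ((1 + ‖x‖ ^ 2)⁻¹ * (2 * (‖x‖ * ‖v‖))))) := by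
          have := (Real.exp_pos (p * (n + q (g x - n)))).le
          gcongr
      _ = _ := by rw [div_eq_mul_inv]; ring

variable [MeasurableSpace X] [BorelSpace X]
  {a b : ℝ} {m : ℝ → ℝ} {w : ℝ → X → X} {μ : ℝ → Pc X}

/-- Grönwall for t ↦ ∫ ψ dμ(t). Constants at infinity are harmless: subtracting c changes no
derivative and shifts every integral by c, the masses being 1. -/
theorem SolvesCE.integral_le_mul_exp (h : SolvesCE a b w μ) (hm : Integrable m) (hm0 : ∀ t, 0 ≤ m t)
    {ψ : X → ℝ} (hψ : ContDiff ℝ ∞ ψ) (hc : ∃ c : ℝ, HasCompactSupport fun x => ψ x - c)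
    (H : ∀ᵐ t ∂volume.restrict (Icc a b),
      ∫ x, fderiv ℝ ψ x (w t x) ∂(μ t).toMeasure ≤ m t * ∫ x, ψ x ∂(μ t).toMeasure)
    {t : ℝ} (ht : t ∈ Icc a b) :
    ∫ x, ψ x ∂(μ t).toMeasure ≤ (∫ x, ψ x ∂(μ a).toMeasure) * Real.exp (∫ s in a..t, m s) := by
  obtain ⟨c, hc⟩ := hc
  have hψc : ContDiff ℝ ∞ fun x => ψ x - c := hψ.sub contDiff_const
  have hfd : ∀ x, fderiv ℝ (fun x => ψ x - c) x = fderiv ℝ ψ x := fun x => fderiv_sub_const c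
  have hint : ∀ s, Integrable ψ (μ s).toMeasure := fun s => by
    have := (hψc.continuous.integrable_of_hasCompactSupport (μ := (μ s).toMeasure) hc).add
      (integrable_const c)
    refine this.congr (Eventually.of_forall fun x => ?_)
    simp
  have hI : ∀ s, ∫ x, (ψ x - c) ∂(μ s).toMeasure = ∫ x, ψ x ∂(μ s).toMeasure - c := fun s => by
    rw [integral_sub (hint s) (integrable_const c)]; simp
  obtain ⟨h1, h2⟩ := h.2.2 _ hψc hc
  simp only [hfd, hI] at h1 h2
  have h2' : ∀ s ∈ Icc a b, ∫ x, ψ x ∂(μ s).toMeasure = ∫ x, ψ x ∂(μ a).toMeasure +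
      ∫ r in a..s, ∫ x, fderiv ℝ ψ x (w r x) ∂(μ r).toMeasure := fun s hs => by
    linarith [h2 s hs]
  have hab : a ≤ b := ht.1.trans ht.2
  have hcont : ContinuousOn (fun s => ∫ x, ψ x ∂(μ s).toMeasure) (Icc a b) := by
    refine ContinuousOn.congr ?_ h2'
    refine continuousOn_const.add ?_
    have := intervalIntegral.continuousOn_primitive_interval
      (f := fun r => ∫ x, fderiv ℝ ψ x (w r x) ∂(μ r).toMeasure) (μ := volume) (a := a) (b := b)
      (by rwa [uIcc_of_le hab])
    rwa [uIcc_of_le hab] at this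
  have hsub : Icc a t ⊆ Icc a b := Icc_subset_Icc_right ht.2
  refine gronwall_of_le_integral hm hm0 ht.1 (hcont.mono hsub) fun s hs => ?_
  have hs' := hsub hs
  rw [h2' s hs']
  refine add_le_add le_rfl (intervalIntegral.integral_mono_ae_restrict hs.1
    (IntegrableOn.intervalIntegrable_of_Icc h1 ⟨le_rfl, hab⟩ hs') ?_ ?_)
  · refine hm.intervalIntegrable.mul_continuousOn ?_
    rw [uIcc_of_le hs.1]
    exact hcont.mono (Icc_subset_Icc_right hs'.2)
  · exact ae_restrict_of_ae_restrict_of_subset (Icc_subset_Icc_right hs'.2) H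

/-- Under a sublinear growth condition, the supports stay in a ball whose radius depends only on
the initial support and the integral of the rate. -/
theorem SolvesCE.exists_support_bound (X : Type*) [NormedAddCommGroup X] [InnerProductSpace ℝ X]
    [FiniteDimensional ℝ X] [MeasurableSpace X] [BorelSpace X] :
    ∃ C : ℝ, 0 ≤ C ∧ ∀ {a b : ℝ} {m : ℝ → ℝ} {w : ℝ → X → X} {μ : ℝ → Pc X}, SolvesCE a b w μ →
      Integrable m → (∀ t, 0 ≤ m t) →
      (∀ᵐ t ∂volume.restrict (Icc a b), ∀ x, ‖w t x‖ ≤ m t * (1 + ‖x‖)) →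
      ∀ {R : ℝ}, μ a ∈ POn (Metric.closedBall 0 R) → ∀ t ∈ Icc a b,
      μ t ∈ POn (Metric.closedBall 0
        (Real.exp (Real.log (1 + R ^ 2) + C * (∫ s in a..t, m s) + 1))) := by
  obtain ⟨C, hC, hpow⟩ := exists_truncated_power X
  refine ⟨2 * C, by positivity, fun {a b m w μ} h hm hm0 hw {R} hR t ht => ?_⟩
  set M := ∫ s in a..t, m s
  set g₀ := Real.log (1 + R ^ 2)
  set G := g₀ + 2 * C * M with hG
  obtain ⟨S, hS, hSμ⟩ := (μ t).exists_mem_POn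
  have hlogmono : ∀ {x : X} {r : ℝ}, ‖x‖ ≤ r → Real.log (1 + ‖x‖ ^ 2) ≤ Real.log (1 + r ^ 2) :=
    fun {x r} hx => Real.log_le_log (by positivity) (by gcongr)
  -- The truncation is inactive on the supports of μ(a) and μ(t). Intermediate times need no such
  -- care, since the bound on Dψ holds everywhere.
  set n := max g₀ (Real.log (1 + S ^ 2))
  -- Grönwall bounds the p-th power moment at time t by exp(pG), and Markov's inequality at the
  -- level exp(p(G + 1)) leaves mass at most exp(−p). Letting p → ∞ shows that the set is null.
  have key : ∀ p : ℕ, (μ t).toMeasure.real {x | G + 1 ≤ Real.log (1 + ‖x‖ ^ 2)} ≤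
      Real.exp (-1) ^ p := by
    intro p
    obtain ⟨ψ, hψ, hψ0, hψc, hψn, hψd⟩ := hpow p n (Nat.cast_nonneg p)
    have hint : ∀ s, Integrable ψ (μ s).toMeasure := fun s => by
      obtain ⟨c, hc⟩ := hψc
      have := ((hψ.continuous.sub continuous_const).integrable_of_hasCompactSupport
        (μ := (μ s).toMeasure) hc).add (integrable_const c)
      refine this.congr (Eventually.of_forall fun x => ?_)
      simp
    have h1 := h.integral_le_mul_exp (m := fun t => (2 * C * p) * m t) (hm.const_mul _)
      (fun t => by have := hm0 t; positivity) hψ hψc ?_ ht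
    · have h2 : ∫ x, ψ x ∂(μ a).toMeasure ≤ Real.exp (p * g₀) := by
        have : ∀ᵐ x ∂(μ a).toMeasure, ψ x ≤ Real.exp (p * g₀) := by
          filter_upwards [ae_norm_le_of_mem_POn hR] with x hx
          rw [hψn x ((hlogmono hx).trans (le_max_left _ _))]
          have := hlogmono hx
          gcongr
        refine (integral_mono_ae (hint a) (integrable_const _) this).trans ?_
        simp
      have h3 : Real.exp (p * (G + 1)) *
          (μ t).toMeasure.real {x | G + 1 ≤ Real.log (1 + ‖x‖ ^ 2)} ≤
          ∫ x, ψ x ∂(μ t).toMeasure := by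
        refine le_trans ?_ (mul_meas_ge_le_integral_of_nonneg
          (Eventually.of_forall fun x => (hψ0 x).le) (hint t) (Real.exp (p * (G + 1))))
        refine mul_le_mul_of_nonneg_left ?_ (Real.exp_pos _).le
        refine ENNReal.toReal_mono (measure_ne_top _ _) (measure_mono_ae ?_)
        filter_upwards [ae_norm_le_of_mem_POn hSμ] with x hx hx'
        show Real.exp (p * (G + 1)) ≤ ψ x
        rw [hψn x ((hlogmono hx).trans (le_max_right _ _))]
        have : G + 1 ≤ Real.log (1 + ‖x‖ ^ 2) := hx'
        gcongr
      have h4 : Real.exp (p * (G + 1)) *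
          (μ t).toMeasure.real {x | G + 1 ≤ Real.log (1 + ‖x‖ ^ 2)} ≤
          Real.exp (p * G) := by
        refine (h3.trans h1).trans ((mul_le_mul_of_nonneg_right h2 (Real.exp_pos _).le).trans ?_)
        rw [intervalIntegral.integral_const_mul, ← Real.exp_add]
        refine le_of_eq ?_
        rw [hG]; congr 1; ring
      rw [mul_add, mul_one, Real.exp_add, mul_assoc] at h4
      have h5 := le_of_mul_le_mul_left (h4.trans_eq (mul_one _).symm) (Real.exp_pos _)
      rw [← Real.exp_nat_mul, mul_neg_one, Real.exp_neg, ← one_div, le_div_iff₀ (Real.exp_pos _),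
        mul_comm]
      exact h5
    · filter_upwards [hw] with s hs
      rw [← integral_const_mul]
      refine (Real.le_norm_self _).trans (norm_integral_le_of_norm_le ((hint s).const_mul _)
        (Eventually.of_forall fun x => (hψd x _).trans ?_))
      have h1 : ‖x‖ * ‖w s x‖ / (1 + ‖x‖ ^ 2) ≤ 2 * m s := by
        rw [div_le_iff₀ (by positivity)]
        have h2 := mul_le_mul_of_nonneg_left (hs x) (norm_nonneg x)
        have h3 : ‖x‖ * (1 + ‖x‖) ≤ 2 * (1 + ‖x‖ ^ 2) := by nlinarith [sq_nonneg (‖x‖ - 1)]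
        have h4 := mul_le_mul_of_nonneg_left h3 (hm0 s)
        linarith
      have h2 := mul_le_mul_of_nonneg_left h1 (mul_nonneg (mul_nonneg hC (Nat.cast_nonneg p))
        (hψ0 x).le)
      linarith
  have hzero : (μ t).toMeasure.real {x | G + 1 ≤ Real.log (1 + ‖x‖ ^ 2)} = 0 := by
    refine le_antisymm (ge_of_tendsto' (tendsto_pow_atTop_nhds_zero_of_lt_one
      (Real.exp_pos _).le (Real.exp_lt_one_iff.2 (by norm_num))) key) measureReal_nonneg
  rw [measureReal_eq_zero_iff] at hzero
  refine mem_POn_of_ae_norm_le ?_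
  have : ∀ᵐ x ∂(μ t).toMeasure, ¬ (G + 1 ≤ Real.log (1 + ‖x‖ ^ 2)) := by
    rw [ae_iff]; simpa using hzero
  filter_upwards [this] with x hx
  rw [not_le, Real.log_lt_iff_lt_exp (by positivity)] at hx
  by_contra hcon
  rw [not_le] at hcon
  have h1 : 1 + Real.exp (G + 1) ^ 2 < Real.exp (G + 1) := by
    refine lt_of_le_of_lt ?_ hx
    have := Real.exp_pos (G + 1)
    gcongr
  nlinarith [Real.exp_pos (G + 1), sq_nonneg (Real.exp (G + 1) - 1)]

/-- If the field grows sublinearly in the position and in the first moment, the first moment is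
bounded in terms of the initial support and the integral of the rate. -/
theorem SolvesCE.exists_moment_bound (X : Type*) [NormedAddCommGroup X] [InnerProductSpace ℝ X]
    [FiniteDimensional ℝ X] [MeasurableSpace X] [BorelSpace X] :
    ∃ C : ℝ, 0 ≤ C ∧ ∀ {a b : ℝ} {m : ℝ → ℝ} {w : ℝ → X → X} {μ : ℝ → Pc X}, SolvesCE a b w μ →
      Integrable m → (∀ t, 0 ≤ m t) →
      (∀ᵐ t ∂volume.restrict (Icc a b), ∀ x,
        ‖w t x‖ ≤ m t * (1 + ‖x‖ + ∫ y, ‖y‖ ∂(μ t).toMeasure)) →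
      ∀ {R S : ℝ}, 0 ≤ R → μ a ∈ POn (Metric.closedBall 0 R) →
      (∀ t ∈ Icc a b, μ t ∈ POn (Metric.closedBall 0 S)) → ∀ t ∈ Icc a b,
      ∫ y, ‖y‖ ∂(μ t).toMeasure ≤ (1 + R) * Real.exp (C * ∫ s in a..t, m s) := by
  obtain ⟨C, hC, hpow⟩ := exists_truncated_power X
  refine ⟨2 * C, by positivity, fun {a b m w μ} h hm hm0 hw {R S} hR0 hR hS t ht => ?_⟩
  have hlogmono : ∀ {x : X} {r : ℝ}, ‖x‖ ≤ r → Real.log (1 + ‖x‖ ^ 2) ≤ Real.log (1 + r ^ 2) :=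
    fun {x r} hx => Real.log_le_log (by positivity) (by gcongr)
  -- The power 1/2 gives ψ = √(1 + |x|²) on the ball of radius S, which dominates both 1 and |x|. S
  -- only sets the truncation level and does not enter the final bound.
  obtain ⟨ψ, hψ, hψ0, hψc, hψn, hψd⟩ := hpow (1 / 2) (Real.log (1 + S ^ 2)) (by norm_num)
  have hint : ∀ s, Integrable ψ (μ s).toMeasure := fun s => by
    obtain ⟨c, hc⟩ := hψc
    have := ((hψ.continuous.sub continuous_const).integrable_of_hasCompactSupport
      (μ := (μ s).toMeasure) hc).add (integrable_const c)
    refine this.congr (Eventually.of_forall fun x => ?_)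
    simp
  have hψS : ∀ x, ‖x‖ ≤ S → ψ x ^ 2 = 1 + ‖x‖ ^ 2 := fun x hx => by
    rw [hψn x (hlogmono hx), ← Real.exp_nat_mul, ← mul_assoc]
    norm_num
    rw [Real.exp_log (by positivity)]
  have hψ1 : ∀ x, ‖x‖ ≤ S → 1 ≤ ψ x := fun x hx => by
    have := hψS x hx
    nlinarith [hψ0 x, sq_nonneg ‖x‖]
  have hψx : ∀ x, ‖x‖ ≤ S → ‖x‖ ≤ ψ x := fun x hx =>
    abs_le_of_sq_le_sq' (by rw [hψS x hx]; linarith) (hψ0 x).le |>.2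
  have hmom : ∀ s ∈ Icc a b, ∫ y, ‖y‖ ∂(μ s).toMeasure ≤ ∫ x, ψ x ∂(μ s).toMeasure :=
    fun s hs => integral_mono_ae (μ s).integrable_norm (hint s)
      ((ae_norm_le_of_mem_POn (hS s hs)).mono hψx)
  have hone : ∀ s ∈ Icc a b, 1 ≤ ∫ x, ψ x ∂(μ s).toMeasure := fun s hs => by
    have := integral_mono_ae (integrable_const (1 : ℝ)) (hint s)
      ((ae_norm_le_of_mem_POn (hS s hs)).mono hψ1)
    simpa using this
  have h1 := h.integral_le_mul_exp (m := fun t => (2 * C) * m t) (hm.const_mul _)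
    (fun t => by have := hm0 t; positivity) hψ hψc ?_ ht
  · rw [intervalIntegral.integral_const_mul] at h1
    refine ((hmom t ht).trans h1).trans ?_
    gcongr
    have hab : a ∈ Icc a b := ⟨le_rfl, ht.1.trans ht.2⟩
    refine (integral_mono_ae (hint a) (integrable_const (1 + R)) ?_).trans (by simp)
    filter_upwards [ae_norm_le_of_mem_POn hR, ae_norm_le_of_mem_POn (hS a hab)] with x hx hx'
    refine abs_le_of_sq_le_sq' ?_ (by positivity) |>.2
    rw [hψS x hx']
    nlinarith [norm_nonneg x]
  · filter_upwards [hw, ae_restrict_mem measurableSet_Icc] with s hs hmem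
    set K := ∫ y, ‖y‖ ∂(μ s).toMeasure with hK
    have hK0 : 0 ≤ K := integral_nonneg fun _ => norm_nonneg _
    have hi : Integrable (fun x => C * (1 / 2) * m s * (ψ x + ψ x + K)) (μ s).toMeasure :=
      (((hint s).add (hint s)).add (integrable_const K)).const_mul _
    refine (Real.le_norm_self _).trans ((norm_integral_le_of_norm_le hi ?_).trans ?_)
    · filter_upwards [ae_norm_le_of_mem_POn (hS s hmem)] with x hx
      refine (hψd x _).trans ?_
      have e1 := hψS x hx
      have e2 := hψ1 x hx
      have e3 := hψx x hx
      have e4 : ψ x * (‖x‖ * ‖w s x‖ / (1 + ‖x‖ ^ 2)) ≤ m s * (ψ x + ψ x + K) := by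
        rw [← e1, ← mul_div_assoc, div_le_iff₀ (by have := hψ0 x; positivity)]
        calc ψ x * (‖x‖ * ‖w s x‖) ≤ ψ x * (ψ x * (m s * (ψ x + ψ x + K))) := by
              have := hψ0 x
              have := hm0 s
              gcongr
              exact (hs x).trans (by gcongr)
          _ = _ := by ring
      have e5 := mul_le_mul_of_nonneg_left e4 (by positivity : 0 ≤ C * (1 / 2))
      linarith
    · have hI : ∫ x, (ψ x + ψ x + K) ∂(μ s).toMeasure =
          ∫ x, ψ x ∂(μ s).toMeasure + ∫ x, ψ x ∂(μ s).toMeasure + K := by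
        have e1 := integral_add ((hint s).add (hint s)) (integrable_const K)
        simp only [Pi.add_apply] at e1
        rw [e1, integral_add (hint s) (hint s)]; simp
      rw [integral_const_mul, hI]
      have e1 := hmom s hmem
      have e2 := hone s hmem
      calc C * (1 / 2) * m s * (∫ x, ψ x ∂(μ s).toMeasure + ∫ x, ψ x ∂(μ s).toMeasure + K)
          ≤ C * (1 / 2) * m s * (4 * ∫ x, ψ x ∂(μ s).toMeasure) := by
            have := hm0 s
            gcongr
            linarith
        _ = _ := by ring

end Support

/-! ### Trajectories of the control problem -/

section Trajectories

variable {d : ℕ} {U : Type*} [MetricSpace U] [CompactSpace U] [MeasurableSpace U] [BorelSpace U]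
  {T : ℝ} {v : ℝ → Pc (E d) → U → E d → E d} {φ : Pc (E d) → ℝ}

theorem Hypotheses.exists_growth_rate (hyp : Hypotheses T v φ) :
    ∃ m : ℝ → ℝ, Integrable m ∧ (∀ t, 0 ≤ m t) ∧
      ∀ᵐ t ∂volume.restrict (Icc 0 T), ∀ u μ x,
        ‖v t μ u x‖ ≤ m t * (1 + ‖x‖ + ∫ y, ‖y‖ ∂μ.toMeasure) := by
  obtain ⟨m, hm0, hm, hv⟩ := hyp.sublinear
  -- Extension by zero makes the rate integrable on the whole line.
  refine ⟨(Icc 0 T).indicator m, hm.integrable_indicator measurableSet_Icc,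
    fun t => indicator_nonneg (fun _ _ => hm0 _) t, ?_⟩
  filter_upwards [hv, ae_restrict_mem measurableSet_Icc] with t h1 h2
  simpa only [indicator_of_mem h2] using h1

/-- `P` is a truncation that is the identity on the ball of radius `S`, and `m` is a rate for the
truncated velocity `v(t, μ, u, P x)`. -/
structure IsTruncation (T : ℝ) (v : ℝ → Pc (E d) → U → E d → E d) (S : ℝ) (P : E d →ᵇ E d)
    (C : ℝ) (m : ℝ → ℝ) : Prop where
  integrable : Integrable m
  nonneg : ∀ t, 0 ≤ m t
  const_nonneg : 0 ≤ C
  eq_self : ∀ x, ‖x‖ ≤ S → P x = x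
  norm_le_norm : ∀ x, ‖P x‖ ≤ ‖x‖
  norm_le : ∀ x, ‖P x‖ ≤ 2 * S
  lipschitz : ∀ x y, ‖P x - P y‖ ≤ C * ‖x - y‖
  norm_velocity_le : ∀ᵐ t ∂volume.restrict (Icc 0 T), ∀ u,
    ∀ μ ∈ POn (Metric.closedBall (0 : E d) (2 * S)), ∀ x, ‖v t μ u (P x)‖ ≤ m t
  norm_velocity_sub_le : ∀ᵐ t ∂volume.restrict (Icc 0 T), ∀ u,
    ∀ μ ∈ POn (Metric.closedBall (0 : E d) (2 * S)),
    ∀ ν ∈ POn (Metric.closedBall (0 : E d) (2 * S)), ∀ x y,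
      ‖v t μ u (P x) - v t ν u (P y)‖ ≤ m t * (‖x - y‖ + wass 1 μ ν)

/-- P takes values in the ball of radius 2S, so the local Lipschitz rates l and L of that ball apply
everywhere. There both |P x| and the first moment are at most 2S, whence the factor 1 + 4S in front
of the growth rate. -/
theorem Hypotheses.exists_isTruncation (hyp : Hypotheses T v φ) {S : ℝ} (hS : 0 < S) :
    ∃ P C m, IsTruncation T v S P C m := by
  obtain ⟨P, C, hC, hP1, hP2, hP3, hP4⟩ := exists_truncation (E d) hS
  obtain ⟨m₀, hm₀, hm₀0, hv⟩ := hyp.exists_growth_rate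
  obtain ⟨l, L, hl0, hL0, hl, hL, hlL⟩ := hyp.lipschitz (2 * S) (by positivity)
  set l' := (Icc 0 T).indicator l
  set L' := (Icc 0 T).indicator L
  have hl'0 : ∀ t, 0 ≤ l' t := fun t => indicator_nonneg (fun _ _ => hl0 _) t
  have hL'0 : ∀ t, 0 ≤ L' t := fun t => indicator_nonneg (fun _ _ => hL0 _) t
  have hPball : ∀ x, P x ∈ Metric.closedBall (0 : E d) (2 * S) := fun x => by
    simpa using hP3 x
  refine ⟨BoundedContinuousFunction.ofNormedAddCommGroup P (continuous_of_norm_sub_le hP4) _ hP3, C,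
    fun t => (1 + 4 * S) * m₀ t + (C * l' t + L' t), ?_⟩
  refine ⟨(hm₀.const_mul _).add (((hl.integrable_indicator measurableSet_Icc).const_mul C).add
    (hL.integrable_indicator measurableSet_Icc)), fun t => ?_, hC, hP1, hP2, hP3, hP4, ?_, ?_⟩
  · have := hm₀0 t; have := hl'0 t; have := hL'0 t; positivity
  · filter_upwards [hv] with t ht u μ hμ x
    refine (ht u μ _).trans ?_
    have h1 : ∫ y, ‖y‖ ∂μ.toMeasure ≤ 2 * S := by
      refine (integral_mono_ae μ.integrable_norm (integrable_const (2 * S))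
        (ae_norm_le_of_mem_POn hμ)).trans (by simp)
    have h2 := hP3 x
    have := hm₀0 t; have := hl'0 t; have := hL'0 t
    calc m₀ t * (1 + ‖P x‖ + ∫ y, ‖y‖ ∂μ.toMeasure) ≤ m₀ t * (1 + 2 * S + 2 * S) := by gcongr
      _ ≤ (1 + 4 * S) * m₀ t + (C * l' t + L' t) := by
        have : 0 ≤ C * l' t + L' t := by positivity
        linarith
  · filter_upwards [hlL, ae_restrict_mem measurableSet_Icc] with t ht hmem u μ hμ ν hν x y
    have h1 := (ht u μ hμ ν hν (P x) (hPball x) (P y) (hPball y)).1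
    have h2 := (ht u μ hμ ν hν (P y) (hPball y) (P y) (hPball y)).2
    rw [← indicator_of_mem hmem l] at h1
    rw [← indicator_of_mem hmem L] at h2
    have e1 := hm₀0 t; have e2 := hl'0 t; have e3 := hL'0 t
    have e4 := wass_nonneg 1 μ ν
    calc ‖v t μ u (P x) - v t ν u (P y)‖
        ≤ ‖v t μ u (P x) - v t μ u (P y)‖ + ‖v t μ u (P y) - v t ν u (P y)‖ :=
          norm_sub_le_norm_sub_add_norm_sub _ _ _
      _ ≤ l' t * (C * ‖x - y‖) + L' t * wass 1 μ ν := by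
          refine add_le_add (h1.trans ?_) h2
          exact mul_le_mul_of_nonneg_left (hP4 x y) e2
      _ ≤ ((1 + 4 * S) * m₀ t + (C * l' t + L' t)) * (‖x - y‖ + wass 1 μ ν) := by
          have f1 : 0 ≤ (1 + 4 * S) * m₀ t := by positivity
          have f2 := norm_nonneg (x - y)
          have f3 : 0 ≤ C * l' t := by positivity
          nlinarith [mul_nonneg f1 f2, mul_nonneg f1 e4, mul_nonneg f3 e4, mul_nonneg e3 f2]

variable {S C : ℝ} {P : E d →ᵇ E d} {m : ℝ → ℝ} {a b : ℝ}

/-- Along a `W₁`-continuous curve in a fixed ball, the truncated velocity is a Lipschitz field. -/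
theorem IsTruncation.isLipschitzField (hP : IsTruncation T v S P C m) (hyp : Hypotheses T v φ)
    (hab : a ≤ b) (hsub : Icc a b ⊆ Icc 0 T) {μ : ℝ → Pc (E d)}
    (hμ : ∀ t ∈ Icc a b, μ t ∈ POn (Metric.closedBall (0 : E d) (2 * S)))
    (hμc : ∀ t ∈ Icc a b, Tendsto (fun s => wass 1 (μ s) (μ t)) (𝓝[Icc a b] t) (𝓝 0))
    {u : ℝ → U} (hu : u ∈ controls U T) :
    IsLipschitzField a b m (fun t x => v t (μ t) (u t) (P x)) := by
  refine ⟨fun x => ?_, ?_, ?_⟩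
  · have hu' : AEMeasurable u (volume.restrict (Icc a b)) :=
      AEMeasurable.mono_measure hu (Measure.restrict_mono hsub le_rfl)
    -- The time at which the curve is evaluated is decoupled from the explicit time. With (r, u) in
    -- [a, b] × U as parameter, v(s, μ(r), u, P x) is a Carathéodory function, into which (s, u(s))
    -- is substituted.
    have key := aestronglyMeasurable_comp_caratheodory (lam := volume.restrict (Icc a b))
      (P := Icc a b × U) (g := fun s p => v s (μ p.1) p.2 (P x))
      (x := fun s => (projIcc a b hab s, u s)) ?_ (fun p =>
        (hyp.measurable_time _ _ _).mono_measure (Measure.restrict_mono hsub le_rfl))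
      (continuous_projIcc.aemeasurable.prodMk hu')
    · refine key.congr ?_
      filter_upwards [ae_restrict_mem measurableSet_Icc] with s hs
      simp only [projIcc_of_mem hab hs]
    · filter_upwards [ae_restrict_of_ae_restrict_of_subset hsub hP.norm_velocity_sub_le,
        ae_restrict_of_ae_restrict_of_subset hsub hyp.continuous_control] with s h1 h2
      rw [continuous_iff_continuousAt]
      intro p
      rw [ContinuousAt, tendsto_iff_norm_sub_tendsto_zero]
      have t1 : Tendsto (fun q : Icc a b × U => m s * wass 1 (μ q.1) (μ p.1)) (𝓝 p) (𝓝 0) := by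
        have := hμc p.1 p.1.2
        rw [← map_nhds_subtype_val p.1, tendsto_map'_iff] at this
        have h3 := (this.comp (continuous_fst.tendsto p)).const_mul (m s)
        simpa using h3
      have t2 : Tendsto (fun q : Icc a b × U =>
          ‖v s (μ p.1) q.2 (P x) - v s (μ p.1) p.2 (P x)‖) (𝓝 p) (𝓝 0) := by
        have : Continuous fun q : Icc a b × U =>
            ‖v s (μ p.1) q.2 (P x) - v s (μ p.1) p.2 (P x)‖ :=
          (((h2 (μ p.1) (P x)).comp continuous_snd).sub continuous_const).norm
        simpa using this.tendsto p
      refine squeeze_zero (fun _ => norm_nonneg _) (fun q => ?_) (by simpa using t1.add t2)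
      refine (norm_sub_le_norm_sub_add_norm_sub _ (v s (μ p.1) q.2 (P x)) _).trans ?_
      refine add_le_add ?_ le_rfl
      simpa using h1 q.2 _ (hμ q.1 q.1.2) _ (hμ p.1 p.1.2) x x
  · filter_upwards [ae_restrict_of_ae_restrict_of_subset hsub hP.norm_velocity_le,
      ae_restrict_mem measurableSet_Icc] with t h1 h2 x
    exact h1 _ _ (hμ t h2) x
  · filter_upwards [ae_restrict_of_ae_restrict_of_subset hsub hP.norm_velocity_sub_le,
      ae_restrict_mem measurableSet_Icc] with t h1 h2 x y
    have h3 := h1 (u t) _ (hμ t h2) _ (hμ t h2) x y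
    have h4 : wass 1 (μ t) (μ t) ≤ 0 := by
      refine (wass_le_integral (P := (μ t).toMeasure) (f := id) (g := id) aemeasurable_id
        aemeasurable_id (by simp) (by simp) (by simp)).trans (by simp)
    have h5 := hP.nonneg t
    refine h3.trans ?_
    gcongr
    linarith

theorem Pc.map_eq_of_ae {X Y : Type*} [TopologicalSpace X] [HereditarilyLindelofSpace X]
    [MeasurableSpace X] [OpensMeasurableSpace X] [TopologicalSpace Y] [T2Space Y]
    [MeasurableSpace Y] [BorelSpace Y] {μ : Pc X} {f g : X → Y} {hf : Continuous f}
    {hg : Continuous g} (h : ∀ᵐ x ∂μ.toMeasure, f x = g x) : μ.map f hf = μ.map g hg := by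
  have : (μ.map f hf).toMeasure = (μ.map g hg).toMeasure := Measure.map_congr h
  revert this
  generalize μ.map f hf = ρ
  generalize μ.map g hg = σ
  intro h
  cases ρ; cases σ; cases h; rfl

theorem Pc.map_eq_self {X : Type*} [TopologicalSpace X] [HereditarilyLindelofSpace X] [T2Space X]
    [MeasurableSpace X] [BorelSpace X] {μ : Pc X} {f : X → X} {hf : Continuous f}
    (h : ∀ᵐ x ∂μ.toMeasure, f x = x) : μ.map f hf = μ := by
  have : (μ.map f hf).toMeasure = μ.toMeasure := by
    rw [show (μ.map f hf).toMeasure = μ.toMeasure.map f from rfl,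
      Measure.map_congr (g := id) h, Measure.map_id]
  revert this
  generalize μ.map f hf = ρ
  intro h
  cases ρ; cases μ; cases h; rfl

theorem Pc.integral_map {μ : Pc (E d)} {f : E d → E d} {hf : Continuous f} {F : Type*}
    [NormedAddCommGroup F] [NormedSpace ℝ F] {g : E d → F} (hg : Continuous g) :
    ∫ y, g y ∂(μ.map f hf).toMeasure = ∫ x, g (f x) ∂μ.toMeasure :=
  MeasureTheory.integral_map hf.measurable.aemeasurable hg.aestronglyMeasurable

theorem Pc.map_mem_POn {μ : Pc (E d)} {f : E d → E d} {hf : Continuous f} {R : ℝ}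
    (h : ∀ᵐ x ∂μ.toMeasure, ‖f x‖ ≤ R) : μ.map f hf ∈ POn (Metric.closedBall (0 : E d) R) := by
  refine mem_POn_of_ae_norm_le ?_
  exact (ae_map_iff hf.measurable.aemeasurable
    (measurableSet_le measurable_norm measurable_const)).2 h

theorem wass_map_le {μ : Pc (E d)} {f g : E d → E d} {hf : Continuous f} {hg : Continuous g}
    {K : ℝ} (h : ∀ x, ‖f x - g x‖ ≤ K) : wass 1 (μ.map f hf) (μ.map g hg) ≤ K := by
  have hi : Integrable (fun x => ‖f x - g x‖) μ.toMeasure :=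
    Integrable.of_bound (by fun_prop) K (Eventually.of_forall fun x => by simpa using h x)
  refine (wass_le_integral hf.measurable.aemeasurable hg.measurable.aemeasurable rfl rfl hi).trans ?_
  exact (integral_mono hi (integrable_const K) h).trans (by simp)

/-- Every control drives a trajectory from every initial measure. -/
theorem Hypotheses.exists_isTrajectory (hyp : Hypotheses T v φ) (ha : a ∈ Icc 0 T)
    (ρ : Pc (E d)) {u : ℝ → U} (hu : u ∈ controls U T) : ∃ μ, IsTrajectory T v a ρ μ u := by
  obtain ⟨R₀, hR₀, hρ⟩ := ρ.exists_mem_POn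
  obtain ⟨P₀, C₀, k₀, hP₀⟩ := hyp.exists_isTruncation hR₀
  obtain ⟨m₀, hm₀, hm₀0, hgrowth⟩ := hyp.exists_growth_rate
  -- An a priori bound: with data bounded by 2R₀, the quantity 1 + 2‖Y‖ starts at most at 1 + 4R₀
  -- and grows at the rate 2m₀.
  set S : ℝ := (1 + 4 * R₀) * Real.exp (∫ s in 0..T, 2 * m₀ s)
  have hS : 0 < S := by positivity
  obtain ⟨P, C, m, hP⟩ := hyp.exists_isTruncation hS
  have hsub : Icc a T ⊆ Icc 0 T := Icc_subset_Icc_left ha.1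
  have hcurve : ∀ Y : ℝ → (E d →ᵇ E d), Continuous Y → ∀ t ∈ Icc a T, Tendsto (fun s => wass 1
      (ρ.map (fun x => P (Y s x)) (P.continuous.comp (Y s).continuous))
      (ρ.map (fun x => P (Y t x)) (P.continuous.comp (Y t).continuous))) (𝓝[Icc a T] t) (𝓝 0) := by
    intro Y hY t _
    have h1 : Tendsto (fun s => C * ‖Y s - Y t‖) (𝓝[Icc a T] t) (𝓝 0) := by
      have : Continuous fun s => C * ‖Y s - Y t‖ := by fun_prop
      simpa using (this.tendsto t).mono_left nhdsWithin_le_nhds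
    refine squeeze_zero (fun _ => wass_nonneg _ _ _) (fun s => wass_map_le fun x => ?_) h1
    exact (hP.lipschitz _ _).trans (mul_le_mul_of_nonneg_left
      ((Y s - Y t).norm_coe_le_norm x) hP.const_nonneg)
  have hball : ∀ Y : E d →ᵇ E d, ρ.map (fun x => P (Y x)) (P.continuous.comp Y.continuous) ∈
      POn (Metric.closedBall (0 : E d) (2 * S)) := fun Y =>
    Pc.map_mem_POn (Eventually.of_forall fun x => hP.norm_le _)
  have hfield : ∀ Y : ℝ → (E d →ᵇ E d), Continuous Y → IsLipschitzField a T m (fun t x => v t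
      (ρ.map (fun x => P (Y t x)) (P.continuous.comp (Y t).continuous)) (u t) (P x)) :=
    fun Y hY => hP.isLipschitzField hyp ha.2 hsub (fun t _ => hball (Y t)) (hcurve Y hY) hu
  -- The nonlocal characteristic system. The truncation P₀ replaces the identity as initial datum
  -- because the Picard space consists of bounded maps; on the support of ρ they agree.
  obtain ⟨Y, hYc, hY⟩ : ∃ Y : ℝ → (E d →ᵇ E d), Continuous Y ∧ ∀ t ∈ Icc a T, ∀ x, Y t x = P₀ x +
      ∫ s in a..t, v s (ρ.map (fun x => P (Y s x)) (P.continuous.comp (Y s).continuous)) (u s)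
        (P (Y s x)) := by
    refine exists_integral_curve (a := a) (b := T) ha.2
      (m := fun t => (1 + C) * m t) (hP.integrable.const_mul _)
      (fun t => mul_nonneg (by have := hP.const_nonneg; positivity) (hP.nonneg t)) P₀
      (G := fun s Y z => v s (ρ.map (fun x => P (Y x)) (P.continuous.comp Y.continuous)) (u s) (P z))
      ?_ ?_ ?_
    · filter_upwards [ae_restrict_of_ae_restrict_of_subset hsub hP.norm_velocity_le] with s hs Y z
      refine (hs _ _ (hball Y) z).trans ?_
      have := mul_nonneg hP.const_nonneg (hP.nonneg s)
      linarith
    · filter_upwards [ae_restrict_of_ae_restrict_of_subset hsub hP.norm_velocity_sub_le]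
        with s hs Y Y' z z'
      refine (hs _ _ (hball Y) _ (hball Y') z z').trans ?_
      have hw : wass 1 (ρ.map (fun x => P (Y x)) (P.continuous.comp Y.continuous))
          (ρ.map (fun x => P (Y' x)) (P.continuous.comp Y'.continuous)) ≤ C * ‖Y - Y'‖ :=
        wass_map_le fun x => (hP.lipschitz _ _).trans (mul_le_mul_of_nonneg_left
          ((Y - Y').norm_coe_le_norm x) hP.const_nonneg)
      have e1 := hP.nonneg s
      have e2 := hP.const_nonneg
      have e3 : ‖z - z'‖ + C * ‖Y - Y'‖ ≤ (1 + C) * (‖Y - Y'‖ + ‖z - z'‖) := by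
        have := norm_nonneg (Y - Y')
        have := mul_nonneg e2 (norm_nonneg (z - z'))
        linarith
      calc _ ≤ m s * (‖z - z'‖ + C * ‖Y - Y'‖) := by gcongr
        _ ≤ m s * ((1 + C) * (‖Y - Y'‖ + ‖z - z'‖)) := by gcongr
        _ = _ := by ring
    · intro Y hY x
      have hw := hfield Y hY
      exact aestronglyMeasurable_comp_caratheodory hw.ae_continuous hw.aestronglyMeasurable
        (x := fun s => Y s x) ((continuous_eval_const x).comp hY).aemeasurable
  have hw := hfield Y hYc
  set w : ℝ → E d → E d := fun t x => v t
      (ρ.map (fun x => P (Y t x)) (P.continuous.comp (Y t).continuous)) (u t) (P x) with hwdef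
  have hYa : Y a = P₀ := by
    ext1 x
    simpa using hY a ⟨le_rfl, ha.2⟩ x
  have hflow : IsFlow a T w Y := ⟨hYc, fun t ht x => by rw [hYa]; exact hY t ht x⟩
  -- Grönwall with the growth bound. The position and the first moment are each at most ‖Y‖, since P
  -- does not increase norms. Hence the flow never leaves the region where P is the identity.
  have hnorm : ∀ t ∈ Icc a T, ‖Y t‖ ≤ S := by
    intro t ht
    have hc : Continuous fun s => 1 + 2 * ‖Y s‖ := by fun_prop
    have hgr := gronwall_of_le_integral (m := fun s => 2 * m₀ s) (g := fun s => 1 + 2 * ‖Y s‖)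
      (c := 1 + 4 * R₀) (hm₀.const_mul 2) (fun s => mul_nonneg zero_le_two (hm₀0 s)) ht.1
      hc.continuousOn ?_
    · have h1 : ∫ s in a..t, 2 * m₀ s ≤ ∫ s in 0..T, 2 * m₀ s := by
        have hI := hm₀.const_mul 2
        refine intervalIntegral.integral_mono_interval ha.1 ht.1 ht.2
          (Eventually.of_forall fun s => mul_nonneg zero_le_two (hm₀0 s)) hI.intervalIntegrable
      have h2 : (1 + 4 * R₀) * Real.exp (∫ s in a..t, 2 * m₀ s) ≤ S := by
        simp only [S]; gcongr
      linarith [norm_nonneg (Y t)]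
    · intro s hs
      have hs' : s ∈ Icc a T := ⟨hs.1, hs.2.trans ht.2⟩
      have hI : IntervalIntegrable (fun r => m₀ r * (1 + 2 * ‖Y r‖)) volume a s :=
        hm₀.intervalIntegrable.mul_continuousOn hc.continuousOn
      have hle : ‖Y s‖ ≤ 2 * R₀ + ∫ r in a..s, m₀ r * (1 + 2 * ‖Y r‖) := by
        have h0 : 0 ≤ ∫ r in a..s, m₀ r * (1 + 2 * ‖Y r‖) :=
          intervalIntegral.integral_nonneg hs.1 fun r _ => mul_nonneg (hm₀0 r) (by positivity)
        rw [BoundedContinuousFunction.norm_le (by positivity)]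
        intro x
        rw [hflow.2 s hs' x, hYa]
        refine (norm_add_le _ _).trans (add_le_add (hP₀.norm_le x) ?_)
        refine intervalIntegral.norm_integral_le_of_norm_le hs.1 ?_ hI
        have := (ae_restrict_iff' measurableSet_Icc).1 hgrowth
        filter_upwards [this] with r hr hr'
        refine (hr (hsub ⟨hr'.1.le, hr'.2.trans hs'.2⟩) _ _ _).trans ?_
        have f1 : ‖P (Y r x)‖ ≤ ‖Y r‖ :=
          (hP.norm_le_norm _).trans ((Y r).norm_coe_le_norm x)
        have f2 : ∫ y, ‖y‖ ∂(ρ.map (fun x => P (Y r x))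
            (P.continuous.comp (Y r).continuous)).toMeasure ≤ ‖Y r‖ := by
          rw [Pc.integral_map continuous_norm]
          have : ∀ x, ‖P (Y r x)‖ ≤ ‖Y r‖ := fun x =>
            (hP.norm_le_norm _).trans ((Y r).norm_coe_le_norm x)
          refine (integral_mono (Integrable.of_bound (by fun_prop) ‖Y r‖
            (Eventually.of_forall fun x => by simpa using this x)) (integrable_const _) this).trans
            (by simp)
        have := hm₀0 r
        exact mul_le_mul_of_nonneg_left (by linarith) this
      have h3 : ∫ r in a..s, 2 * m₀ r * (1 + 2 * ‖Y r‖) =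
          2 * ∫ r in a..s, m₀ r * (1 + 2 * ‖Y r‖) := by
        rw [← intervalIntegral.integral_const_mul]
        simp only [mul_assoc]
      rw [h3]
      linarith
  have hPY : ∀ t ∈ Icc a T, ρ.map (fun x => P (Y t x)) (P.continuous.comp (Y t).continuous) =
      ρ.map (Y t) (Y t).continuous := fun t ht => Pc.map_eq_of_ae (Eventually.of_forall fun x =>
    hP.eq_self _ (((Y t).norm_coe_le_norm x).trans (hnorm t ht)))
  refine ⟨fun t => ρ.map (Y t) (Y t).continuous, ?_, ?_⟩
  · refine (hflow.solvesCE hP.integrable hw ρ).congr_field ?_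
    filter_upwards [ae_restrict_mem measurableSet_Icc] with t ht
    have : ρ.map (Y t) (Y t).continuous ∈ POn (Metric.closedBall (0 : E d) S) :=
      Pc.map_mem_POn (Eventually.of_forall fun x =>
        ((Y t).norm_coe_le_norm x).trans (hnorm t ht))
    filter_upwards [ae_norm_le_of_mem_POn this] with x hx
    simp only [hwdef]
    rw [hP.eq_self x hx, hPY t ht]
  · simp only [hYa]
    refine Pc.map_eq_self ?_
    filter_upwards [ae_norm_le_of_mem_POn hρ] with x hx using hP₀.eq_self x hx

end Trajectories

/-! ### Regularity of the value function -/

section Value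

variable {d : ℕ} {U : Type*} [MetricSpace U] [CompactSpace U] [MeasurableSpace U] [BorelSpace U]
  {T : ℝ} {v : ℝ → Pc (E d) → U → E d → E d} {φ : Pc (E d) → ℝ}

theorem IsTrajectory.mono {a b : ℝ} {ρ : Pc (E d)} {μ : ℝ → Pc (E d)} {u : ℝ → U}
    (h : IsTrajectory T v a ρ μ u) (hab : a ≤ b) : IsTrajectory T v b (μ b) μ u :=
  ⟨h.1.mono (Icc_subset_Icc_left hab), rfl⟩

/-- Trajectories issued from a ball stay in a common ball. -/
theorem Hypotheses.exists_uniform_support (hyp : Hypotheses T v φ) {R : ℝ} (hR : 0 < R) :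
    ∃ S, R ≤ S ∧ ∀ a ∈ Icc 0 T, ∀ ρ ∈ POn (Metric.closedBall (0 : E d) R), ∀ μ (u : ℝ → U),
      IsTrajectory T v a ρ μ u → ∀ t ∈ Icc a T, μ t ∈ POn (Metric.closedBall (0 : E d) S) := by
  obtain ⟨m, hm, hm0, hv⟩ := hyp.exists_growth_rate
  obtain ⟨C₁, hC₁, hsupp⟩ := SolvesCE.exists_support_bound (E d)
  obtain ⟨C₂, hC₂, hmom⟩ := SolvesCE.exists_moment_bound (E d)
  set K : ℝ := (1 + R) * Real.exp (C₂ * ∫ s in 0..T, m s)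
  have hK : 0 ≤ K := by positivity
  have hmono : ∀ a ∈ Icc 0 T, ∀ t ∈ Icc a T, ∫ s in a..t, m s ≤ ∫ s in 0..T, m s :=
    fun a ha t ht => intervalIntegral.integral_mono_interval ha.1 ht.1 ht.2
      (Eventually.of_forall hm0) hm.intervalIntegrable
  set S : ℝ := max R
    (Real.exp (Real.log (1 + R ^ 2) + C₁ * ((1 + K) * ∫ s in 0..T, m s) + 1))
  have key : ∀ a ∈ Icc 0 T, ∀ μ (u : ℝ → U), SolvesCE a T (fun t => v t (μ t) (u t)) μ →
      μ a ∈ POn (Metric.closedBall (0 : E d) R) → ∀ L, 0 ≤ L →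
      (∀ t ∈ Icc a T, ∫ y, ‖y‖ ∂(μ t).toMeasure ≤ L) → ∀ t ∈ Icc a T,
      μ t ∈ POn (Metric.closedBall (0 : E d)
        (Real.exp (Real.log (1 + R ^ 2) + C₁ * ((1 + L) * ∫ s in 0..T, m s) + 1))) := by
    intro a ha μ u h hρ L hL hμL t ht
    have h1 := hsupp h (m := fun t => (1 + L) * m t) (hm.const_mul _)
      (fun t => mul_nonneg (by positivity) (hm0 t)) ?_ hρ t ht
    · refine POn_mono ?_ h1
      rw [intervalIntegral.integral_const_mul]
      have := hmono a ha t ht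
      gcongr
    · filter_upwards [ae_restrict_of_ae_restrict_of_subset (Icc_subset_Icc_left ha.1) hv,
        ae_restrict_mem measurableSet_Icc] with s hs hs' x
      refine (hs _ _ _).trans ?_
      have h2 := hμL s hs'
      have h3 : 1 + ‖x‖ + ∫ y, ‖y‖ ∂(μ s).toMeasure ≤ (1 + L) * (1 + ‖x‖) := by
        nlinarith [norm_nonneg x, mul_nonneg hL (norm_nonneg x)]
      calc _ ≤ m s * ((1 + L) * (1 + ‖x‖)) := mul_le_mul_of_nonneg_left h3 (hm0 s)
        _ = _ := by ring
  refine ⟨S, le_max_left _ _, fun a ha ρ hρ μ u h t ht => ?_⟩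
  obtain ⟨hCE, rfl⟩ := h
  have hcont : ContinuousOn (fun t => ∫ y, ‖y‖ ∂(μ t).toMeasure) (Icc a T) := by
    intro t ht
    rw [ContinuousWithinAt, tendsto_iff_norm_sub_tendsto_zero]
    refine squeeze_zero (fun _ => norm_nonneg _) (fun s => ?_) (hCE.1 t ht)
    have := abs_integral_sub_le_wass (f := fun y : E d => ‖y‖) zero_le_one (fun x y => by
      simpa using abs_norm_sub_norm_le x y) (μ s) (μ t)
    simpa using this
  -- A bootstrap. W₁-continuity gives some moment bound L, which depends on the trajectory, and this
  -- gives some support bound. The moment estimate then yields the uniform bound K, and the support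
  -- estimate is applied again with K.
  obtain ⟨L, hL⟩ := isCompact_Icc.exists_bound_of_continuousOn hcont
  have hbound := hmom hCE hm hm0 (ae_restrict_of_ae_restrict_of_subset
    (Icc_subset_Icc_left ha.1) (hv.mono fun t h x => h _ _ _)) hR.le hρ
    (key a ha μ u hCE hρ (max L 0) (le_max_right _ _) fun t ht =>
      (le_abs_self _).trans ((hL t ht).trans (le_max_left _ _)))
  refine POn_mono (le_max_right _ _) (key a ha μ u hCE hρ K hK (fun t ht => ?_) t ht)
  refine (hbound t ht).trans ?_
  have := hmono a ha t ht
  simp only [K]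
  gcongr

variable {S C : ℝ} {P : E d →ᵇ E d} {m : ℝ → ℝ} {a : ℝ}

/-- A trajectory is transported by the flow of the truncated velocity. -/
theorem IsTrajectory.exists_flow {ρ : Pc (E d)} {μ : ℝ → Pc (E d)} {u : ℝ → U}
    (h : IsTrajectory T v a ρ μ u) (hyp : Hypotheses T v φ) (hP : IsTruncation T v S P C m)
    (ha : a ∈ Icc 0 T) (hu : u ∈ controls U T)
    (hμ : ∀ t ∈ Icc a T, μ t ∈ POn (Metric.closedBall (0 : E d) S)) :
    IsLipschitzField a T m (fun t x => v t (μ t) (u t) (P x)) ∧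
    ∃ Y : ℝ → (E d →ᵇ E d), IsFlow a T (fun t x => v t (μ t) (u t) (P x)) Y ∧ Y a = P ∧
      ∀ t ∈ Icc a T, μ t = ρ.map (Y t) (Y t).continuous := by
  have hS : S ≤ 2 * S := by
    have := (norm_nonneg _).trans (hP.norm_le 0)
    linarith
  have hw := hP.isLipschitzField hyp ha.2 (Icc_subset_Icc_left ha.1)
    (fun t ht => POn_mono hS (hμ t ht)) h.1.1 hu
  obtain ⟨Y, hY, hYa⟩ := hw.exists_flow ha.2 hP.integrable hP.nonneg P
  refine ⟨hw, Y, hY, hYa, fun t ht => ?_⟩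
  -- With the measure argument frozen along μ, the trajectory and the push-forward solve the same
  -- linear equation, and uniqueness identifies them.
  refine (h.1.congr_field ?_).eq_of_eq_left (hY.solvesCE hP.integrable hw ρ) hP.integrable
    hP.nonneg hw ?_ ht
  · filter_upwards [ae_restrict_mem measurableSet_Icc] with t ht
    filter_upwards [ae_norm_le_of_mem_POn (hμ t ht)] with x hx
    rw [hP.eq_self x hx]
  · have hρ := hμ a ⟨le_rfl, ha.2⟩
    rw [h.2] at hρ ⊢
    refine (Pc.map_eq_self ?_).symm
    filter_upwards [ae_norm_le_of_mem_POn hρ] with x hx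
    rw [hYa, hP.eq_self x hx]

theorem plans_map_fst {X : Type*} [MeasurableSpace X] {μ ν : Measure X} {γ : Measure (X × X)}
    (hγ : γ ∈ plans μ ν) {f : X → X} (hf : Measurable f) : γ.map (fun z => f z.1) = μ.map f := by
  rw [← hγ.2.1, Measure.map_map hf measurable_fst]; rfl

theorem plans_map_snd {X : Type*} [MeasurableSpace X] {μ ν : Measure X} {γ : Measure (X × X)}
    (hγ : γ ∈ plans μ ν) {f : X → X} (hf : Measurable f) : γ.map (fun z => f z.2) = ν.map f := by
  rw [← hγ.2.2, Measure.map_map hf measurable_snd]; rfl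

/-- Stability of the trajectories driven by a given control. -/
theorem IsTruncation.wass_le (hP : IsTruncation T v S P C m) (hyp : Hypotheses T v φ)
    (ha : a ∈ Icc 0 T) {u : ℝ → U} (hu : u ∈ controls U T) {ρ₁ ρ₂ : Pc (E d)}
    {μ₁ μ₂ : ℝ → Pc (E d)} (h₁ : IsTrajectory T v a ρ₁ μ₁ u) (h₂ : IsTrajectory T v a ρ₂ μ₂ u)
    (hμ₁ : ∀ t ∈ Icc a T, μ₁ t ∈ POn (Metric.closedBall (0 : E d) S))
    (hμ₂ : ∀ t ∈ Icc a T, μ₂ t ∈ POn (Metric.closedBall (0 : E d) S)) :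
    wass 1 (μ₁ T) (μ₂ T) ≤ Real.exp (∫ s in 0..T, m s) * C *
      Real.exp (Real.exp (∫ s in 0..T, m s) * ∫ s in 0..T, m s) * wass 1 ρ₁ ρ₂ := by
  obtain ⟨hw₁, Y₁, hY₁, hY₁a, hYμ₁⟩ := h₁.exists_flow hyp hP ha hu hμ₁
  obtain ⟨hw₂, Y₂, hY₂, hY₂a, hYμ₂⟩ := h₂.exists_flow hyp hP ha hu hμ₂
  have hS : S ≤ 2 * S := by
    have := (norm_nonneg _).trans (hP.norm_le 0)
    linarith
  set M := ∫ s in 0..T, m s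
  have hC := hP.const_nonneg
  have hmono : ∀ t ∈ Icc a T, ∫ s in a..t, m s ≤ M :=
    fun t ht => intervalIntegral.integral_mono_interval ha.1 ht.1 ht.2
      (Eventually.of_forall hP.nonneg) hP.integrable.intervalIntegrable
  suffices H : ∀ ε > 0, wass 1 (μ₁ T) (μ₂ T) ≤
      Real.exp M * C * Real.exp (Real.exp M * M) * (wass 1 ρ₁ ρ₂ + ε) by
    set A := Real.exp M * C * Real.exp (Real.exp M * M)
    have hlim : Tendsto (fun ε => A * (wass 1 ρ₁ ρ₂ + ε)) (𝓝[>] 0) (𝓝 (A * wass 1 ρ₁ ρ₂)) := by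
      have : Continuous fun ε => A * (wass 1 ρ₁ ρ₂ + ε) := by fun_prop
      simpa using (this.tendsto 0).mono_left nhdsWithin_le_nhds
    refine ge_of_tendsto hlim ?_
    filter_upwards [self_mem_nhdsWithin] with ε hε using H ε hε
  intro ε hε
  obtain ⟨γ, hγ, hγi, hγε⟩ := exists_plan_integral_le ρ₁ ρ₂ hε
  have := hγ.1
  set D : ℝ → ℝ := fun t => ∫ z, ‖Y₁ t z.1 - Y₂ t z.2‖ ∂γ with hD
  have hDi : ∀ t, Integrable (fun z : E d × E d => ‖Y₁ t z.1 - Y₂ t z.2‖) γ := fun t => by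
    have h1 := (Y₁ t).continuous
    have h2 := (Y₂ t).continuous
    refine Integrable.of_bound (Continuous.aestronglyMeasurable (by fun_prop))
      (‖Y₁ t‖ + ‖Y₂ t‖) (Eventually.of_forall fun z => ?_)
    rw [norm_norm]
    exact (norm_sub_le _ _).trans
      (add_le_add ((Y₁ t).norm_coe_le_norm _) ((Y₂ t).norm_coe_le_norm _))
  have hDc : Continuous D := by
    refine continuous_iff_continuousAt.2 fun t => ?_
    rw [ContinuousAt, tendsto_iff_norm_sub_tendsto_zero]
    have hlim : Tendsto (fun s => ‖Y₁ s - Y₁ t‖ + ‖Y₂ s - Y₂ t‖) (𝓝 t) (𝓝 0) := by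
      have : Continuous fun s => ‖Y₁ s - Y₁ t‖ + ‖Y₂ s - Y₂ t‖ := by
        have := hY₁.1; have := hY₂.1; fun_prop
      simpa using this.tendsto t
    refine squeeze_zero (fun _ => norm_nonneg _) (fun s => ?_) hlim
    rw [← integral_sub (hDi s) (hDi t)]
    refine (norm_integral_le_of_norm_le_const (C := ‖Y₁ s - Y₁ t‖ + ‖Y₂ s - Y₂ t‖)
      (Eventually.of_forall fun z => ?_)).trans (by simp)
    refine (abs_norm_sub_norm_le _ _).trans ?_
    rw [show Y₁ s z.1 - Y₂ s z.2 - (Y₁ t z.1 - Y₂ t z.2) =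
      (Y₁ s - Y₁ t) z.1 - (Y₂ s - Y₂ t) z.2 by simp; abel]
    exact (norm_sub_le _ _).trans
      (add_le_add ((Y₁ s - Y₁ t).norm_coe_le_norm _) ((Y₂ s - Y₂ t).norm_coe_le_norm _))
  have hwass : ∀ t ∈ Icc a T, wass 1 (μ₁ t) (μ₂ t) ≤ D t := fun t ht => by
    rw [hYμ₁ t ht, hYμ₂ t ht]
    exact wass_le_integral ((Y₁ t).continuous.measurable.comp measurable_fst).aemeasurable
      ((Y₂ t).continuous.measurable.comp measurable_snd).aemeasurable
      (plans_map_fst hγ (Y₁ t).continuous.measurable)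
      (plans_map_snd hγ (Y₂ t).continuous.measurable) (hDi t)
  have hD0 : ∀ t, 0 ≤ D t := fun t => integral_nonneg fun _ => norm_nonneg _
  have hmD : ∀ s t, IntervalIntegrable (fun r => m r * D r) volume s t := fun s t =>
    hP.integrable.intervalIntegrable.mul_continuousOn hDc.continuousOn
  -- First Grönwall argument, for a fixed pair of starting points. The measure arguments contribute
  -- m·D, as D bounds the W₁-distance of the trajectories.
  have hpoint : ∀ t ∈ Icc a T, ∀ x y, ‖Y₁ t x - Y₂ t y‖ ≤
      (C * ‖x - y‖ + ∫ s in a..t, m s * D s) * Real.exp M := by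
    intro t ht x y
    have hc : Continuous fun s => ‖Y₁ s x - Y₂ s y‖ :=
      ((hY₁.continuous_apply x).sub (hY₂.continuous_apply y)).norm
    have hI : 0 ≤ ∫ s in a..t, m s * D s :=
      intervalIntegral.integral_nonneg ht.1 fun r _ => mul_nonneg (hP.nonneg r) (hD0 r)
    refine (gronwall_of_le_integral (c := C * ‖x - y‖ + ∫ s in a..t, m s * D s) hP.integrable
      hP.nonneg ht.1 hc.continuousOn fun s hs => ?_).trans
      (mul_le_mul_of_nonneg_left (Real.exp_le_exp.2 (hmono t ht)) (by positivity))
    have hs' : s ∈ Icc a T := ⟨hs.1, hs.2.trans ht.2⟩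
    have haa : a ∈ Icc a T := ⟨le_rfl, ha.2⟩
    have i1 := IntegrableOn.intervalIntegrable_of_Icc (hY₁.integrableOn hP.integrable hw₁ x) haa hs'
    have i2 := IntegrableOn.intervalIntegrable_of_Icc (hY₂.integrableOn hP.integrable hw₂ y) haa hs'
    have i3 : IntervalIntegrable (fun r => m r * ‖Y₁ r x - Y₂ r y‖) volume a s :=
      hP.integrable.intervalIntegrable.mul_continuousOn hc.continuousOn
    have e1 : ∫ r in a..s, m r * D r ≤ ∫ r in a..t, m r * D r :=
      intervalIntegral.integral_mono_interval le_rfl hs.1 hs.2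
        (Eventually.of_forall fun r => mul_nonneg (hP.nonneg r) (hD0 r)) (hmD a t)
    rw [hY₁.2 s hs' x, hY₂.2 s hs' y, hY₁a, hY₂a, add_sub_add_comm,
      ← intervalIntegral.integral_sub i1 i2]
    have e2 : ‖∫ r in a..s, (v r (μ₁ r) (u r) (P (Y₁ r x)) - v r (μ₂ r) (u r) (P (Y₂ r y)))‖ ≤
        ∫ r in a..s, (m r * D r + m r * ‖Y₁ r x - Y₂ r y‖) := by
      refine intervalIntegral.norm_integral_le_of_norm_le hs.1 ?_ ((hmD a s).add i3)
      filter_upwards [(ae_restrict_iff' measurableSet_Icc).1 hP.norm_velocity_sub_le] with r hr hr'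
      have hr1 : r ∈ Icc a T := ⟨hr'.1.le, hr'.2.trans hs'.2⟩
      refine (hr (Icc_subset_Icc_left ha.1 hr1) _ _ (POn_mono hS (hμ₁ r hr1)) _
        (POn_mono hS (hμ₂ r hr1)) _ _).trans ?_
      rw [← mul_add, add_comm]
      exact mul_le_mul_of_nonneg_left (by linarith [hwass r hr1]) (hP.nonneg r)
    rw [intervalIntegral.integral_add (hmD a s) i3] at e2
    linarith [norm_add_le (P x - P y)
      (∫ r in a..s, (v r (μ₁ r) (u r) (P (Y₁ r x)) - v r (μ₂ r) (u r) (P (Y₂ r y)))),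
      hP.lipschitz x y]
  -- Integrating over the plan closes the inequality for D. The second Grönwall argument produces
  -- the iterated exponential.
  have hint : ∀ t ∈ Icc a T, D t ≤ Real.exp M * C * (wass 1 ρ₁ ρ₂ + ε) +
      ∫ s in a..t, (Real.exp M * m s) * D s := by
    intro t ht
    have h1 : D t ≤ ∫ z, (C * ‖z.1 - z.2‖ + ∫ s in a..t, m s * D s) * Real.exp M ∂γ :=
      integral_mono (hDi t) (((hγi.const_mul C).add (integrable_const _)).mul_const _)
        fun z => hpoint t ht z.1 z.2
    rw [integral_mul_const, integral_add (hγi.const_mul C) (integrable_const _),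
      integral_const_mul] at h1
    simp only [mul_assoc, intervalIntegral.integral_const_mul]
    simp only [integral_const, probReal_univ, one_smul] at h1
    have h2 : C * ∫ z, ‖z.1 - z.2‖ ∂γ ≤ C * (wass 1 ρ₁ ρ₂ + ε) :=
      mul_le_mul_of_nonneg_left hγε hC
    have h3 := mul_le_mul_of_nonneg_left h2 (Real.exp_pos M).le
    linarith
  refine (hwass T ⟨ha.2, le_rfl⟩).trans ?_
  have hfin := gronwall_of_le_integral (hP.integrable.const_mul (Real.exp M))
    (fun s => mul_nonneg (Real.exp_pos M).le (hP.nonneg s)) ha.2 hDc.continuousOn hint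
  rw [intervalIntegral.integral_const_mul] at hfin
  have hw0 := wass_nonneg 1 ρ₁ ρ₂
  calc D T ≤ _ := hfin
    _ ≤ Real.exp M * C * (wass 1 ρ₁ ρ₂ + ε) * Real.exp (Real.exp M * M) := by
      have := hmono T ⟨ha.2, le_rfl⟩
      gcongr
    _ = _ := by ring

theorem wass_le_of_mem_POn {R : ℝ} {μ ν : Pc (E d)}
    (hμ : μ ∈ POn (Metric.closedBall (0 : E d) R)) (hν : ν ∈ POn (Metric.closedBall (0 : E d) R)) :
    wass 1 μ ν ≤ 2 * R := by
  have hb : ∀ᵐ z ∂μ.toMeasure.prod ν.toMeasure, ‖z.1 - z.2‖ ≤ 2 * R := by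
    have h1 : ∀ᵐ z ∂μ.toMeasure.prod ν.toMeasure, ‖z.1‖ ≤ R :=
      Measure.quasiMeasurePreserving_fst.ae (ae_norm_le_of_mem_POn hμ)
    have h2 : ∀ᵐ z ∂μ.toMeasure.prod ν.toMeasure, ‖z.2‖ ≤ R :=
      Measure.quasiMeasurePreserving_snd.ae (ae_norm_le_of_mem_POn hν)
    filter_upwards [h1, h2] with z h1 h2
    linarith [norm_sub_le z.1 z.2]
  have hi : Integrable (fun z : E d × E d => ‖z.1 - z.2‖) (μ.toMeasure.prod ν.toMeasure) :=
    Integrable.of_bound (Continuous.aestronglyMeasurable (by fun_prop)) (2 * R)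
      (by simpa using hb)
  refine (wass_le_integral (P := μ.toMeasure.prod ν.toMeasure) (f := Prod.fst) (g := Prod.snd)
    measurable_fst.aemeasurable measurable_snd.aemeasurable (by simp) (by simp) hi).trans ?_
  exact (integral_mono_ae hi (integrable_const _) hb).trans (by simp)

theorem Hypotheses.exists_cost_rate (hyp : Hypotheses T v φ) {R : ℝ} (hR : 0 < R) :
    ∃ L, 0 ≤ L ∧ ∀ μ ∈ POn (Metric.closedBall (0 : E d) R),
      ∀ ν ∈ POn (Metric.closedBall (0 : E d) R), |φ μ - φ ν| ≤ L * wass 1 μ ν := by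
  obtain ⟨L, hL⟩ := hyp.cost_lipschitz R hR
  exact ⟨|L|, abs_nonneg L, fun μ hμ ν hν => (hL μ hμ ν hν).trans
    (mul_le_mul_of_nonneg_right (le_abs_self L) (wass_nonneg _ _ _))⟩

/-- All competing trajectories end in a common ball, on which φ is Lipschitz and the diameter in W₁
is finite. The costs are thus bounded below, and the real infimum is genuine. -/
theorem Hypotheses.value_le (hyp : Hypotheses T v φ) (ha : a ∈ Icc 0 T) {ρ : Pc (E d)}
    {μ : ℝ → Pc (E d)} {u : ℝ → U} (hu : u ∈ controls U T) (h : IsTrajectory T v a ρ μ u) :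
    value T v φ a ρ ≤ φ (μ T) := by
  refine csInf_le ?_ ⟨u, hu, μ, h, rfl⟩
  obtain ⟨R, hR, hρ⟩ := ρ.exists_mem_POn
  obtain ⟨S, hRS, hS⟩ := hyp.exists_uniform_support hR
  obtain ⟨L, hL0, hL⟩ := hyp.exists_cost_rate (hR.trans_le hRS)
  refine ⟨φ (μ T) - L * (2 * S), ?_⟩
  rintro c ⟨u', -, μ', h', rfl⟩
  have h1 := hS a ha ρ hρ μ u h T ⟨ha.2, le_rfl⟩
  have h2 := hS a ha ρ hρ μ' u' h' T ⟨ha.2, le_rfl⟩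
  have h3 := (le_abs_self _).trans (hL _ h1 _ h2)
  have h4 := mul_le_mul_of_nonneg_left (wass_le_of_mem_POn h1 h2) hL0
  linarith

/-- The existence of trajectories makes the set of costs nonempty, which excludes the default value
0 of the infimum. -/
theorem Hypotheses.exists_lt_value_add (hyp : Hypotheses T v φ) (ha : a ∈ Icc 0 T) (ρ : Pc (E d))
    (hU : (controls U T).Nonempty) {ε : ℝ} (hε : 0 < ε) :
    ∃ u ∈ controls U T, ∃ μ, IsTrajectory T v a ρ μ u ∧ φ (μ T) < value T v φ a ρ + ε := by
  obtain ⟨u₀, hu₀⟩ := hU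
  obtain ⟨μ₀, hμ₀⟩ := hyp.exists_isTrajectory ha ρ hu₀
  obtain ⟨c, ⟨u, hu, μ, hμ, rfl⟩, hc⟩ := Real.lt_sInf_add_pos
    (s := {c | ∃ u ∈ controls U T, ∃ μ, IsTrajectory T v a ρ μ u ∧ c = φ (μ T)})
    ⟨_, u₀, hu₀, μ₀, hμ₀, rfl⟩ hε
  exact ⟨u, hu, μ, hμ, hc⟩

theorem Hypotheses.value_terminal (hyp : Hypotheses T v φ) (hT : 0 ≤ T) (ρ : Pc (E d))
    (hU : (controls U T).Nonempty) : value T v φ T ρ = φ ρ := by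
  obtain ⟨u, hu⟩ := hU
  obtain ⟨μ, hμ⟩ := hyp.exists_isTrajectory ⟨hT, le_rfl⟩ ρ hu
  refine le_antisymm ?_ (le_csInf ⟨_, u, hu, μ, hμ, rfl⟩ ?_)
  · exact (hyp.value_le ⟨hT, le_rfl⟩ hu hμ).trans_eq (by rw [hμ.2])
  · rintro c ⟨u', -, μ', h', rfl⟩
    rw [h'.2]

/-- The value function is locally Lipschitz in the measure, uniformly in time. -/
theorem Hypotheses.exists_value_lipschitz (hyp : Hypotheses T v φ) (hU : (controls U T).Nonempty)
    {R : ℝ} (hR : 0 < R) : ∃ K, 0 ≤ K ∧ ∀ a ∈ Icc 0 T,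
      ∀ ρ₁ ∈ POn (Metric.closedBall (0 : E d) R), ∀ ρ₂ ∈ POn (Metric.closedBall (0 : E d) R),
        value T v φ a ρ₂ ≤ value T v φ a ρ₁ + K * wass 1 ρ₁ ρ₂ := by
  obtain ⟨S, hRS, hS⟩ := hyp.exists_uniform_support hR
  have hS0 := hR.trans_le hRS
  obtain ⟨L, hL0, hL⟩ := hyp.exists_cost_rate hS0
  obtain ⟨P, C, m, hP⟩ := hyp.exists_isTruncation hS0
  have hC := hP.const_nonneg
  refine ⟨L * (Real.exp (∫ s in 0..T, m s) * C *
      Real.exp (Real.exp (∫ s in 0..T, m s) * ∫ s in 0..T, m s)), by positivity,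
      fun a ha ρ₁ hρ₁ ρ₂ hρ₂ => le_of_forall_pos_le_add fun ε hε => ?_⟩
  -- A control that is nearly optimal from ρ₁ is used from ρ₂ as well, and stability compares the
  -- final costs.
  obtain ⟨u, hu, μ₁, h₁, hlt⟩ := hyp.exists_lt_value_add ha ρ₁ hU hε
  obtain ⟨μ₂, h₂⟩ := hyp.exists_isTrajectory ha ρ₂ hu
  have hT : T ∈ Icc a T := ⟨ha.2, le_rfl⟩
  have e1 := hyp.value_le ha hu h₂
  have e2 := hP.wass_le hyp ha hu h₁ h₂ (hS a ha ρ₁ hρ₁ μ₁ u h₁) (hS a ha ρ₂ hρ₂ μ₂ u h₂)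
  have e3 := (neg_le_abs _).trans
    (hL _ (hS a ha ρ₁ hρ₁ μ₁ u h₁ T hT) _ (hS a ha ρ₂ hρ₂ μ₂ u h₂ T hT))
  have e4 := mul_le_mul_of_nonneg_left e2 hL0
  rw [← mul_assoc] at e4
  linarith

/-- Along a trajectory the value function increases at most at an integrable rate. -/
theorem Hypotheses.exists_value_rate (hyp : Hypotheses T v φ) {ρ : Pc (E d)} {μ : ℝ → Pc (E d)}
    {u : ℝ → U} (hu : u ∈ controls U T) (hT : 0 ≤ T) (h : IsTrajectory T v 0 ρ μ u) :
    ∃ m : ℝ → ℝ, Integrable m ∧ ∀ s t, 0 ≤ s → s ≤ t → t ≤ T →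
      value T v φ t (μ t) - value T v φ s (μ s) ≤ ∫ r in s..t, m r := by
  obtain ⟨R₀, hR₀, hρ⟩ := ρ.exists_mem_POn
  obtain ⟨R, hR, hμR⟩ := hyp.exists_uniform_support hR₀
  have hR' := hR₀.trans_le hR
  obtain ⟨S, hRS, hS⟩ := hyp.exists_uniform_support hR'
  have hS0 := hR'.trans_le hRS
  obtain ⟨P, C, m, hP⟩ := hyp.exists_isTruncation hS0
  obtain ⟨K, hK, hV⟩ := hyp.exists_value_lipschitz ⟨u, hu⟩ hS0
  have hμ : ∀ t ∈ Icc 0 T, μ t ∈ POn (Metric.closedBall (0 : E d) R) :=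
    hμR 0 ⟨le_rfl, hT⟩ ρ hρ μ u h
  -- K is the Lipschitz constant of the value function. The 2 counts two trajectories leaving μ(s),
  -- each with speed at most m.
  refine ⟨fun t => K * (2 * m t), (hP.integrable.const_mul 2).const_mul K,
    fun s t hs hst ht => le_of_forall_pos_le_add fun ε hε => ?_⟩
  have hsT : s ∈ Icc 0 T := ⟨hs, hst.trans ht⟩
  have htT : t ∈ Icc 0 T := ⟨hs.trans hst, ht⟩
  have hts : t ∈ Icc s T := ⟨hst, ht⟩
  -- Only the easy half of dynamic programming is used: along this nearly optimal competitor, the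
  -- value at (t, μ'(t)) is at most its final cost. The values at μ(t) and μ'(t) are then compared.
  obtain ⟨u', hu', μ', h', hlt⟩ := hyp.exists_lt_value_add hsT (μ s) ⟨u, hu⟩ hε
  have hμ' := hS s hsT _ (hμ s hsT) μ' u' h'
  have hμ'' : ∀ r ∈ Icc s T, μ r ∈ POn (Metric.closedBall (0 : E d) S) :=
    fun r hr => POn_mono hRS (hμ r ⟨hs.trans hr.1, hr.2⟩)
  obtain ⟨hw₁, Y₁, hY₁, hY₁a, hYμ₁⟩ := h'.exists_flow hyp hP hsT hu' hμ'
  obtain ⟨hw₂, Y₂, hY₂, hY₂a, hYμ₂⟩ := (h.mono hs).exists_flow hyp hP hsT hu hμ''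
  have e1 := hyp.value_le htT hu' (h'.mono hst)
  have e2 := hV t htT _ (hμ' t hts) _ (hμ'' t hts)
  have e3 : wass 1 (μ' t) (μ t) ≤ 2 * ∫ r in s..t, m r := by
    rw [hYμ₁ t hts, hYμ₂ t hts]
    refine wass_map_le fun x => ?_
    have f1 := hY₁.norm_sub_le hP.integrable hw₁ x le_rfl hst ht
    have f2 := hY₂.norm_sub_le hP.integrable hw₂ x le_rfl hst ht
    rw [hY₁a] at f1
    rw [hY₂a, norm_sub_rev] at f2
    linarith [norm_sub_le_norm_sub_add_norm_sub (Y₁ t x) (P x) (Y₂ t x)]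
  have e4 := mul_le_mul_of_nonneg_left e3 hK
  rw [intervalIntegral.integral_const_mul, intervalIntegral.integral_const_mul]
  linarith

end Value

/-! ### Differentiability of flows -/

section FlowDerivative

variable {X : Type*} [NormedAddCommGroup X] [NormedSpace ℝ X] [FiniteDimensional ℝ X]
  [MeasurableSpace X] [BorelSpace X] {a b : ℝ} {m : ℝ → ℝ} {w : ℝ → X → X} {Y : ℝ → (X →ᵇ X)}

theorem IsFlow.norm_apply_sub_le (hY : IsFlow a b w Y) (hm : Integrable m) (hm0 : ∀ t, 0 ≤ m t)
    (hw : IsLipschitzField a b m w) {t : ℝ} (ht : t ∈ Icc a b) (x y : X) :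
    ‖Y t x - Y t y‖ ≤ ‖Y a x - Y a y‖ * Real.exp (∫ s in a..t, m s) := by
  have hc : Continuous fun s => ‖Y s x - Y s y‖ :=
    ((hY.continuous_apply x).sub (hY.continuous_apply y)).norm
  refine gronwall_of_le_integral hm hm0 ht.1 hc.continuousOn fun s hs => ?_
  have hs' : s ∈ Icc a b := ⟨hs.1, hs.2.trans ht.2⟩
  have ha : a ∈ Icc a b := ⟨le_rfl, ht.1.trans ht.2⟩
  rw [hY.2 s hs' x, hY.2 s hs' y, add_sub_add_comm, ← intervalIntegral.integral_sub
    (IntegrableOn.intervalIntegrable_of_Icc (hY.integrableOn hm hw x) ha hs')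
    (IntegrableOn.intervalIntegrable_of_Icc (hY.integrableOn hm hw y) ha hs')]
  refine (norm_add_le _ _).trans (add_le_add le_rfl ?_)
  refine intervalIntegral.norm_integral_le_of_norm_le hs.1 ?_
    (hm.intervalIntegrable.mul_continuousOn hc.continuousOn)
  filter_upwards [(ae_restrict_iff' measurableSet_Icc).1 hw.norm_sub_le] with r hr hr'
  exact hr ⟨hr'.1.le, hr'.2.trans hs'.2⟩ _ _

/-- Increments depend on the starting point in a Lipschitz way, with a constant proportional to ∫ m
over the time step. After division by the step this gives equicontinuity of the difference quotients
in x. -/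
theorem IsFlow.norm_increment_sub_le (hY : IsFlow a b w Y) (hm : Integrable m)
    (hm0 : ∀ t, 0 ≤ m t) (hw : IsLipschitzField a b m w) {s t : ℝ} (h1 : a ≤ s) (h2 : s ≤ t)
    (h3 : t ≤ b) (x y : X) :
    ‖(Y t x - Y s x) - (Y t y - Y s y)‖ ≤
      ‖Y a x - Y a y‖ * Real.exp (∫ r in a..b, m r) * ∫ r in s..t, m r := by
  have hs : s ∈ Icc a b := ⟨h1, h2.trans h3⟩
  have ht : t ∈ Icc a b := ⟨h1.trans h2, h3⟩
  rw [hY.sub_eq hm hw x hs ht, hY.sub_eq hm hw y hs ht, ← intervalIntegral.integral_sub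
    (IntegrableOn.intervalIntegrable_of_Icc (hY.integrableOn hm hw x) hs ht)
    (IntegrableOn.intervalIntegrable_of_Icc (hY.integrableOn hm hw y) hs ht),
    ← intervalIntegral.integral_const_mul]
  refine intervalIntegral.norm_integral_le_of_norm_le h2 ?_ (hm.intervalIntegrable.const_mul _)
  filter_upwards [(ae_restrict_iff' measurableSet_Icc).1 hw.norm_sub_le] with r hr hr'
  have hr1 : r ∈ Icc a b := ⟨h1.trans hr'.1.le, hr'.2.trans h3⟩
  refine (hr hr1 _ _).trans ?_
  rw [mul_comm]
  refine mul_le_mul_of_nonneg_right ((hY.norm_apply_sub_le hm hm0 hw hr1 x y).trans ?_) (hm0 r)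
  have := integral_mono_right hm hm0 (a := a) hr1.2
  gcongr

/-- At almost every time, all the integral curves of the flow are differentiable. -/
theorem IsFlow.ae_forall_tendsto (hY : IsFlow a b w Y) (hab : a ≤ b) (hm : Integrable m)
    (hm0 : ∀ t, 0 ≤ m t) (hw : IsLipschitzField a b m w) :
    ∀ᵐ t ∂volume.restrict (Icc a b),
      Tendsto (fun ε => ε⁻¹ * ∫ r in t..t + ε, m r) (𝓝[>] 0) (𝓝 (m t)) ∧
      ∀ x, Tendsto (fun ε => ‖ε⁻¹ • (Y (t + ε) x - Y t x) - w t (Y t x)‖) (𝓝[>] 0) (𝓝 0) := by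
  have : Nonempty X := ⟨0⟩
  -- The exceptional null set depends on x, so only a countable dense set of starting points is
  -- treated directly.
  have hD := ae_all_iff.2 fun n => hY.ae_hasDerivAt hab hm hw (TopologicalSpace.denseSeq X n)
  rw [← restrict_Ioo_eq_restrict_Icc] at hD ⊢
  filter_upwards [hD, ae_restrict_of_ae_restrict_of_subset Ioo_subset_Icc_self
    (ae_hasDerivAt_primitive hab hm.integrableOn),
    ae_restrict_of_ae_restrict_of_subset Ioo_subset_Icc_self hw.norm_sub_le,
    ae_restrict_mem measurableSet_Ioo] with t hx hmt hwt ht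
  have hq : Tendsto (fun ε => ε⁻¹ * ∫ r in t..t + ε, m r) (𝓝[>] 0) (𝓝 (m t)) := by
    have := hmt.tendsto_slope_zero_right
    refine this.congr fun ε => ?_
    rw [integral_rate_eq_sub hm a t (t + ε), smul_eq_mul]
  refine ⟨hq, fun x => ?_⟩
  set E := Real.exp (∫ r in a..b, m r)
  rw [Metric.tendsto_nhds]
  intro η hη
  have hcont : Continuous fun y => ‖Y a x - Y a y‖ * E * (m t + 1) + m t * ‖Y t x - Y t y‖ := by
    have := (Y a).continuous
    have := (Y t).continuous
    fun_prop
  -- The total error of moving from x to a nearby dense point y: the change of the difference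
  -- quotient, whose mean rate is eventually below m(t) + 1, and the change of the velocity.
  have hopen : IsOpen {y | ‖Y a x - Y a y‖ * E * (m t + 1) + m t * ‖Y t x - Y t y‖ < η / 2} :=
    isOpen_lt hcont continuous_const
  obtain ⟨n, hn⟩ := (TopologicalSpace.denseRange_denseSeq X).exists_mem_open hopen
    ⟨x, by simpa using hη⟩
  have hlim := (hx n).tendsto_slope_zero_right
  rw [tendsto_iff_norm_sub_tendsto_zero] at hlim
  filter_upwards [self_mem_nhdsWithin, hq.eventually_lt_const (lt_add_one (m t)),
    hlim.eventually_lt_const (half_pos hη),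
    nhdsWithin_le_nhds (Iio_mem_nhds (sub_pos.2 ht.2))] with ε hε hqε hgε htε
  set y := TopologicalSpace.denseSeq X n
  have hε' : 0 < ε := hε
  have htb : t + ε ≤ b := by have : ε < b - t := htε; linarith
  rw [dist_zero_right, norm_norm]
  have e1 := hY.norm_increment_sub_le hm hm0 hw ht.1.le (by linarith : t ≤ t + ε) htb x y
  have e2 : ‖ε⁻¹ • ((Y (t + ε) x - Y t x) - (Y (t + ε) y - Y t y))‖ ≤
      ‖Y a x - Y a y‖ * E * (m t + 1) := by
    rw [norm_smul, norm_inv, Real.norm_of_nonneg hε'.le]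
    calc ε⁻¹ * _ ≤ ε⁻¹ * (‖Y a x - Y a y‖ * E * ∫ r in t..t + ε, m r) := by gcongr
      _ = ‖Y a x - Y a y‖ * E * (ε⁻¹ * ∫ r in t..t + ε, m r) := by ring
      _ ≤ _ := by gcongr
  have e3 := hwt (Y t x) (Y t y)
  have e4 : ε⁻¹ • (Y (t + ε) x - Y t x) - w t (Y t x) =
      ε⁻¹ • ((Y (t + ε) x - Y t x) - (Y (t + ε) y - Y t y)) - (w t (Y t x) - w t (Y t y)) +
      (ε⁻¹ • (Y (t + ε) y - Y t y) - w t (Y t y)) := by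
    rw [smul_sub ε⁻¹ (Y (t + ε) x - Y t x)]; abel
  have hn' : ‖Y a x - Y a y‖ * E * (m t + 1) + m t * ‖Y t x - Y t y‖ < η / 2 := hn
  rw [e4]
  refine (norm_add_le _ _).trans_lt ?_
  have e5 := _root_.norm_sub_le (ε⁻¹ • ((Y (t + ε) x - Y t x) - (Y (t + ε) y - Y t y)))
    (w t (Y t x) - w t (Y t y))
  linarith

/-- Dominated convergence: for small ε the difference quotient is at most m(t) + 1 and the velocity
at most m(t). This makes the first-order expansion of the flow hold in W₁ after push-forward. -/
theorem IsFlow.ae_tendsto_integral (hY : IsFlow a b w Y) (hab : a ≤ b) (hm : Integrable m)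
    (hm0 : ∀ t, 0 ≤ m t) (hw : IsLipschitzField a b m w) (ρ : Pc X) :
    ∀ᵐ t ∂volume.restrict (Icc a b), Tendsto (fun ε =>
      ∫ x, ‖ε⁻¹ • (Y (t + ε) x - Y t x) - w t (Y t x)‖ ∂ρ.toMeasure) (𝓝[>] 0) (𝓝 0) := by
  have key := hY.ae_forall_tendsto hab hm hm0 hw
  rw [← restrict_Ioo_eq_restrict_Icc] at key ⊢
  filter_upwards [key,
    ae_restrict_of_ae_restrict_of_subset Ioo_subset_Icc_self hw.norm_le,
    ae_restrict_of_ae_restrict_of_subset Ioo_subset_Icc_self hw.ae_continuous,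
    ae_restrict_mem measurableSet_Ioo] with t hx hwt hwc ht
  have hlim := tendsto_integral_filter_of_dominated_convergence (μ := ρ.toMeasure)
    (l := 𝓝[>] (0 : ℝ)) (F := fun ε x => ‖ε⁻¹ • (Y (t + ε) x - Y t x) - w t (Y t x)‖)
    (f := fun _ => 0) (fun _ => m t + 1 + m t) ?_ ?_ (integrable_const _)
    (Eventually.of_forall fun x => hx.2 x)
  · simpa using hlim
  · refine Eventually.of_forall fun ε => Continuous.aestronglyMeasurable ?_
    have h1 := (Y t).continuous
    have h2 := (Y (t + ε)).continuous
    exact (((h2.sub h1).const_smul _).sub (hwc.comp h1)).norm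
  · filter_upwards [self_mem_nhdsWithin, hx.1.eventually_lt_const (lt_add_one (m t)),
      nhdsWithin_le_nhds (Iio_mem_nhds (sub_pos.2 ht.2))] with ε hε hqε htε
    have hε' : 0 < ε := hε
    have htb : t + ε ≤ b := by have : ε < b - t := htε; linarith
    refine Eventually.of_forall fun x => ?_
    rw [norm_norm]
    refine (_root_.norm_sub_le _ _).trans (add_le_add ?_ (hwt _))
    rw [norm_smul, norm_inv, Real.norm_of_nonneg hε'.le]
    refine le_trans ?_ hqε.le
    have := hY.norm_sub_le hm hw x ht.1.le (by linarith : t ≤ t + ε) htb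
    gcongr

end FlowDerivative

/-! ### The Dini superdifferential along a trajectory -/

section Verification

variable {d : ℕ} {U : Type*} [MetricSpace U] [CompactSpace U] [MeasurableSpace U] [BorelSpace U]
  {T : ℝ} {v : ℝ → Pc (E d) → U → E d → E d} {φ : Pc (E d) → ℝ}

/-- Disintegrate ν over its first marginal and move the inner integral over r into the inner
product, where g(x) is constant. -/
theorem integral_inner_barycenter {ν : Pc (E d × E d)} {g : E d → E d} (hg : Continuous g) {B : ℝ}
    (hB : ∀ x, ‖g x‖ ≤ B) : ∫ x, ⟪barycenter ν x, g x⟫_ℝ ∂ν.fst.toMeasure =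
      ∫ z, ⟪z.2, g z.1⟫_ℝ ∂ν.toMeasure := by
  have hsnd : Integrable (fun z : E d × E d => z.2) ν.toMeasure :=
    ν.integrable_norm.mono' measurable_snd.aestronglyMeasurable
      (Eventually.of_forall fun z => _root_.norm_snd_le z)
  have hint : Integrable (fun z : E d × E d => ⟪z.2, g z.1⟫_ℝ) ν.toMeasure := by
    refine (ν.integrable_norm.mul_const B).mono'
      (Continuous.aestronglyMeasurable (by fun_prop)) (Eventually.of_forall fun z => ?_)
    refine (norm_inner_le_norm _ _).trans ?_
    exact mul_le_mul (_root_.norm_snd_le z) (hB _) (norm_nonneg _) (norm_nonneg _)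
  rw [← Measure.integral_condKernel hint]
  refine integral_congr_ae ?_
  filter_upwards [hsnd.condKernel_ae] with x hx
  rw [barycenter, real_inner_comm, ← integral_inner hx]
  exact integral_congr_ae (Eventually.of_forall fun r => real_inner_comm _ _)

theorem upperDini_eventually_le {V : ℝ → Pc (E d) → ℝ} {t : ℝ} {μ : Pc (E d)}
    {F : Lp (E d) ⊤ μ.toMeasure} (h : upperDini V t μ 1 F ≤ 0) {η : ℝ} (hη : 0 < η) :
    ∀ᶠ ε in 𝓝[>] (0 : ℝ), V (t + ε) (μ.perturb F ε) - V t μ ≤ η * ε := by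
  have h1 : upperDini V t μ 1 F < (η : EReal) := h.trans_lt (by exact_mod_cast hη)
  filter_upwards [eventually_lt_of_limsup_lt h1, self_mem_nhdsWithin] with ε hε hε0
  have h2 : (V (t + ε * 1) (μ.perturb F ε) - V t μ) / ε < η := by exact_mod_cast hε
  rw [mul_one, div_lt_iff₀ hε0] at h2
  exact h2.le

/-- The value function is almost everywhere right-differentiable along the trajectory from above,
with nonpositive slope. -/
theorem Hypotheses.ae_value_le (hyp : Hypotheses T v φ) (hT : 0 ≤ T) {ρ : Pc (E d)}
    {μ : ℝ → Pc (E d)} {u : ℝ → U} (hu : u ∈ controls U T) (h : IsTrajectory T v 0 ρ μ u)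
    {ν : ℝ → Pc (E d × E d)} (hν : ∀ t ∈ Icc 0 T, (ν t).fst = μ t)
    (hsens : ∀ᵐ t ∂volume.restrict (Icc 0 T), MemDiniSuperdifferential (value T v φ) t (μ t)
      (hamiltonian v t (ν t) (u t)) (fun x => -barycenter (ν t) x)) :
    ∀ᵐ t ∂volume.restrict (Icc 0 T), ∀ η > 0, ∀ᶠ ε in 𝓝[>] (0 : ℝ),
      value T v φ (t + ε) (μ (t + ε)) - value T v φ t (μ t) ≤ η * ε := by
  obtain ⟨R₀, hR₀, hρ⟩ := ρ.exists_mem_POn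
  obtain ⟨S, hRS, hS⟩ := hyp.exists_uniform_support hR₀
  have hS0 := hR₀.trans_le hRS
  obtain ⟨P, C, m, hP⟩ := hyp.exists_isTruncation hS0
  have hμ := hS 0 ⟨le_rfl, hT⟩ ρ hρ μ u h
  obtain ⟨hw, Y, hY, hYa, hYμ⟩ := h.exists_flow hyp hP ⟨le_rfl, hT⟩ hu hμ
  have key := hY.ae_tendsto_integral hT hP.integrable hP.nonneg hw ρ
  rw [← restrict_Ioo_eq_restrict_Icc] at key hsens ⊢
  filter_upwards [key, hsens,
    ae_restrict_of_ae_restrict_of_subset Ioo_subset_Icc_self hw.norm_le,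
    ae_restrict_of_ae_restrict_of_subset Ioo_subset_Icc_self hw.ae_continuous,
    ae_restrict_mem measurableSet_Ioo] with t hlim hdini hwt hwc ht η hη
  have htI : t ∈ Icc 0 T := Ioo_subset_Icc_self ht
  set w : E d → E d := fun x => v t (μ t) (u t) (P x) with hwdef
  have hLp : MemLp w ⊤ (μ t).toMeasure :=
    memLp_top_of_bound hwc.aestronglyMeasurable (m t) (Eventually.of_forall hwt)
  set F : Lp (E d) ⊤ (μ t).toMeasure := hLp.toLp w
  have hF : ∀ᵐ x ∂(μ t).toMeasure, F x = w x := hLp.coeFn_toLp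
  -- The cancellation behind the theorem: in the direction (1, F) the linear form of the
  -- superdifferential is −ℍ + ℍ. Truncation does not affect ℍ, because the first marginal of ν(t)
  -- is μ(t), which lives where P is the identity.
  have hzero : ∫ x, ⟪-barycenter (ν t) x, F x⟫_ℝ ∂(μ t).toMeasure +
      hamiltonian v t (ν t) (u t) * 1 = 0 := by
    have e1 : ∫ x, ⟪-barycenter (ν t) x, F x⟫_ℝ ∂(μ t).toMeasure =
        -∫ x, ⟪barycenter (ν t) x, w x⟫_ℝ ∂(μ t).toMeasure := by
      rw [← integral_neg]
      refine integral_congr_ae ?_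
      filter_upwards [hF] with x hx
      rw [hx, inner_neg_left]
    have e2 : hamiltonian v t (ν t) (u t) = ∫ z, ⟪z.2, w z.1⟫_ℝ ∂(ν t).toMeasure := by
      refine integral_congr_ae ?_
      have h1 : ∀ᵐ x ∂(ν t).toMeasure.map Prod.fst, ‖x‖ ≤ S := by
        change ∀ᵐ x ∂(ν t).fst.toMeasure, ‖x‖ ≤ S
        rw [hν t htI]
        exact ae_norm_le_of_mem_POn (hμ t htI)
      filter_upwards [ae_of_ae_map measurable_fst.aemeasurable h1] with z hz
      simp only [hwdef]
      rw [hν t htI, hP.eq_self _ hz]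
    rw [e1, e2, ← integral_inner_barycenter hwc hwt, hν t htI]
    ring
  have hdini' := hdini.2 1 F
  rw [hzero] at hdini'
  -- For ε < 1, the perturbed measure stays in the ball of radius S + m(t), as |F| ≤ m(t) a.e.
  obtain ⟨K, hK, hV⟩ := hyp.exists_value_lipschitz ⟨u, hu⟩ (R := S + m t)
    (by linarith [hP.nonneg t])
  have hKlim := hlim.const_mul K
  rw [mul_zero] at hKlim
  filter_upwards [upperDini_eventually_le hdini' (half_pos hη), self_mem_nhdsWithin,
    hKlim.eventually_lt_const (half_pos hη),
    nhdsWithin_le_nhds (Iio_mem_nhds (sub_pos.2 ht.2)),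
    nhdsWithin_le_nhds (Iio_mem_nhds zero_lt_one)] with ε hε hε0 hεK hεT hε1
  have hε' : 0 < ε := hε0
  have hε1' : ε < 1 := hε1
  have htε : t + ε ∈ Icc 0 T := ⟨by linarith [ht.1], by have : ε < T - t := hεT; linarith⟩
  have hmeas : AEMeasurable (fun x => x + ε • F x) (μ t).toMeasure :=
    aemeasurable_id.add ((Lp.aestronglyMeasurable F).aemeasurable.const_smul ε)
  have hpert : (μ t).perturb F ε ∈ POn (Metric.closedBall (0 : E d) (S + m t)) := by
    refine mem_POn_of_ae_norm_le ((ae_map_iff hmeas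
      (measurableSet_le measurable_norm measurable_const)).2 ?_)
    filter_upwards [hF, ae_norm_le_of_mem_POn (hμ t htI)] with x hx hxS
    rw [hx]
    refine (norm_add_le _ _).trans (add_le_add hxS ?_)
    rw [norm_smul, Real.norm_of_nonneg hε'.le]
    have h1 := hwt x
    have h2 := norm_nonneg (w x)
    nlinarith
  have hμε := POn_mono (by linarith [hP.nonneg t] : S ≤ S + m t) (hμ (t + ε) htε)
  have h1 := hV (t + ε) htε _ hpert _ hμε
  have hYt := (Y t).continuous
  have hYtε := (Y (t + ε)).continuous
  have hc : Continuous fun x => Y t x + ε • w (Y t x) :=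
    hYt.add ((hwc.comp hYt).const_smul ε)
  -- Both measures are images of ρ, under Y(t) + ε w(Y(t)) and Y(t + ε). The coupling through the
  -- common starting point gives ε times the mean error of the difference quotients.
  have h2 : wass 1 ((μ t).perturb F ε) (μ (t + ε)) ≤
      ε * ∫ x, ‖ε⁻¹ • (Y (t + ε) x - Y t x) - w (Y t x)‖ ∂ρ.toMeasure := by
    rw [← integral_const_mul]
    have hi : Integrable (fun x => ‖(Y t x + ε • w (Y t x)) - Y (t + ε) x‖) ρ.toMeasure := by
      refine Integrable.of_bound (hc.sub hYtε).norm.aestronglyMeasurable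
        (‖Y t‖ + ε * m t + ‖Y (t + ε)‖) (Eventually.of_forall fun x => ?_)
      rw [norm_norm]
      refine (norm_sub_le _ _).trans (add_le_add ((norm_add_le _ _).trans (add_le_add
        ((Y t).norm_coe_le_norm x) ?_)) ((Y (t + ε)).norm_coe_le_norm x))
      rw [norm_smul, Real.norm_of_nonneg hε'.le]
      exact mul_le_mul_of_nonneg_left (hwt _) hε'.le
    have hmap : ρ.toMeasure.map (fun x => Y t x + ε • w (Y t x)) =
        ((μ t).perturb F ε).toMeasure := by
      have e1 : ((μ t).perturb F ε).toMeasure =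
          (μ t).toMeasure.map (fun x => x + ε • w x) := by
        refine Measure.map_congr ?_
        filter_upwards [hF] with x hx
        rw [hx]
      have e2 : (μ t).toMeasure = ρ.toMeasure.map (Y t) := congrArg Pc.toMeasure (hYμ t htI)
      have hc' : Continuous fun x => x + ε • w x := continuous_id.add (hwc.const_smul ε)
      rw [e1, e2, Measure.map_map hc'.measurable hYt.measurable]
      rfl
    refine (wass_le_integral hc.measurable.aemeasurable hYtε.measurable.aemeasurable hmap
      (congrArg Pc.toMeasure (hYμ (t + ε) htε)).symm hi).trans_eq ?_
    refine integral_congr_ae (Eventually.of_forall fun x => ?_)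
    have e3 : Y t x + ε • w (Y t x) - Y (t + ε) x =
        -(ε • (ε⁻¹ • (Y (t + ε) x - Y t x) - w (Y t x))) := by
      rw [smul_sub, smul_smul, mul_inv_cancel₀ hε'.ne', one_smul]; abel
    simp only
    rw [e3, norm_neg, norm_smul, Real.norm_of_nonneg hε'.le]
  have h3 := mul_le_mul_of_nonneg_left h2 hK
  have h4 := mul_le_mul_of_nonneg_right hεK.le hε'.le
  have h5 : K * (ε * ∫ x, ‖ε⁻¹ • (Y (t + ε) x - Y t x) - w (Y t x)‖ ∂ρ.toMeasure) ≤ η / 2 * ε := by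
    refine le_trans (le_of_eq ?_) h4
    ring
  linarith

end Verification

end MeanField

/-! ### Conclusion: the verification theorem. -/

theorem mainTheorem9 {d : ℕ} {U : Type*} [MetricSpace U] [CompactSpace U] [MeasurableSpace U]
    [BorelSpace U] (T : ℝ) (hT : 0 < T)
    (v : ℝ → MeanField.Pc (MeanField.E d) → U → MeanField.E d → MeanField.E d)
    (φ : MeanField.Pc (MeanField.E d) → ℝ) (hyp : MeanField.Hypotheses T v φ)
    (μ₀ : MeanField.Pc (MeanField.E d))
    (μ : ℝ → MeanField.Pc (MeanField.E d)) (u : ℝ → U)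
    (hadm : MeanField.IsAdmissible T v μ₀ μ u)
    (ν : ℝ → MeanField.Pc (MeanField.E d × MeanField.E d))
    (hPMP : MeanField.SatisfiesPMP T v φ μ u ν)
    (hsens : ∀ᵐ t ∂volume.restrict (Icc 0 T),
      MeanField.MemDiniSuperdifferential (MeanField.value T v φ) t (μ t)
        (MeanField.hamiltonian v t (ν t) (u t)) (fun x => -MeanField.barycenter (ν t) x)) :
    MeanField.IsOptimal T v φ μ₀ μ u := by
  refine ⟨hadm, fun μ' u' hadm' => ?_⟩
  obtain ⟨hu, h⟩ := hadm
  obtain ⟨m, hm, hV⟩ := hyp.exists_value_rate hu hT.le h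
  -- The value at (T, μ(T)), which is the final cost, is at most the value at (0, μ⁰).
  have hle := MeanField.le_of_ae_right_derivative_nonpos
    (f := fun t => MeanField.value T v φ t (μ t)) hm hT.le hV
    (hyp.ae_value_le hT.le hu h hPMP.marginal hsens)
  have h0 := hyp.value_le ⟨le_rfl, hT.le⟩ hadm'.1 hadm'.2
  simp only [h.2, hyp.value_terminal hT.le (μ T) ⟨u, hu⟩] at hle
  exact hle.trans h0
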